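/- **Setting.** Let $m,r\in\mathbb N$, $r\ge1$, $n=rm$, and let $A\in\mathbb R^{n\times n}$, $B,C^\top\in\mathbb R^{n\times m}$ be such that the system $\dot x=Ax+Bu$, $y=Cx$ has strict relative degree $r$, i.e. $CA^kB=0$ for $k=0,\dots,r-2$ and $\Gamma:=CA^{r-1}B$ is invertible, and assume $\Gamma+\Gamma^\top>0$. Since $n=rm$ (trivial internal dynamics), in the coordinates $(y,\dot y,\dots,y^{(r-1)})=Ux$, $U$ invertible, the system reads $$y^{(r)}(t)=\sum_{i=1}^rR_i\,y^{(i-1)}(t)+\Gamma u(t),\qquad (y(0),\dots,y^{(r-1)}(0))=(y_0^0,\dots,y_{r-1}^0).\tag{1}$$ Let $\beta\ge0$ with $\sum_{i=1}^r\|R_i\|\le\beta-\frac{spM+\mu}{\mu}$, where $s=p=M=0$ and $\mu=1$, i.e. $\sum_{i=1}^r\|R_i\|\le\beta-1$ (spectral norms). Let $y_{\rm ref}\in\mathcal W^{r,\infty}(\mathbb R_{\ge0};\mathbb R^m)$ (continuous representative), $x_{\rm ref}:=(y_{\rm ref},\dots,y_{\rm ref}^{(r-1)})$, $e:=y-y_{\rm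 ref}$, and let $\|\cdot\|_\infty$ be the $L^\infty$ norm on $\mathbb R_{\ge0}$ (with the Euclidean norm in the values). **Availability.** Let $a:\mathbb R_{\ge0}\to\{0,1\}$ be left-continuous with finitely many jumps in each compact interval. Let $\Delta>0$ and $\delta>0$ be arbitrary, and suppose that every interval $(t_1,t_2]$ on which $a=0$ has length at most $\Delta$, that $a=1$ on $[0,\delta]$, and that whenever a loss ends at a time $t_1$ (i.e. $a(t_1)=0$ and $a=1$ directly after $t_1$) we have $a=1$ on $(t_1,t_1+\delta]$. **Design.** Let $\alpha(\sigma)=1/(1-\sigma)$, $\tilde\alpha(\sigma)=(1+\sigma)/(1-\sigma)^2$, $\hat\alpha^\dagger(z)=z/(1+z)$. Let $q\in(0,1)$ and $A_r:=\sum_{j=0}^r\alpha(q^2)^j$. Let $\eta^*>0$ satisfy $\eta^*\ge(\|x_{\rm ref}\|_\infty+1)e^{\beta\Delta+\delta}$ (the other lower bounds on $\eta^*$ in the general design vanish for $s=p=M=0$, $\mu=1$). Let $$\Phi=\Big\{\phi\in\mathcal C^1(\mathbb R_{\ge0};\mathbb R):\ \forall\,t_2\ge t_1\ge0:\ 0<\phi(t_1)\le\phi(t_2),\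 \ \exists\,d>0\ \forall\,t\ge0:\ |\dot\phi(t)|\le d(1+\phi(t))\Big\}.$$ Let $\varphi_0\in\Phi$, with a constant $d>0$ as in this definition, satisfy $$0\le\varphi_0(0)\le\frac{q}{A_rE},\qquad E:=\|x_{\rm ref}\|_\infty(1+e^{\beta\Delta})+e^{\beta\Delta},$$ and $\varphi_0(\rho)\ge\chi$ for some $\rho\in(0,\delta)$. Here $\chi$ is defined as follows. Let $e^{(i)}(0)=y_i^0-y_{\rm ref}^{(i)}(0)$, $e_1^0=\varphi_0(0)e(0)$, $e_k^0=\varphi_0(0)e^{(k-1)}(0)+\alpha(\|e_{k-1}^0\|^2)e_{k-1}^0$, $c_0=0$, $\mu_0=d(1+\varphi_0(0))/\varphi_0(0)$, $$\mu_k=1+\mu_0\big(1+c_{k-1}\alpha(c_{k-1}^2)\big)+\tilde\alpha(c_{k-1}^2)\big(\mu_{k-1}+c_{k-1}\alpha(c_{k-1}^2)\big)\quad(k\ge1),$$ $c_1=\max\{\|e_1^0\|^2,\hat\alpha^\dagger(1+\mu_0),q^2\}^{1/2}$, $c_k=\max\{\|e_k^0\|^2,\hat\alpha^\dagger(\mu_k),q^2\}^{1/2}$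 for $k\ge2$, and $$\chi=\sum_{i=1}^{r-1}\big(c_i+c_{i-1}\alpha(c_{i-1}^2)\big)+\big(1+c_{r-1}\alpha(c_{r-1}^2)\big).$$ **Feedback.** Let $\tau(t)$ be the last time in $[0,t]$ at which $a=0$ ($\tau(t)=0$ if there is none), $\varphi(t)=0$ if $a(t)=0$ and $\varphi(t)=\varphi_0(t-\tau(t))$ if $a(t)=1$, and $$e_1=\varphi e,\quad e_{i+1}=\varphi e^{(i)}+\alpha(\|e_i\|^2)e_i\ (i=1,\dots,r-1),\quad u=-a\,\alpha(\|e_r\|^2)\,e_r.\tag{2}$$ A solution of (1), (2) on $[0,\omega)$, $\omega\in(0,\infty]$, is a function $y\in\mathcal C^{r-1}([0,\omega),\mathbb R^m)$ with the given initial values such that $y^{(r-1)}$ is locally absolutely continuous and (1), with $u$ from (2), holds for almost all $t\in[0,\omega)$. It is maximal if it has no proper right extension that is also a solution. **Claim.** If $\|e_i(0)\|<1$ for $i=1,\dots,r$, then (1), (2) has a solution, every solution can be extended to a maximal solution, and every maximal solution $y:[0,\omega)\to\mathbb R^m$ satisfies: 1. $\omega=\infty$; 2. $\varphi(t)\|e(t)\|<1$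 for all $t\ge0$; moreover $\|e_i(t)\|<1$ for all $t\ge0$ and $i=1,\dots,r$, so that (2) is well defined along the solution; 3. $u\in\mathcal L^\infty(\mathbb R_{\ge0};\mathbb R^m)$ and $y\in\mathcal W^{r,\infty}(\mathbb R_{\ge0};\mathbb R^m)$. -/

import Mathlib

open Set MeasureTheory Topology Filter
open scoped ENNReal

namespace FunnelControl

/-- `ℝᵐ` with the Euclidean norm. -/
abbrev Vec (m : ℕ) : Type := EuclideanSpace ℝ (Fin m)

/-! ## Linear systems and the class `Σ_{m,r}` -/

open scoped Matrix.Norms.L2Operator in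
/-- The matrix norm induced by the Euclidean norms. -/
noncomputable def matNorm {k l : ℕ} (M : Matrix (Fin k) (Fin l) ℝ) : ℝ := ‖M‖

open scoped Matrix.Norms.L2Operator in
/-- The matrix exponential `e^{Qt}`. -/
noncomputable def matExp {k : ℕ} (Q : Matrix (Fin k) (Fin k) ℝ) (t : ℝ) :
    Matrix (Fin k) (Fin k) ℝ := NormedSpace.exp (t • Q)

/-- The high frequency gain `Γ = C A^{r-1} B`. -/
def gainMatrix {n m : ℕ} (r : ℕ) (A : Matrix (Fin n) (Fin n) ℝ)
    (B : Matrix (Fin n) (Fin m) ℝ) (C : Matrix (Fin m) (Fin n) ℝ) : Matrix (Fin m) (Fin m) ℝ :=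
  C * A ^ (r - 1) * B

/-- Strict relative degree `r`: `C A^k B = 0` for `k = 0, …, r - 2`, and `C A^{r-1} B` is
invertible. -/
def HasStrictRelDeg {n m : ℕ} (r : ℕ) (A : Matrix (Fin n) (Fin n) ℝ)
    (B : Matrix (Fin n) (Fin m) ℝ) (C : Matrix (Fin m) (Fin n) ℝ) : Prop :=
  (∀ k : ℕ, k + 2 ≤ r → C * A ^ k * B = 0) ∧ IsUnit (gainMatrix r A B C)

/-- The matrix `U` of the coordinate change `(y, …, y^{(r-1)}, η) = U x`, where
`y^{(i)} = C A^i x` and `η = N x`. -/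
def coordMatrix {n m k : ℕ} (r : ℕ) (A : Matrix (Fin n) (Fin n) ℝ)
    (C : Matrix (Fin m) (Fin n) ℝ) (N : Matrix (Fin k) (Fin n) ℝ) :
    Matrix ((Fin r × Fin m) ⊕ Fin k) (Fin n) ℝ :=
  Matrix.of (Sum.elim (fun p => (C * A ^ (p.1 : ℕ)) p.2) (fun j => N j))

/-- In coordinates `(y, …, y^{(r-1)}, η) = U x` with `U` invertible, the system
`ẋ = A x + B u`, `y = C x` of strict relative degree `r` reads
`y^{(r)} = ∑ i = 1..r, R_i y^{(i-1)} + S η + Γ u`, `η̇ = Q η + P y`.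
The matrix `R_i` is `R (i - 1)`, and `k = n - r m` is the dimension of `η`. -/
def IsNormalForm {n m r k : ℕ} (A : Matrix (Fin n) (Fin n) ℝ)
    (B : Matrix (Fin n) (Fin m) ℝ) (C : Matrix (Fin m) (Fin n) ℝ)
    (R : Fin r → Matrix (Fin m) (Fin m) ℝ) (S : Matrix (Fin m) (Fin k) ℝ)
    (Q : Matrix (Fin k) (Fin k) ℝ) (P : Matrix (Fin k) (Fin m) ℝ) : Prop :=
  ∃ N : Matrix (Fin k) (Fin n) ℝ,
    Function.Bijective (coordMatrix r A C N).mulVec ∧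
    C * A ^ r = ∑ i : Fin r, R i * (C * A ^ (i : ℕ)) + S * N ∧
    N * A = Q * N + P * C ∧
    N * B = 0

/-- The constants `s, p, M, μ, β` parametrising the system class. -/
structure ClassParams where
  s : ℝ
  p : ℝ
  M : ℝ
  μ : ℝ
  β : ℝ

/-- The choice `s = p = M = 0`, `μ = 1` for trivial internal dynamics. -/
def trivialParams (β : ℝ) : ClassParams := ⟨0, 0, 0, 1, β⟩

/-- Membership of a system (with its normal form) in `Σ_{m,r}`, for the constants `c`. -/
structure InSystemClass {n m r k : ℕ} (c : ClassParams) (A : Matrix (Fin n) (Fin n) ℝ)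
    (B : Matrix (Fin n) (Fin m) ℝ) (C : Matrix (Fin m) (Fin n) ℝ)
    (R : Fin r → Matrix (Fin m) (Fin m) ℝ) (S : Matrix (Fin m) (Fin k) ℝ)
    (Q : Matrix (Fin k) (Fin k) ℝ) (P : Matrix (Fin k) (Fin m) ℝ) : Prop where
  params_nonneg : 0 ≤ c.s ∧ 0 ≤ c.p ∧ 0 ≤ c.M ∧ 0 ≤ c.μ ∧ 0 ≤ c.β
  relDeg : HasStrictRelDeg r A B C
  normalForm : IsNormalForm A B C R S Q P
  hurwitz : ∀ z ∈ spectrum ℂ (Q.map (algebraMap ℝ ℂ)), z.re < 0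
  exp_bound : ∀ t : ℝ, 0 ≤ t → matNorm (matExp Q t) ≤ c.M * Real.exp (-c.μ * t)
  S_bound : matNorm S ≤ c.s
  P_bound : matNorm P ≤ c.p
  R_bound : ∑ i, matNorm (R i) ≤ c.β - (c.s * c.p * c.M + c.μ) / c.μ
  gain_posDef : (gainMatrix r A B C + (gainMatrix r A B C).transpose).PosDef

/-! ## Sobolev spaces and reference signals -/

/-- `g` is a weak derivative of `f` on `(0, ∞)`. -/
def HasWeakDeriv {m : ℕ} (f g : ℝ → Vec m) : Prop :=
  ∀ θ : ℝ → ℝ, ContDiff ℝ ((⊤ : ℕ∞) : WithTop ℕ∞) θ → HasCompactSupport θ → tsupport θ ⊆ Ioi 0 →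
    ∫ t in Ioi (0 : ℝ), deriv θ t • f t = -∫ t in Ioi (0 : ℝ), θ t • g t

/-- `f ∈ W^{k,∞}(ℝ≥0; ℝᵐ)`: the weak derivatives `f, f', …, f^{(k)}` exist and lie in `L^∞`. -/
def MemSobolevInf {m : ℕ} (k : ℕ) (f : ℝ → Vec m) : Prop :=
  ∃ g : ℕ → ℝ → Vec m, g 0 = f ∧
    (∀ i ≤ k, MemLp (g i) ∞ (volume.restrict (Ici 0))) ∧
    (∀ i < k, HasWeakDeriv (g i) (g (i + 1)))

/-- The `L^∞` norm on `ℝ≥0`. -/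
noncomputable def supNorm {E : Type*} [NormedAddCommGroup E] (f : ℝ → E) : ℝ :=
  (eLpNorm f ∞ (volume.restrict (Ici 0))).toReal

/-- `x_ref = (y_ref, y_ref', …, y_ref^{(r-1)})`, with values in Euclidean `ℝ^{rm}`. -/
noncomputable def refState {m : ℕ} (r : ℕ) (yref : ℝ → Vec m) (t : ℝ) :
    PiLp 2 (fun _ : Fin r => Vec m) :=
  WithLp.toLp 2 (fun i : Fin r => iteratedDerivWithin (i : ℕ) yref (Ici 0) t)

/-! ## Availability of the measurement -/

/-- `a : ℝ≥0 → {0, 1}` is left-continuous and has finitely many jumps in each compact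
interval. -/
structure IsAvailability (a : ℝ → ℝ) : Prop where
  values : ∀ t, 0 ≤ t → a t = 0 ∨ a t = 1
  left_cont : ∀ t, 0 < t → ContinuousWithinAt a (Iic t) t
  finite_jumps : ∀ T : ℝ, {t ∈ Icc 0 T | ¬ ContinuousWithinAt a (Ici 0) t}.Finite

/-- Every interval `(t₁, t₂]` on which the measurement is lost has length at most `Δ`. -/
def LossAtMost (a : ℝ → ℝ) (Δ : ℝ) : Prop :=
  ∀ t₁ t₂ : ℝ, 0 ≤ t₁ → t₁ < t₂ → (∀ t ∈ Ioc t₁ t₂, a t = 0) → t₂ - t₁ ≤ Δ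

/-- Whenever the measurement is available, initially or after a loss ending at time `t₁`, it
stays available for at least the time `δ`. -/
def AvailableAtLeast (a : ℝ → ℝ) (δ : ℝ) : Prop :=
  (∀ t ∈ Icc 0 δ, a t = 1) ∧
  ∀ t₁ : ℝ, 0 ≤ t₁ → a t₁ = 0 → (∃ ε > 0, ∀ t ∈ Ioc t₁ (t₁ + ε), a t = 1) →
    ∀ t ∈ Ioc t₁ (t₁ + δ), a t = 1

/-! ## The set `Φ` of funnel functions -/

/-- `d > 0` satisfies `|φ'(t)| ≤ d (1 + φ(t))` for all `t ≥ 0`. -/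
def IsGrowthConst (φ : ℝ → ℝ) (d : ℝ) : Prop :=
  0 < d ∧ ∀ t, 0 ≤ t → |derivWithin φ (Ici 0) t| ≤ d * (1 + φ t)

/-- The set `Φ`. -/
def funnelFunctions : Set (ℝ → ℝ) :=
  {φ | ContDiffOn ℝ 1 φ (Ici 0) ∧ (∀ t₁ t₂, 0 ≤ t₁ → t₁ ≤ t₂ → 0 < φ t₁ ∧ φ t₁ ≤ φ t₂) ∧
    ∃ d, IsGrowthConst φ d}

/-! ## The control scheme -/

/-- `α(s) = 1 / (1 - s)`. -/
noncomputable def alpha (s : ℝ) : ℝ := 1 / (1 - s)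

/-- The auxiliary errors `e_1 = φ e^{(0)}`, `e_{i+1} = φ e^{(i)} + α(‖e_i‖²) e_i` for a value `φ`
of the funnel function and values `ε i = e^{(i)}`; the index `0` gives the dummy `e_0 = 0`. -/
noncomputable def auxError {m : ℕ} (φ : ℝ) (ε : ℕ → Vec m) : ℕ → Vec m
  | 0 => 0
  | i + 1 => φ • ε i + alpha (‖auxError φ ε i‖ ^ 2) • auxError φ ε i

/-- `τ(t)`: the last time in `[0, t]` at which the measurement was lost (`0` if there is none).
So `τ(t) = t` where `a(t) = 0`, and `τ` is constant while the measurement is available. -/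
noncomputable def lastLoss (a : ℝ → ℝ) (t : ℝ) : ℝ :=
  sSup (insert 0 {s ∈ Icc 0 t | a s = 0})

/-- `φ(t) = 0` if `a(t) = 0`, and `φ(t) = φ₀(t - τ(t))` if `a(t) = 1`. -/
noncomputable def shiftedFunnel (a φ₀ : ℝ → ℝ) (t : ℝ) : ℝ :=
  if a t = 0 then 0 else φ₀ (t - lastLoss a t)

/-- The interval `[0, ω)`. -/
def timeDomain (ω : EReal) : Set ℝ := {t | 0 ≤ t ∧ (t : EReal) < ω}

/-- `e^{(i)}(t) = y^{(i)}(t) - y_ref^{(i)}(t)` for a function `y` on `[0, ω)`. -/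
noncomputable def errDeriv {m : ℕ} (yref : ℝ → Vec m) (ω : EReal) (y : ℝ → Vec m)
    (t : ℝ) (i : ℕ) : Vec m :=
  iteratedDerivWithin i y (timeDomain ω) t - iteratedDerivWithin i yref (Ici 0) t

/-- `e_i(t)` along a function `y` on `[0, ω)`. -/
noncomputable def loopError {m : ℕ} (yref : ℝ → Vec m) (a φ₀ : ℝ → ℝ) (ω : EReal)
    (y : ℝ → Vec m) (i : ℕ) (t : ℝ) : Vec m :=
  auxError (shiftedFunnel a φ₀ t) (errDeriv yref ω y t) i

/-- The feedback `u(t) = -a(t) α(‖e_r(t)‖²) e_r(t)`. -/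
noncomputable def control {m : ℕ} (r : ℕ) (yref : ℝ → Vec m) (a φ₀ : ℝ → ℝ) (ω : EReal)
    (y : ℝ → Vec m) (t : ℝ) : Vec m :=
  -(a t * alpha (‖loopError yref a φ₀ ω y r t‖ ^ 2)) • loopError yref a φ₀ ω y r t

/-! ## Solutions of the closed loop -/

/-- `y : [0, ω) → ℝᵐ` solves `y^{(r)} = ∑ i, R_i y^{(i-1)} + Γ u`, `y^{(i)}(0) = y_i^0` with the
feedback `u`: it is of class `C^{r-1}`, `y^{(r-1)}` is locally absolutely continuous, and the
equation holds almost everywhere. The values of `y` outside `[0, ω)` play no role. -/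
structure IsSolution {m r : ℕ} (R : Fin r → Matrix (Fin m) (Fin m) ℝ)
    (Γ : Matrix (Fin m) (Fin m) ℝ) (yref : ℝ → Vec m) (a φ₀ : ℝ → ℝ) (y₀ : Fin r → Vec m)
    (ω : EReal) (y : ℝ → Vec m) : Prop where
  pos : 0 < ω
  contDiffOn : ContDiffOn ℝ ((r - 1 : ℕ) : ℕ∞) y (timeDomain ω)
  initial : ∀ i : Fin r, iteratedDerivWithin (i : ℕ) y (timeDomain ω) 0 = y₀ i
  absCont : ∀ T ∈ timeDomain ω,
    AbsolutelyContinuousOnInterval (iteratedDerivWithin (r - 1) y (timeDomain ω)) 0 T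
  ode : ∀ᵐ t : ℝ, t ∈ timeDomain ω →
    HasDerivAt (iteratedDerivWithin (r - 1) y (timeDomain ω))
      (∑ i : Fin r, Matrix.toEuclideanLin (R i) (iteratedDerivWithin (i : ℕ) y (timeDomain ω) t)
        + Matrix.toEuclideanLin Γ (control r yref a φ₀ ω y t)) t

/-- A solution without a proper right extension that is also a solution. -/
def IsMaximalSolution {m r : ℕ} (R : Fin r → Matrix (Fin m) (Fin m) ℝ)
    (Γ : Matrix (Fin m) (Fin m) ℝ) (yref : ℝ → Vec m) (a φ₀ : ℝ → ℝ) (y₀ : Fin r → Vec m)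
    (ω : EReal) (y : ℝ → Vec m) : Prop :=
  IsSolution R Γ yref a φ₀ y₀ ω y ∧
    ∀ (ω' : EReal) (y' : ℝ → Vec m), IsSolution R Γ yref a φ₀ y₀ ω' y' → ω < ω' →
      ¬ EqOn y' y (timeDomain ω)

/-! ## The design parameters -/

/-- `A_k(s) = ∑ j = 0..k, s^j`. -/
def geomPoly (k : ℕ) (s : ℝ) : ℝ := ∑ j ∈ Finset.range (k + 1), s ^ j

/-- `A_r = A_r(α(q²))`. -/
noncomputable def designA (r : ℕ) (q : ℝ) : ℝ := geomPoly r (alpha (q ^ 2))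

/-- The conditions on `η* > 0`. -/
structure IsEtaStar {m : ℕ} (r : ℕ) (c : ClassParams) (q Δ δ : ℝ) (yref : ℝ → Vec m)
    (ηs : ℝ) : Prop where
  pos : 0 < ηs
  ref : c.p * Δ * Real.exp (c.μ * δ) * supNorm yref ≤ ηs
  refall : (supNorm (refState r yref) + 1) * Real.exp (c.β * Δ + c.μ * δ) ≤ ηs
  funnel : c.p * c.M * designA r q *
      (supNorm (refState r yref) * (1 + Real.exp (c.β * Δ)) + Real.exp (c.β * Δ)) /
      (c.μ * q - c.s * c.p * c.M ^ 2 * designA r q * Δ * Real.exp (c.β * Δ) *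
        (c.μ * Δ + 2 * c.M * Real.exp (-c.μ * δ))) ≤ ηs

/-- The bound `E` for the error at the end of a loss. -/
noncomputable def errorBound {m : ℕ} (r : ℕ) (c : ClassParams) (Δ δ : ℝ) (yref : ℝ → Vec m)
    (ηs : ℝ) : ℝ :=
  supNorm (refState r yref) * (1 + Real.exp (c.β * Δ)) + Real.exp (c.β * Δ) +
    c.s * c.M * Δ * Real.exp (c.β * Δ) * (2 * c.M * Real.exp (-c.μ * δ) + c.μ * Δ) * ηs

/-- The condition `p M / (μ η*) ≤ φ₀(0) ≤ q / (A_r E)`. -/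
def FunnelInitCond {m : ℕ} (r : ℕ) (c : ClassParams) (q Δ δ : ℝ) (yref : ℝ → Vec m)
    (ηs : ℝ) (φ₀ : ℝ → ℝ) : Prop :=
  c.p * c.M / (c.μ * ηs) ≤ φ₀ 0 ∧ φ₀ 0 ≤ q / (designA r q * errorBound r c Δ δ yref ηs)

/-- `α̂†(z) = z / (1 + z)`. -/
noncomputable def alphaDagger (z : ℝ) : ℝ := z / (1 + z)

/-- `α̃(s) = 2 s α'(s) + α(s) = (1 + s) / (1 - s)²`. -/
noncomputable def alphaTilde (s : ℝ) : ℝ := (1 + s) / (1 - s) ^ 2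

/-- `e^{(i)}(0) = y_i^0 - y_ref^{(i)}(0)` for `i < r` (and `0` for the irrelevant indices). -/
noncomputable def initErr {m r : ℕ} (yref : ℝ → Vec m) (y₀ : Fin r → Vec m) (i : ℕ) : Vec m :=
  if h : i < r then y₀ ⟨i, h⟩ - iteratedDerivWithin i yref (Ici 0) 0 else 0

/-- `μ_0 = d (1 + φ₀(0)) / φ₀(0)`. -/
noncomputable def muZero (d : ℝ) (φ₀ : ℝ → ℝ) : ℝ := d * (1 + φ₀ 0) / φ₀ 0

/-- The pairs `(c_k, μ_k)`, where `c_0 = 0`,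
`μ_k = 1 + μ_0 (1 + c_{k-1} α(c_{k-1}²)) + α̃(c_{k-1}²) (μ_{k-1} + c_{k-1} α(c_{k-1}²))`,
`c_1 = max {‖e_1^0‖², α̂†(1 + μ_0), q²}^{1/2}`, and
`c_k = max {‖e_k^0‖², α̂†(μ_k), q²}^{1/2}` for `k ≥ 2`. -/
noncomputable def cmu {m : ℕ} (q d : ℝ) (φ₀ : ℝ → ℝ) (ε₀ : ℕ → Vec m) : ℕ → ℝ × ℝ
  | 0 => (0, muZero d φ₀)
  | k + 1 =>
    let c := (cmu q d φ₀ ε₀ k).1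
    let μ := (cmu q d φ₀ ε₀ k).2
    let μ' := 1 + muZero d φ₀ * (1 + c * alpha (c ^ 2)) +
      alphaTilde (c ^ 2) * (μ + c * alpha (c ^ 2))
    (Real.sqrt (max (max (‖auxError (φ₀ 0) ε₀ (k + 1)‖ ^ 2)
      (alphaDagger (if k = 0 then 1 + muZero d φ₀ else μ'))) (q ^ 2)), μ')

/-- The constant
`χ = ∑ i = 1..r-1, (c_i + c_{i-1} α(c_{i-1}²)) + (1 + c_{r-1} α(c_{r-1}²))`. -/
noncomputable def chi {m : ℕ} (r : ℕ) (q d : ℝ) (φ₀ : ℝ → ℝ) (ε₀ : ℕ → Vec m) : ℝ :=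
  let c := fun k => (cmu q d φ₀ ε₀ k).1
  ∑ i ∈ Finset.Icc 1 (r - 1), (c i + c (i - 1) * alpha (c (i - 1) ^ 2)) +
    (1 + c (r - 1) * alpha (c (r - 1) ^ 2))

end FunnelControl

/-! The proof rests on two a priori estimates, one for the times when the measurement is available
and one for losses, each supplying what the other needs at the switching time.

While the measurement is available, `φ e^{(i)} = e_{i+1} - α(‖e_i‖²) e_i`. Hence for `i < r` the
derivative of `e_i` is a bounded term minus `α(‖e_i‖²) e_i`, as long as `‖e_{i+1}‖ ≤ 1` and the
errors of lower index are under control. The constant `c_i` is chosen so that `α(c_i²) c_i²`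
dominates that bound, so the curve points inwards on the sphere of radius `c_i`
(`lower_error_bound`). For `e_r` the damping comes from the input through the coercivity of `Γ`, and
since `α` blows up at `1`, some radius `C < 1` beats the drift (`exists_lt_alpha_mul`,
`top_error_bound`). The derivative of `y_ref^{(r-1)}` exists only weakly; the barrier argument
`norm_le_of_inner_lt` therefore uses just its Lipschitz constant. The bounds `c_1, …, c_{r-1}, C`
are the same in every phase of availability (`IsTrajectory.available_bound`).

During a loss the input is zero and the state grows at most like `e^{βt}`
(`IsTrajectory.loss_growth`). A loss is preceded by an available phase of length at least `δ`, at
whose end `φ ≥ χ`; this makes the vector of error derivatives have norm at most `1` when the loss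
begins. So it has norm at most `E` when the loss ends, and the choice of `φ₀(0)` turns this into
`‖e_i‖ ≤ q`, which is within all bounds, at the restart (`norm_auxError_le_of_small`). Induction
over time in steps of `δ` combines the two estimates (`IsTrajectory.bounds`).

Existence and maximality come from freezing the gain outside a ball of radius `k < 1` that is larger
than all the bounds. The frozen loop has a globally Lipschitz right-hand side, hence a unique global
solution by Picard iteration. The notion `IsTrajectory` covers the frozen loop and the true loop at
once, so the a priori bounds hold for both, and freezing has no effect on either. The global
solution of the frozen loop thus solves the true loop and coincides with every solution of the true
loop on the domain of the latter; every maximal solution is therefore global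
(`Design.exists_global_solution`).

Classical derivatives of the reference are obtained from the weak ones by the lemma of du
Bois-Reymond (`reference_regularity`). -/

namespace FunnelControl

/-! ## Integral equations with a Lipschitz right-hand side -/

section IntegralEquation

variable {E : Type*} [NormedAddCommGroup E] [NormedSpace ℝ E]

/-- Grönwall's lemma in integral form, with vanishing initial value. -/
theorem eq_zero_of_le_mul_integral {u : ℝ → ℝ} {T L : ℝ} (hu : ContinuousOn u (Icc 0 T))
    (hu0 : ∀ t ∈ Icc 0 T, 0 ≤ u t) (hle : ∀ t ∈ Icc 0 T, u t ≤ L * ∫ s in 0..t, u s) :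
    ∀ t ∈ Icc 0 T, u t = 0 := by
  intro t ht
  have hT : 0 ≤ T := ht.1.trans ht.2
  have hint : IntervalIntegrable u volume 0 T := by
    apply ContinuousOn.intervalIntegrable; rwa [uIcc_of_le hT]
  have hv : ContinuousOn (fun t => ∫ s in 0..t, u s) (Icc 0 T) := by
    have := intervalIntegral.continuousOn_primitive_interval' hint left_mem_uIcc
    rwa [uIcc_of_le hT] at this
  have hv' : ∀ x ∈ Ico 0 T, HasDerivWithinAt (fun t => ∫ s in 0..t, u s) (u x) (Ici x) x := by
    intro x hx
    apply intervalIntegral.integral_hasDerivWithinAt_right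
    · exact hint.mono_set (by rw [uIcc_of_le hx.1, uIcc_of_le hT]; exact Icc_subset_Icc_right hx.2.le)
    · refine ⟨Icc x T, ?_, ?_⟩
      · rw [mem_nhdsWithin]
        refine ⟨Iio T, isOpen_Iio, hx.2, ?_⟩
        rintro y ⟨hy, hy'⟩
        exact ⟨(mem_Ioi.1 hy').le, (mem_Iio.1 hy).le⟩
      · exact ((hu.mono (Icc_subset_Icc_left hx.1)).aestronglyMeasurable measurableSet_Icc)
    · refine ((hu x ⟨hx.1, hx.2.le⟩).mono_of_mem_nhdsWithin ?_)
      rw [mem_nhdsWithin]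
      refine ⟨Iio T, isOpen_Iio, hx.2, ?_⟩
      rintro y ⟨hy, hy'⟩
      exact ⟨hx.1.trans (mem_Ioi.1 hy').le, (mem_Iio.1 hy).le⟩
  have hnn : ∀ t ∈ Icc 0 T, 0 ≤ ∫ s in 0..t, u s := fun t ht =>
    intervalIntegral.integral_nonneg ht.1 fun s hs => hu0 s ⟨hs.1, hs.2.trans ht.2⟩
  -- The differential inequality is applied to the primitive of `u`, which has the right derivative
  -- `u`; no derivative of `u` is needed.
  have key := norm_le_gronwallBound_of_norm_deriv_right_le (δ := 0) (K := L) (ε := 0) hv hv'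
    (by simp) (by
      intro x hx
      have hx' : x ∈ Icc 0 T := ⟨hx.1, hx.2.le⟩
      rw [Real.norm_of_nonneg (hu0 x hx'), Real.norm_of_nonneg (hnn x hx'), add_zero]
      exact hle x hx')
  have h0 : (∫ s in 0..t, u s) = 0 := by
    have := key t ht
    rw [gronwallBound_ε0_δ0] at this
    exact norm_le_zero_iff.1 this
  have := hle t ht
  rw [h0, mul_zero] at this
  exact le_antisymm this (hu0 t ht)

/-- Solutions of an integral equation with a Lipschitz right-hand side are unique. -/
theorem integral_solution_unique {F : ℝ → E → E} {T L : ℝ}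
    (hF : ∀ t ∈ Icc 0 T, ∀ x y, ‖F t x - F t y‖ ≤ L * ‖x - y‖) {x y : ℝ → E} {x₀ : E}
    (hx : ContinuousOn x (Icc 0 T)) (hy : ContinuousOn y (Icc 0 T))
    (hxi : ∀ t ∈ Icc 0 T, IntervalIntegrable (fun s => F s (x s)) volume 0 t)
    (hyi : ∀ t ∈ Icc 0 T, IntervalIntegrable (fun s => F s (y s)) volume 0 t)
    (hxe : ∀ t ∈ Icc 0 T, x t = x₀ + ∫ s in 0..t, F s (x s))
    (hye : ∀ t ∈ Icc 0 T, y t = x₀ + ∫ s in 0..t, F s (y s)) :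
    EqOn x y (Icc 0 T) := by
  have h := eq_zero_of_le_mul_integral (u := fun t => ‖x t - y t‖) (L := L) (hx.sub hy).norm
    (fun _ _ => norm_nonneg _) (by
      intro t ht
      rw [hxe t ht, hye t ht, add_sub_add_left_eq_sub,
        ← intervalIntegral.integral_sub (hxi t ht) (hyi t ht), ← intervalIntegral.integral_const_mul]
      have hc : ContinuousOn (fun t => ‖x t - y t‖) (Icc 0 t) :=
        ((hx.sub hy).norm).mono (Icc_subset_Icc_right ht.2)
      have hi : IntervalIntegrable (fun t => L * ‖x t - y t‖) volume 0 t := by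
        apply ContinuousOn.intervalIntegrable; rw [uIcc_of_le ht.1]; exact hc.const_mul L
      refine intervalIntegral.norm_integral_le_of_norm_le ht.1 ?_ hi
      filter_upwards with s hs
      exact hF s ⟨hs.1.le, hs.2.trans ht.2⟩ _ _)
  intro t ht
  exact sub_eq_zero.1 (norm_eq_zero.1 (h t ht))

/-- Global existence on a compact interval, by iterating Picard's operator. -/
theorem exists_integral_solution_Icc [CompleteSpace E] {F : ℝ → E → E} {T L : ℝ} (hT : 0 ≤ T)
    (hL : 0 ≤ L) (hF : ∀ t ∈ Icc 0 T, ∀ x y, ‖F t x - F t y‖ ≤ L * ‖x - y‖)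
    (hFi : ∀ x : ℝ → E, Continuous x → IntervalIntegrable (fun t => F t (x t)) volume 0 T)
    (x₀ : E) :
    ∃ x : ℝ → E, Continuous x ∧ ∀ t ∈ Icc 0 T, x t = x₀ + ∫ s in 0..t, F s (x s) := by
  let ext : C(Icc (0 : ℝ) T, E) → ℝ → E := fun x => IccExtend hT x
  have hext : ∀ x, Continuous (ext x) := fun x => x.continuous.Icc_extend'
  have hFi' : ∀ x, ∀ t ∈ Icc 0 T, IntervalIntegrable (fun t => F t (ext x t)) volume 0 t := by
    intro x t ht
    refine (hFi _ (hext x)).mono_set ?_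
    rw [uIcc_of_le ht.1, uIcc_of_le hT]; exact Icc_subset_Icc_right ht.2
  let P : C(Icc (0 : ℝ) T, E) → C(Icc (0 : ℝ) T, E) := fun x =>
    ⟨fun t => x₀ + ∫ s in 0..(t : ℝ), F s (ext x s), by
      have := intervalIntegral.continuousOn_primitive_interval' (hFi _ (hext x)) left_mem_uIcc
      rw [uIcc_of_le hT] at this
      exact continuous_const.add (continuousOn_iff_continuous_domRestrict.1 this)⟩
  have hPapp : ∀ x t, P x t = x₀ + ∫ s in 0..(t : ℝ), F s (ext x s) := fun _ _ => rfl
  have hext_app : ∀ x : C(Icc (0 : ℝ) T, E), ∀ t (ht : t ∈ Icc 0 T), ext x t = x ⟨t, ht⟩ :=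
    fun x t ht => IccExtend_of_mem hT x ht
  -- Integrating from `0` at each iteration produces the factorial, so some iterate of `P` contracts
  -- on all of `[0, T]` and the interval need not be shortened.
  have hiter : ∀ n : ℕ, ∀ x y : C(Icc (0 : ℝ) T, E), ∀ t : Icc (0 : ℝ) T,
      ‖(P^[n] x) t - (P^[n] y) t‖ ≤ (L * t) ^ n / n.factorial * dist x y := by
    intro n
    induction n with
    | zero =>
      intro x y t
      simpa [dist_eq_norm] using ContinuousMap.dist_apply_le_dist (f := x) (g := y) t
    | succ n ih =>
      intro x y t
      rw [Function.iterate_succ_apply', Function.iterate_succ_apply', hPapp, hPapp,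
        add_sub_add_left_eq_sub,
        ← intervalIntegral.integral_sub (hFi' _ t t.2) (hFi' _ t t.2)]
      have hi : IntervalIntegrable
          (fun s : ℝ => L * ((L * s) ^ n / n.factorial * dist x y)) volume 0 t :=
        (by fun_prop : Continuous _).intervalIntegrable _ _
      refine (intervalIntegral.norm_integral_le_of_norm_le t.2.1 ?_ hi).trans (le_of_eq ?_)
      · filter_upwards with s hs
        have hs' : s ∈ Icc 0 T := ⟨hs.1.le, hs.2.trans t.2.2⟩
        refine (hF s hs' _ _).trans (mul_le_mul_of_nonneg_left ?_ hL)
        rw [hext_app _ s hs', hext_app _ s hs']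
        exact ih x y ⟨s, hs'⟩
      · have : (fun s : ℝ => L * ((L * s) ^ n / n.factorial * dist x y)) =
            fun s : ℝ => (L ^ (n + 1) / n.factorial * dist x y) * s ^ n := by
          ext s; rw [mul_pow, pow_succ]; ring
        rw [this, intervalIntegral.integral_const_mul, integral_pow, Nat.factorial_succ]
        push_cast
        have : (n.factorial : ℝ) ≠ 0 := by positivity
        field_simp
        ring
  have hlip : ∀ n : ℕ, LipschitzWith (Real.toNNReal ((L * T) ^ n / n.factorial)) (P^[n]) := by
    intro n
    have h0 : 0 ≤ (L * T) ^ n / n.factorial := by positivity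
    refine LipschitzWith.of_dist_le_mul fun x y => ?_
    rw [Real.coe_toNNReal _ h0, ContinuousMap.dist_le (by positivity)]
    intro t
    rw [dist_eq_norm]
    refine (hiter n x y t).trans ?_
    have ht0 : (0 : ℝ) ≤ t := t.2.1
    have htT : (t : ℝ) ≤ T := t.2.2
    gcongr
  obtain ⟨n, hn⟩ : ∃ n : ℕ, (L * T) ^ n / n.factorial < 1 :=
    ((FloorSemiring.tendsto_pow_div_factorial_atTop (L * T)).eventually_lt_const one_pos).exists
  have hcontr : ContractingWith (Real.toNNReal ((L * T) ^ n / n.factorial)) (P^[n]) :=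
    ⟨by rw [Real.toNNReal_lt_one]; exact hn, hlip n⟩
  have hfix : P (ContractingWith.fixedPoint _ hcontr) = ContractingWith.fixedPoint _ hcontr :=
    hcontr.isFixedPt_fixedPoint_iterate
  refine ⟨ext (ContractingWith.fixedPoint _ hcontr), hext _, fun t ht => ?_⟩
  rw [hext_app _ t ht]
  conv_lhs => rw [← hfix]
  rfl

/-- Global existence on the half-line. -/
theorem exists_integral_solution [CompleteSpace E] {F : ℝ → E → E} {L : ℝ → ℝ}
    (hL : ∀ T, 0 ≤ T → 0 ≤ L T)
    (hF : ∀ T, ∀ t ∈ Icc 0 T, ∀ x y, ‖F t x - F t y‖ ≤ L T * ‖x - y‖)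
    (hFi : ∀ T, 0 ≤ T → ∀ x : ℝ → E, ContinuousOn x (Icc 0 T) →
      IntervalIntegrable (fun t => F t (x t)) volume 0 T)
    (x₀ : E) :
    ∃ x : ℝ → E, ContinuousOn x (Ici 0) ∧ ∀ t, 0 ≤ t → x t = x₀ + ∫ s in 0..t, F s (x s) := by
  have h : ∀ n : ℕ, ∃ x : ℝ → E, Continuous x ∧
      ∀ t ∈ Icc (0 : ℝ) n, x t = x₀ + ∫ s in 0..t, F s (x s) := fun n =>
    exists_integral_solution_Icc n.cast_nonneg (hL _ n.cast_nonneg) (hF n)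
      (fun x hx => hFi n n.cast_nonneg x hx.continuousOn) x₀
  choose X hXc hX using h
  have heq : ∀ m n : ℕ, m ≤ n → EqOn (X n) (X m) (Icc (0 : ℝ) m) := by
    intro m n hmn
    have hmn' : (m : ℝ) ≤ n := by exact_mod_cast hmn
    exact integral_solution_unique (hF m) (hXc n).continuousOn
      (hXc m).continuousOn (fun t ht => hFi t ht.1 _ (hXc n).continuousOn)
      (fun t ht => hFi t ht.1 _ (hXc m).continuousOn)
      (fun t ht => hX n t ⟨ht.1, ht.2.trans hmn'⟩) (hX m)
  let Y : ℝ → E := fun t => X (⌊t⌋₊ + 1) t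
  have hY : ∀ n : ℕ, ∀ t ∈ Ico (0 : ℝ) n, Y t = X n t := by
    intro n t ht
    have h1 : ⌊t⌋₊ + 1 ≤ n := by
      rw [Nat.succ_le_iff, Nat.floor_lt ht.1]; exact ht.2
    exact (heq _ _ h1 ⟨ht.1, by exact_mod_cast (Nat.lt_floor_add_one t).le⟩).symm
  refine ⟨Y, fun t ht => ?_, fun t ht => ?_⟩
  · have h1 : t < (⌊t⌋₊ + 1 : ℕ) := by exact_mod_cast Nat.lt_floor_add_one t
    refine ((hXc (⌊t⌋₊ + 1)).continuousWithinAt (s := Ici 0)).congr_of_eventuallyEq ?_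
      (hY _ t ⟨ht, h1⟩)
    filter_upwards [self_mem_nhdsWithin, mem_nhdsWithin_of_mem_nhds (Iio_mem_nhds h1)] with s hs hs'
    exact hY _ s ⟨hs, hs'⟩
  · have h1 : t < (⌊t⌋₊ + 1 : ℕ) := by exact_mod_cast Nat.lt_floor_add_one t
    rw [hY _ t ⟨ht, h1⟩, hX _ t ⟨ht, h1.le⟩]
    congr 1
    apply intervalIntegral.integral_congr
    intro s hs
    rw [uIcc_of_le ht] at hs
    simp only [hY _ s ⟨hs.1, hs.2.trans_lt h1⟩]

end IntegralEquation

/-! ## Weak derivatives and Sobolev functions on the half-line -/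

section Sobolev

variable {m : ℕ}

theorem intervalIntegrable_apply {a b : ℝ} {f : ℝ → Vec m} (hf : IntervalIntegrable f volume a b)
    (j : Fin m) : IntervalIntegrable (fun t => f t j) volume a b :=
  ⟨Integrable.eval_piLp hf.1 j, Integrable.eval_piLp hf.2 j⟩

theorem integral_apply {a b : ℝ} {f : ℝ → Vec m} (hf : IntervalIntegrable f volume a b)
    (j : Fin m) : (∫ t in a..b, f t) j = ∫ t in a..b, f t j :=
  ((EuclideanSpace.proj j : Vec m →L[ℝ] ℝ).intervalIntegral_comp_comm hf).symm

/-- Functions given as integrals of `G` have the weak derivative `G`. -/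
theorem hasWeakDeriv_of_integral {F G : ℝ → Vec m}
    (hG : ∀ T, 0 ≤ T → IntervalIntegrable G volume 0 T)
    (hF : ∀ t, 0 ≤ t → F t = F 0 + ∫ s in 0..t, G s) : HasWeakDeriv F G := by
  intro θ hθ hθc hθs
  obtain ⟨T, hT0, hT⟩ : ∃ T : ℝ, 0 ≤ T ∧ tsupport θ ⊆ Iio T := by
    obtain ⟨T, hT⟩ := hθc.isCompact.bddAbove
    refine ⟨max T 0 + 1, by positivity, fun t ht => ?_⟩
    exact lt_of_le_of_lt ((hT ht).trans (le_max_left _ _)) (lt_add_one _)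
  have hsupp : ∀ t, t ∉ Ioc 0 T → θ t = 0 ∧ deriv θ t = 0 := by
    intro t ht
    have : t ∉ tsupport θ := fun h => ht ⟨hθs h, (hT h).le⟩
    exact ⟨image_eq_zero_of_notMem_tsupport this,
      image_eq_zero_of_notMem_tsupport fun h => this (tsupport_deriv_subset h)⟩
  have hred : ∀ (c : ℝ → ℝ) (v : ℝ → Vec m), (∀ t, t ∉ Ioc 0 T → c t = 0) →
      ∫ t in Ioi (0 : ℝ), c t • v t = ∫ t in 0..T, c t • v t := by
    intro c v hc
    rw [intervalIntegral.integral_of_le hT0]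
    refine setIntegral_eq_of_subset_of_forall_sdiff_eq_zero measurableSet_Ioi
      (fun t (ht : t ∈ Ioc 0 T) => ht.1) ?_
    rintro t ⟨-, ht⟩
    simp [hc t ht]
  rw [hred _ _ fun t ht => (hsupp t ht).2, hred _ _ fun t ht => (hsupp t ht).1]
  have hdθ : Continuous (deriv θ) := hθ.continuous_deriv (by simp)
  have hFc : ContinuousOn F (uIcc 0 T) := by
    have h1 := intervalIntegral.continuousOn_primitive_interval' (hG T hT0) left_mem_uIcc
    refine (continuousOn_const.add h1).congr (f := fun t => F 0 + ∫ s in 0..t, G s) fun t ht => ?_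
    rw [uIcc_of_le hT0] at ht
    exact hF t ht.1
  have hi1 : IntervalIntegrable (fun t => deriv θ t • F t) volume 0 T :=
    (hdθ.continuousOn.smul hFc).intervalIntegrable
  have hi2 : IntervalIntegrable (fun t => θ t • G t) volume 0 T :=
    (hG T hT0).continuousOn_smul hθ.continuous.continuousOn
  -- Integration by parts is done in each coordinate, for absolutely continuous functions on `[0,
  -- T]`; the boundary terms vanish with `θ`.
  rw [eq_neg_iff_add_eq_zero]
  ext j
  rw [PiLp.add_apply, integral_apply hi1, integral_apply hi2, PiLp.zero_apply]
  have hθac : AbsolutelyContinuousOnInterval θ 0 T :=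
    (hθ.contDiffOn.of_le (by simp)).absolutelyContinuousOnInterval
  have hGj := intervalIntegrable_apply (hG T hT0) j
  have hprim := hGj.absolutelyContinuousOnInterval_intervalIntegral left_mem_uIcc
  have hconst : AbsolutelyContinuousOnInterval (fun _ : ℝ => F 0 j) 0 T :=
    (LipschitzWith.const (F 0 j)).lipschitzOnWith.absolutelyContinuousOnInterval
  have hpac : AbsolutelyContinuousOnInterval (fun t => F 0 j + ∫ s in 0..t, G s j) 0 T :=
    hconst.add hprim
  have hbp := hθac.integral_deriv_mul_eq_sub hpac
  have h0 := (hsupp 0 (by simp)).1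
  have hTT : θ T = 0 := image_eq_zero_of_notMem_tsupport fun h => lt_irrefl T (hT h)
  rw [h0, hTT, zero_mul, zero_mul, sub_zero] at hbp
  rw [← intervalIntegral.integral_add (intervalIntegrable_apply hi1 j)
    (intervalIntegrable_apply hi2 j)]
  refine Eq.trans ?_ hbp
  apply intervalIntegral.integral_congr_ae
  filter_upwards [hGj.ae_hasDerivAt_integral] with t ht htI
  have htI' := uIoc_subset_uIcc htI
  rw [(ht htI' 0 left_mem_uIcc).const_add (F 0 j) |>.deriv]
  rw [uIcc_of_le hT0] at htI'
  have hI : IntervalIntegrable G volume 0 t := hG t htI'.1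
  have : F t j = F 0 j + ∫ s in 0..t, G s j := by
    rw [hF t htI'.1, PiLp.add_apply, integral_apply hI]
  simp [this]

theorem exists_support_bounds {θ : ℝ → ℝ} (hc : HasCompactSupport θ) (hs : tsupport θ ⊆ Ioi 0) :
    ∃ a b : ℝ, 0 < a ∧ tsupport θ ⊆ Icc a b := by
  rcases (tsupport θ).eq_empty_or_nonempty with h | h
  · exact ⟨1, 1, one_pos, by simp [h]⟩
  · obtain ⟨a, ha, ha'⟩ := hc.isCompact.exists_isLeast h
    obtain ⟨b, hb, hb'⟩ := hc.isCompact.exists_isGreatest h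
    exact ⟨a, b, hs ha, fun t ht => ⟨ha' ht, hb' ht⟩⟩

/-- A smooth function with compact support in `(0, ∞)` and vanishing integral is the derivative of
such a function. -/
theorem exists_primitive_of_integral_eq_zero {ψ : ℝ → ℝ}
    (hψ : ContDiff ℝ ((⊤ : ℕ∞) : WithTop ℕ∞) ψ) (hc : HasCompactSupport ψ)
    (hs : tsupport ψ ⊆ Ioi 0) (h0 : ∫ t, ψ t = 0) :
    ∃ θ : ℝ → ℝ, ContDiff ℝ ((⊤ : ℕ∞) : WithTop ℕ∞) θ ∧ HasCompactSupport θ ∧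
      tsupport θ ⊆ Ioi 0 ∧ deriv θ = ψ := by
  obtain ⟨a, b, ha, hab⟩ := exists_support_bounds hc hs
  have hψ0 : ∀ t, t ∉ Icc a b → ψ t = 0 := fun t ht =>
    image_eq_zero_of_notMem_tsupport fun h => ht (hab h)
  have hd : ∀ t, HasDerivAt (fun t => ∫ s in 0..t, ψ s) (ψ t) t := fun t =>
    intervalIntegral.integral_hasDerivAt_right (hψ.continuous.intervalIntegrable _ _)
      hψ.continuous.aestronglyMeasurable.stronglyMeasurableAtFilter hψ.continuous.continuousAt
  have hderiv : deriv (fun t => ∫ s in 0..t, ψ s) = ψ := funext fun t => (hd t).deriv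
  -- Before the support nothing has been integrated; after it, the full integral has, and this is
  -- zero.
  have hsub : ∀ t, t ∉ Icc a b → ∫ s in 0..t, ψ s = 0 := by
    intro t ht
    rcases lt_or_ge t a with h | h
    · refine (intervalIntegral.integral_congr (g := fun _ => 0) fun s hs => ?_).trans (by simp)
      refine hψ0 s fun hs' => ?_
      have := hs.2
      have h2 : max 0 t < a := max_lt ha h
      exact absurd (hs'.1.trans this) (not_le.2 h2)
    · have hbt : b < t := lt_of_not_ge fun h' => ht ⟨h, h'⟩
      have ht0 : 0 ≤ t := ha.le.trans h
      rw [intervalIntegral.integral_of_le ht0]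
      refine (setIntegral_eq_integral_of_forall_compl_eq_zero fun s hs =>
        hψ0 s fun hs' => hs ?_).trans h0
      exact ⟨ha.trans_le hs'.1, hs'.2.trans hbt.le⟩
  have hts : tsupport (fun t => ∫ s in 0..t, ψ s) ⊆ Icc a b :=
    closure_minimal (fun t ht => by_contra fun h => ht (hsub t h)) isClosed_Icc
  refine ⟨fun t => ∫ s in 0..t, ψ s, ?_, ?_, hts.trans fun t ht => ha.trans_le ht.1, hderiv⟩
  · rw [contDiff_infty_iff_deriv]
    exact ⟨fun t => (hd t).differentiableAt, by rw [hderiv]; exact hψ⟩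
  · exact isCompact_Icc.of_isClosed_subset (isClosed_tsupport _) hts

theorem exists_testFunction_integral_eq_one : ∃ ψ : ℝ → ℝ,
    ContDiff ℝ ((⊤ : ℕ∞) : WithTop ℕ∞) ψ ∧ HasCompactSupport ψ ∧ tsupport ψ ⊆ Ioi 0 ∧
      ∫ t, ψ t = 1 := by
  let B : ContDiffBump (2 : ℝ) := ⟨1 / 2, 1, by norm_num, by norm_num⟩
  refine ⟨B.normed volume, B.contDiff_normed, B.hasCompactSupport_normed, ?_, B.integral_normed⟩
  rw [B.tsupport_normed_eq]
  intro t ht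
  rw [Metric.mem_closedBall, Real.dist_eq] at ht
  have := (abs_le.1 ht).1
  simp only [B] at this
  rw [mem_Ioi]; linarith

/-- The lemma of du Bois-Reymond: a function with vanishing weak derivative is constant. -/
theorem ae_const_of_integral_deriv_smul_eq_zero {h : ℝ → Vec m}
    (hh : LocallyIntegrableOn h (Ioi 0) volume)
    (hw : ∀ θ : ℝ → ℝ, ContDiff ℝ ((⊤ : ℕ∞) : WithTop ℕ∞) θ → HasCompactSupport θ →
      tsupport θ ⊆ Ioi 0 → ∫ t in Ioi (0 : ℝ), deriv θ t • h t = 0) :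
    ∃ c : Vec m, ∀ᵐ t : ℝ, t ∈ Ioi (0 : ℝ) → h t = c := by
  obtain ⟨ψ₀, hψ₀, hψ₀c, hψ₀s, hψ₀i⟩ := exists_testFunction_integral_eq_one
  have hint : ∀ (ψ : ℝ → ℝ), Continuous ψ → HasCompactSupport ψ → tsupport ψ ⊆ Ioi 0 →
      ∀ {f : ℝ → Vec m}, LocallyIntegrableOn f (Ioi 0) volume →
      Integrable (fun t => ψ t • f t) volume := by
    intro ψ h1 h2 h3 f hf
    have hK : IntegrableOn f (tsupport ψ) volume := hf.integrableOn_compact_subset h3 h2.isCompact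
    have := hK.continuousOn_smul h1.continuousOn h2.isCompact
    refine (integrableOn_iff_integrable_of_support_subset fun t ht => ?_).1 this
    by_contra h
    exact ht (by simp [image_eq_zero_of_notMem_tsupport h])
  have hset : ∀ (ψ : ℝ → ℝ), tsupport ψ ⊆ Ioi 0 → ∀ f : ℝ → Vec m,
      ∫ t in Ioi (0 : ℝ), ψ t • f t = ∫ t, ψ t • f t := by
    intro ψ h3 f
    refine setIntegral_eq_integral_of_forall_compl_eq_zero fun t ht => ?_
    simp [image_eq_zero_of_notMem_tsupport fun h => ht (h3 h)]
  -- A constant equals its mean against the weight `ψ₀` of integral one.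
  refine ⟨∫ t, ψ₀ t • h t, ?_⟩
  set c := ∫ t, ψ₀ t • h t with hc
  have hcl : LocallyIntegrableOn (fun _ : ℝ => c) (Ioi 0) volume :=
    (locallyIntegrable_const c).locallyIntegrableOn _
  have key := isOpen_Ioi.ae_eq_zero_of_integral_contDiff_smul_eq_zero (hh.sub hcl) (by
    intro ψ hψ hψc hψs
    set I := ∫ t, ψ t with hI
    -- Subtracting `I * ψ₀` leaves a test function of integral zero, hence a derivative, and `h`
    -- pairs to zero with it by `hw`.
    have hχs : tsupport (fun t => ψ t - I * ψ₀ t) ⊆ Ioi 0 := by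
      refine (tsupport_sub ψ _).trans (union_subset hψs ?_)
      exact (tsupport_mul_subset_right (f := fun _ => I) (g := ψ₀)).trans hψ₀s
    have hχc : HasCompactSupport (fun t => ψ t - I * ψ₀ t) := hψc.sub hψ₀c.mul_left
    have hi1 : Integrable ψ := hψ.continuous.integrable_of_hasCompactSupport hψc
    have hi2 : Integrable ψ₀ := hψ₀.continuous.integrable_of_hasCompactSupport hψ₀c
    obtain ⟨θ, hθ, hθc, hθs, hθd⟩ := exists_primitive_of_integral_eq_zero
      (ψ := fun t => ψ t - I * ψ₀ t) (hψ.sub (contDiff_const.mul hψ₀)) hχc hχs (by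
        rw [integral_sub hi1 (hi2.const_mul I), integral_const_mul, hψ₀i, mul_one, ← hI, sub_self])
    have h1 := hw θ hθ hθc hθs
    rw [hθd, hset _ hχs] at h1
    have j1 := hint ψ hψ.continuous hψc hψs hh
    have j2 := hint ψ₀ hψ₀.continuous hψ₀c hψ₀s hh
    have h2 : ∫ t, ψ t • h t = I • c := by
      simp only [sub_smul, mul_smul] at h1
      have j3 : Integrable (fun t => I • ψ₀ t • h t) := j2.smul I
      rw [integral_sub j1 j3, integral_smul, sub_eq_zero] at h1
      exact h1
    simp only [Pi.sub_apply, smul_sub]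
    rw [integral_sub j1 (hint ψ hψ.continuous hψc hψs hcl), h2, integral_smul_const, sub_self])
  filter_upwards [key] with t ht hpos
  exact sub_eq_zero.1 (ht hpos)

theorem ae_norm_le_of_memLp_top {E : Type*} [NormedAddCommGroup E] {g : ℝ → E}
    (hg : MemLp g ∞ (volume.restrict (Ici 0))) :
    ∀ᵐ t : ℝ, t ∈ Ici (0 : ℝ) → ‖g t‖ ≤ supNorm g := by
  rw [← ae_restrict_iff' measurableSet_Ici]
  have hfin := hg.2
  filter_upwards [ae_le_eLpNormEssSup (f := g) (μ := volume.restrict (Ici 0))] with t ht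
  rw [← eLpNorm_exponent_top] at ht
  rw [supNorm, ← toReal_enorm]
  exact ENNReal.toReal_mono hfin.ne ht

theorem intervalIntegrable_of_memLp_top {g : ℝ → Vec m}
    (hg : MemLp g ∞ (volume.restrict (Ici 0))) {T : ℝ} (hT : 0 ≤ T) :
    IntervalIntegrable g volume 0 T := by
  rw [intervalIntegrable_iff_integrableOn_Ioc_of_le hT]
  have : MemLp g ∞ (volume.restrict (Ioc 0 T)) :=
    hg.mono_measure (Measure.restrict_mono (fun t ht => ht.1.le) le_rfl)
  exact this.integrable le_top

/-- An element of `W^{1,∞}` has a Lipschitz continuous representative. -/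
theorem exists_integral_representative {f g : ℝ → Vec m}
    (hf : MemLp f ∞ (volume.restrict (Ici 0))) (hg : MemLp g ∞ (volume.restrict (Ici 0)))
    (hw : HasWeakDeriv f g) :
    ∃ h : ℝ → Vec m, (∀ t, 0 ≤ t → h t = h 0 + ∫ s in 0..t, g s) ∧
      f =ᵐ[volume.restrict (Ici 0)] h := by
  have hgi := fun T (hT : (0 : ℝ) ≤ T) => intervalIntegrable_of_memLp_top hg hT
  set F : ℝ → Vec m := fun t => ∫ s in 0..t, g s with hF
  have hF0 : F 0 = 0 := by simp [hF]
  have hFw : HasWeakDeriv F g := hasWeakDeriv_of_integral hgi fun t _ => by rw [hF0, zero_add]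
  have hloc : ∀ {f : ℝ → Vec m}, (∀ T : ℝ, 0 ≤ T → IntegrableOn f (Icc 0 T)) →
      LocallyIntegrableOn f (Ioi 0) volume := by
    intro f hf
    rw [locallyIntegrableOn_iff isOpen_Ioi.isLocallyClosed]
    intro K hK hKc
    obtain ⟨T, hT⟩ := hKc.bddAbove
    exact (hf (max T 0) (le_max_right _ _)).mono_set fun t ht =>
      ⟨(hK ht).le, (hT ht).trans (le_max_left _ _)⟩
  have hfi : ∀ T : ℝ, 0 ≤ T → IntegrableOn f (Icc 0 T) := fun T hT =>
    (intervalIntegrable_iff_integrableOn_Icc_of_le hT).1 (intervalIntegrable_of_memLp_top hf hT)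
  have hFi : ∀ T : ℝ, 0 ≤ T → IntegrableOn F (Icc 0 T) := by
    intro T hT
    have := intervalIntegral.continuousOn_primitive_interval' (hgi T hT) left_mem_uIcc
    rw [uIcc_of_le hT] at this
    exact this.integrableOn_Icc
  -- The primitive `F` of `g` also has the weak derivative `g`, so that of `f - F` is zero.
  obtain ⟨c, hc⟩ := ae_const_of_integral_deriv_smul_eq_zero (h := f - F)
    ((hloc hfi).sub (hloc hFi)) (by
      intro θ hθ hθc hθs
      obtain ⟨a, b, ha, hab⟩ := exists_support_bounds hθc hθs
      have hdθ : Continuous (deriv θ) := hθ.continuous_deriv (by simp)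
      have hint : ∀ {f : ℝ → Vec m}, (∀ T : ℝ, 0 ≤ T → IntegrableOn f (Icc 0 T)) →
          IntegrableOn (fun t => deriv θ t • f t) (Ioi 0) := by
        intro f hf
        have h1 : IntegrableOn (fun t => deriv θ t • f t) (Icc 0 (max b 0)) :=
          (hf _ (le_max_right _ _)).continuousOn_smul hdθ.continuousOn isCompact_Icc
        refine ((integrableOn_iff_integrable_of_support_subset fun t ht => ?_).1 h1).integrableOn
        by_contra h
        refine ht ?_
        have : t ∉ tsupport (deriv θ) := fun h' => h
          ⟨ha.le.trans (hab (tsupport_deriv_subset h')).1,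
            (hab (tsupport_deriv_subset h')).2.trans (le_max_left _ _)⟩
        simp [image_eq_zero_of_notMem_tsupport this]
      simp only [Pi.sub_apply, smul_sub]
      rw [integral_sub (hint hfi) (hint hFi), hw θ hθ hθc hθs, hFw θ hθ hθc hθs, sub_self])
  refine ⟨fun t => c + F t, fun t _ => by simp [hF], ?_⟩
  rw [Filter.EventuallyEq, ae_restrict_iff' measurableSet_Ici]
  have h0 : ∀ᵐ t : ℝ, t ≠ 0 := by simp [ae_iff, measure_singleton]
  filter_upwards [hc, h0] with t ht ht0 htI
  have := ht (lt_of_le_of_ne htI (Ne.symm ht0))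
  rw [← this]; simp

theorem norm_sub_le_of_integral {h g : ℝ → Vec m}
    (hg : MemLp g ∞ (volume.restrict (Ici 0)))
    (hh : ∀ t, 0 ≤ t → h t = h 0 + ∫ s in 0..t, g s) {s t : ℝ} (hs : 0 ≤ s) (ht : 0 ≤ t) :
    ‖h t - h s‖ ≤ supNorm g * |t - s| := by
  rw [hh t ht, hh s hs, add_sub_add_left_eq_sub, intervalIntegral.integral_interval_sub_left
    (intervalIntegrable_of_memLp_top hg ht) (intervalIntegrable_of_memLp_top hg hs)]
  refine intervalIntegral.norm_integral_le_of_norm_le_const_ae ?_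
  filter_upwards [ae_norm_le_of_memLp_top hg] with x hx hxI
  exact hx ((le_min hs ht).trans hxI.1.le)

theorem Ici_subset_closure_interior : Ici (0 : ℝ) ⊆ closure (interior (Ici 0)) := by
  rw [interior_Ici, closure_Ioi]

/-- The almost everywhere bound is written as the equation `‖f‖ = min ‖f‖ (supNorm f)` between
continuous functions, which then holds at every point. -/
theorem norm_le_supNorm {E : Type*} [NormedAddCommGroup E] {f : ℝ → E}
    (hf : MemLp f ∞ (volume.restrict (Ici 0))) (hc : ContinuousOn f (Ici 0)) {t : ℝ}
    (ht : 0 ≤ t) : ‖f t‖ ≤ supNorm f := by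
  have h : EqOn (fun t => ‖f t‖) (fun t => min ‖f t‖ (supNorm f)) (Ici 0) := by
    refine Measure.eqOn_of_ae_eq (μ := volume) ?_ hc.norm (ContinuousOn.inf hc.norm continuousOn_const)
      Ici_subset_closure_interior
    rw [Filter.EventuallyEq, ae_restrict_iff' measurableSet_Ici]
    filter_upwards [ae_norm_le_of_memLp_top hf] with t ht h0
    exact (min_eq_left (ht h0)).symm
  have := h ht
  simp only at this
  rw [this]; exact min_le_right _ _

theorem memLp_top_of_continuousOn {E : Type*} [NormedAddCommGroup E] {f : ℝ → E}
    (hc : ContinuousOn f (Ici 0)) [SecondCountableTopology E] {K : ℝ} (hK : ∀ t, 0 ≤ t → ‖f t‖ ≤ K) :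
    MemLp f ∞ (volume.restrict (Ici 0)) := by
  refine memLp_top_of_bound (hc.aestronglyMeasurable measurableSet_Ici) K ?_
  rw [ae_restrict_iff' measurableSet_Ici]
  exact Eventually.of_forall fun t ht => hK t ht

/-- Iterated derivatives within `s` from a chain of derivatives within `s`. -/
theorem eqOn_iteratedDerivWithin {E : Type*} [NormedAddCommGroup E] [NormedSpace ℝ E] {s : Set ℝ}
    (hs : UniqueDiffOn ℝ s) {f : ℝ → E} {h : ℕ → ℝ → E} {N : ℕ} (h0 : EqOn f (h 0) s)
    (hd : ∀ i, i + 1 < N → ∀ t ∈ s, HasDerivWithinAt (h i) (h (i + 1) t) s t) :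
    ∀ i < N, EqOn (iteratedDerivWithin i f s) (h i) s := by
  intro i
  induction i with
  | zero => intro _ t ht; rw [iteratedDerivWithin_zero]; exact h0 ht
  | succ i ih =>
    intro hi t ht
    rw [iteratedDerivWithin_succ]
    have h1 := ih (by omega)
    rw [derivWithin_congr h1 (h1 ht)]
    exact (hd i hi t ht).derivWithin (hs t ht)

/-- The fundamental theorem of calculus on the half-line. -/
theorem hasDerivWithinAt_Ici_of_integral {x g : ℝ → Vec m} (hg : ContinuousOn g (Ici 0))
    (hx : ∀ t, 0 ≤ t → x t = x 0 + ∫ s in 0..t, g s) {t : ℝ} (ht : 0 ≤ t) :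
    HasDerivWithinAt x (g t) (Ici 0) t := by
  have hint : IntervalIntegrable g volume 0 t :=
    (hg.mono (by rw [uIcc_of_le ht]; exact fun s hs => hs.1)).intervalIntegrable
  have h2 : HasDerivWithinAt (fun s => ∫ y in 0..s, g y) (g t) (Icc 0 (t + 1)) t := by
    have : Fact (t ∈ Icc 0 (t + 1)) := ⟨⟨ht, by linarith⟩⟩
    refine intervalIntegral.integral_hasDerivWithinAt_right hint
      ⟨Icc 0 (t + 1), self_mem_nhdsWithin, ?_⟩ ?_
    · exact (hg.mono fun s hs => hs.1).aestronglyMeasurable measurableSet_Icc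
    · exact (hg t ht).mono fun s hs => hs.1
  have hFTC : HasDerivWithinAt (fun s => ∫ y in 0..s, g y) (g t) (Ici 0) t := by
    refine h2.mono_of_mem_nhdsWithin ?_
    rw [mem_nhdsWithin]
    exact ⟨Iio (t + 1), isOpen_Iio, by simp, fun s hs => ⟨hs.2, (mem_Iio.1 hs.1).le⟩⟩
  exact (hFTC.const_add (x 0)).congr hx (hx t ht)

/-- The reference signal has bounded classical derivatives up to order `r - 1`, and the last of
them is Lipschitz continuous. -/
theorem reference_regularity {r : ℕ} (hr : 1 ≤ r) {yref : ℝ → Vec m}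
    (hc : ContinuousOn yref (Ici 0)) (hy : MemSobolevInf r yref) :
    (∀ i < r, ContinuousOn (iteratedDerivWithin i yref (Ici 0)) (Ici 0)) ∧
    (∀ i, i + 1 < r → ∀ t, 0 ≤ t → HasDerivWithinAt (iteratedDerivWithin i yref (Ici 0))
      (iteratedDerivWithin (i + 1) yref (Ici 0) t) (Ici 0) t) ∧
    (∀ i < r, ∃ K, ∀ t, 0 ≤ t → ‖iteratedDerivWithin i yref (Ici 0) t‖ ≤ K) ∧
    ∃ M, 0 ≤ M ∧ ∀ s t, 0 ≤ s → 0 ≤ t → ‖iteratedDerivWithin (r - 1) yref (Ici 0) t -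
      iteratedDerivWithin (r - 1) yref (Ici 0) s‖ ≤ M * |t - s| := by
  obtain ⟨g, hg0, hgm, hgw⟩ := hy
  have hex : ∀ i, ∃ h : ℝ → Vec m, i < r → (∀ t, 0 ≤ t → h t = h 0 + ∫ s in 0..t, g (i + 1) s) ∧
      g i =ᵐ[volume.restrict (Ici 0)] h := by
    intro i
    by_cases hi : i < r
    · obtain ⟨h, h1, h2⟩ := exists_integral_representative (hgm i hi.le) (hgm (i + 1) hi) (hgw i hi)
      exact ⟨h, fun _ => ⟨h1, h2⟩⟩
    · exact ⟨0, fun h => absurd h hi⟩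
  choose h hh using hex
  have hlip : ∀ i < r, ∀ s t, 0 ≤ s → 0 ≤ t → ‖h i t - h i s‖ ≤ supNorm (g (i + 1)) * |t - s| :=
    fun i hi s t hs ht => norm_sub_le_of_integral (hgm (i + 1) hi) (hh i hi).1 hs ht
  have hcont : ∀ i < r, ContinuousOn (h i) (Ici 0) := by
    intro i hi
    refine LipschitzOnWith.continuousOn (K := Real.toNNReal (supNorm (g (i + 1)))) ?_
    refine LipschitzOnWith.of_dist_le_mul fun t ht s hs => ?_
    rw [dist_eq_norm, Real.dist_eq, Real.coe_toNNReal (supNorm (g (i + 1))) ENNReal.toReal_nonneg]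
    exact hlip i hi s t hs ht
  have hd : ∀ i, i + 1 < r → ∀ t ∈ Ici (0 : ℝ), HasDerivWithinAt (h i) (h (i + 1) t) (Ici 0) t := by
    intro i hi t ht
    have ht : 0 ≤ t := ht
    have hci := hcont (i + 1) hi
    -- Under the integral `g (i + 1)` may be replaced by its continuous representative, which makes
    -- `h i` continuously differentiable and not merely Lipschitz.
    have heq : ∀ s, 0 ≤ s → h i s = h i 0 + ∫ x in 0..s, h (i + 1) x := by
      intro s hs
      rw [(hh i (by omega)).1 s hs]
      congr 1
      apply intervalIntegral.integral_congr_ae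
      have := (hh (i + 1) hi).2
      rw [Filter.EventuallyEq, ae_restrict_iff' measurableSet_Ici] at this
      filter_upwards [this] with x hx hxI
      rw [uIoc_of_le hs] at hxI
      exact hx hxI.1.le
    exact hasDerivWithinAt_Ici_of_integral hci heq ht
  have h0 : EqOn yref (h 0) (Ici 0) := by
    refine Measure.eqOn_of_ae_eq (μ := volume) ?_ hc (hcont 0 hr) Ici_subset_closure_interior
    rw [← hg0]; exact (hh 0 hr).2
  have hI := eqOn_iteratedDerivWithin (uniqueDiffOn_Ici (0 : ℝ)) h0 hd
  refine ⟨fun i hi => (hcont i hi).congr (hI i hi), fun i hi t ht => ?_, fun i hi => ?_, ?_⟩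
  · rw [hI (i + 1) hi ht]
    exact (hd i hi t ht).congr (hI i (by omega)) (hI i (by omega) ht)
  · refine ⟨supNorm (h i), fun t ht => ?_⟩
    rw [hI i hi ht]
    exact norm_le_supNorm ((memLp_congr_ae (hh i hi).2).1 (hgm i hi.le)) (hcont i hi) ht
  · refine ⟨supNorm (g (r - 1 + 1)), ENNReal.toReal_nonneg, fun s t hs ht => ?_⟩
    rw [hI (r - 1) (by omega) hs, hI (r - 1) (by omega) ht]
    exact hlip (r - 1) (by omega) s t hs ht

/-- The bounds of the single derivatives serve only to place `refState` in `L^∞`; the estimate then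
follows from continuity. -/
theorem norm_refState_le {r : ℕ} (hr : 1 ≤ r) {yref : ℝ → Vec m}
    (hc : ContinuousOn yref (Ici 0)) (hy : MemSobolevInf r yref) {t : ℝ} (ht : 0 ≤ t) :
    ‖refState r yref t‖ ≤ supNorm (refState r yref) := by
  obtain ⟨h1, -, h3, -⟩ := reference_regularity hr hc hy
  choose K hK using fun i : Fin r => h3 i i.2
  have hcr : ContinuousOn (refState r yref) (Ici 0) :=
    (PiLp.continuous_toLp 2 _).comp_continuousOn (continuousOn_pi.2 fun i => h1 i i.2)
  refine norm_le_supNorm (memLp_top_of_continuousOn hcr (K := √(∑ i, K i ^ 2)) fun s hs => ?_) hcr ht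
  rw [PiLp.norm_eq_of_L2]
  refine Real.sqrt_le_sqrt (Finset.sum_le_sum fun i _ => ?_)
  exact pow_le_pow_left₀ (norm_nonneg _) (hK i s hs) 2

end Sobolev

/-! ## Absolutely continuous curves -/

section AbsolutelyContinuous

variable {m : ℕ}

theorem absolutelyContinuousOnInterval_apply {f : ℝ → Vec m} {a b : ℝ}
    (hf : AbsolutelyContinuousOnInterval f a b) (j : Fin m) :
    AbsolutelyContinuousOnInterval (fun t => f t j) a b := by
  rw [absolutelyContinuousOnInterval_iff] at hf ⊢
  intro ε hε
  obtain ⟨δ, hδ, h⟩ := hf ε hε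
  refine ⟨δ, hδ, fun E hE hlt => lt_of_le_of_lt (Finset.sum_le_sum fun i _ => ?_) (h E hE hlt)⟩
  rw [dist_eq_norm, dist_eq_norm, ← PiLp.sub_apply]
  exact PiLp.norm_apply_le _ _

/-- The fundamental theorem of calculus for absolutely continuous curves. -/
theorem integral_of_absolutelyContinuous {f g : ℝ → Vec m} {T : ℝ}
    (hf : AbsolutelyContinuousOnInterval f 0 T)
    (hg : ∀ᵐ t : ℝ, t ∈ uIoc 0 T → HasDerivAt f (g t) t) :
    IntervalIntegrable g volume 0 T ∧ f T = f 0 + ∫ t in 0..T, g t := by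
  have hd : ∀ j : Fin m, ∀ᵐ t : ℝ, t ∈ uIoc 0 T → deriv (fun t => f t j) t = g t j := by
    intro j
    filter_upwards [hg] with t ht htI
    have := ((EuclideanSpace.proj j : Vec m →L[ℝ] ℝ).hasFDerivAt.comp_hasDerivAt t (ht htI))
    exact this.deriv
  have hi : ∀ j : Fin m, IntervalIntegrable (fun t => g t j) volume 0 T := by
    intro j
    refine (absolutelyContinuousOnInterval_apply hf j).intervalIntegrable_deriv.congr_ae ?_
    rw [Filter.EventuallyEq, ae_restrict_iff' measurableSet_uIoc]
    exact hd j
  have hint : IntervalIntegrable g volume 0 T :=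
    ⟨Integrable.of_eval_piLp fun j => (hi j).1, Integrable.of_eval_piLp fun j => (hi j).2⟩
  refine ⟨hint, ?_⟩
  rw [← sub_eq_iff_eq_add']
  ext j
  rw [integral_apply hint, PiLp.sub_apply,
    ← (absolutelyContinuousOnInterval_apply hf j).integral_deriv_eq_sub]
  exact intervalIntegral.integral_congr_ae (hd j)

end AbsolutelyContinuous

/-! ## The time domain -/

section TimeDomain

variable {ω : EReal}

theorem timeDomain_top : timeDomain ⊤ = Ici 0 := by
  ext t; simp [timeDomain]

theorem Icc_subset_timeDomain {t : ℝ} (ht : t ∈ timeDomain ω) : Icc 0 t ⊆ timeDomain ω :=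
  fun _ hs => ⟨hs.1, lt_of_le_of_lt (EReal.coe_le_coe_iff.2 hs.2) ht.2⟩

theorem timeDomain_mem_nhdsWithin {t : ℝ} (ht : t ∈ timeDomain ω) : timeDomain ω ∈ 𝓝[Ici 0] t := by
  rw [mem_nhdsWithin]
  refine ⟨{s : ℝ | (s : EReal) < ω}, ?_, ht.2, fun s hs => ⟨hs.2, hs.1⟩⟩
  exact isOpen_lt continuous_coe_real_ereal continuous_const

theorem timeDomain_mem_nhdsGE {t : ℝ} (ht : t ∈ timeDomain ω) : timeDomain ω ∈ 𝓝[≥] t :=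
  nhdsWithin_mono t (Ici_subset_Ici.2 ht.1) (timeDomain_mem_nhdsWithin ht)

/-- Near each of its points the time domain coincides with `Ici 0`, whatever `ω` is. -/
theorem uniqueDiffOn_timeDomain : UniqueDiffOn ℝ (timeDomain ω) := by
  intro t ht
  refine (uniqueDiffOn_Ici (0 : ℝ) t ht.1).mono_nhds ?_
  exact le_of_eq (nhdsWithin_eq_iff_eventuallyEq.2 (by
    have := timeDomain_mem_nhdsWithin ht
    filter_upwards [mem_nhdsWithin_iff_eventually.1 this] with s hs
    exact propext ⟨fun h => hs h, fun h => h.1⟩))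

end TimeDomain

/-! ## Availability of the measurement -/

section Availability

variable {a : ℝ → ℝ}

/-- Two values in `{0, 1}` at distance less than `1/2` agree, so left-continuity means being
constant just before `t`. -/
theorem IsAvailability.eventuallyEq_left (ha : IsAvailability a) {t : ℝ} (ht : 0 < t) :
    ∀ᶠ s in 𝓝[≤] t, a s = a t := by
  have h := ha.left_cont t ht
  have h1 := h.eventually (Metric.ball_mem_nhds (a t) one_half_pos)
  have h2 : ∀ᶠ s in 𝓝[≤] t, 0 < s := mem_nhdsWithin_of_mem_nhds (Ioi_mem_nhds ht)
  filter_upwards [h1, h2] with s hs hs0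
  rw [Real.dist_eq, abs_lt] at hs
  rcases ha.values s hs0.le with h3 | h3 <;> rcases ha.values t ht.le with h4 | h4 <;>
    linarith [hs.1, hs.2]

/-- The supremum of times in `[0, t]` with a given availability has that availability. -/
theorem IsAvailability.sSup_mem (ha : IsAvailability a) {v t : ℝ}
    (hne : {s ∈ Icc 0 t | a s = v}.Nonempty) :
    sSup {s ∈ Icc 0 t | a s = v} ∈ {s ∈ Icc 0 t | a s = v} := by
  set S := {s ∈ Icc 0 t | a s = v} with hS
  have hbdd : BddAbove S := ⟨t, fun s hs => hs.1.2⟩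
  obtain ⟨s₀, hs₀⟩ := hne
  have h0 : 0 ≤ sSup S := hs₀.1.1.trans (le_csSup hbdd hs₀)
  have ht : sSup S ≤ t := csSup_le ⟨s₀, hs₀⟩ fun s hs => hs.1.2
  refine ⟨⟨h0, ht⟩, ?_⟩
  rcases h0.eq_or_lt with h | h
  · have : s₀ = 0 := le_antisymm ((le_csSup hbdd hs₀).trans h.symm.le) hs₀.1.1
    rw [← h, ← this]; exact hs₀.2
  · obtain ⟨l, hl, hlS⟩ := (mem_nhdsLE_iff_exists_Ioc_subset).1 (ha.eventuallyEq_left h)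
    obtain ⟨s, hs, hls⟩ := exists_lt_of_lt_csSup ⟨s₀, hs₀⟩ hl
    rw [← hlS ⟨hls, le_csSup hbdd hs⟩]
    exact hs.2

/-- The alternative `τ = 0` covers the initial phase, which no loss precedes; there the maximum is
the inserted element `0`. -/
theorem lastLoss_eq {τ t : ℝ} (hτ : 0 ≤ τ) (hτt : τ ≤ t) (h0 : τ = 0 ∨ a τ = 0)
    (h : ∀ s ∈ Ioc τ t, a s = 1) : lastLoss a t = τ := by
  refine IsGreatest.csSup_eq ⟨?_, ?_⟩
  · rcases h0 with h0 | h0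
    · exact Or.inl h0
    · exact Or.inr ⟨⟨hτ, hτt⟩, h0⟩
  · rintro s (hs | hs)
    · rw [hs]; exact hτ
    · by_contra hlt
      have := h s ⟨not_le.1 hlt, hs.1.2⟩
      rw [hs.2] at this; norm_num at this

/-- The available time interval before an available time `t`. -/
theorem IsAvailability.exists_last_loss (ha : IsAvailability a) {t : ℝ} (ht : 0 ≤ t)
    (hat : a t = 1) : ∃ τ, 0 ≤ τ ∧ τ ≤ t ∧ (τ = 0 ∨ a τ = 0) ∧ (∀ s ∈ Ioc τ t, a s = 1) ∧
      (a τ = 0 → τ < t) := by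
  by_cases hne : {s ∈ Icc 0 t | a s = 0}.Nonempty
  · have h := ha.sSup_mem hne
    refine ⟨_, h.1.1, h.1.2, Or.inr h.2, fun s hs => ?_, fun h' => ?_⟩
    · have hs0 : 0 ≤ s := h.1.1.trans hs.1.le
      refine (ha.values s hs0).resolve_left fun h0 => ?_
      exact absurd (le_csSup ⟨t, fun x hx => hx.1.2⟩ (show s ∈ {s ∈ Icc 0 t | a s = 0} from
        ⟨⟨hs0, hs.2⟩, h0⟩)) (not_le.2 hs.1)
    · refine lt_of_le_of_ne h.1.2 fun heq => ?_
      rw [heq, hat] at h'; norm_num at h'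
  · have h1 : ∀ s ∈ Icc 0 t, a s = 1 := fun s hs =>
      (ha.values s hs.1).resolve_left fun h0 => hne ⟨s, hs, h0⟩
    refine ⟨0, le_rfl, ht, Or.inl rfl, fun s hs => h1 s ⟨hs.1.le, hs.2⟩, fun h' => ?_⟩
    rw [h1 0 ⟨le_rfl, ht⟩] at h'; norm_num at h'

/-- The structure of the times before a time `t` at which the measurement is lost: the loss begins
at `σ`, and the measurement is available on `(τ, σ]`, with `σ - τ ≥ δ` and `t - σ ≤ Δ`. -/
theorem IsAvailability.exists_loss_interval (ha : IsAvailability a) {Δ δ : ℝ} (hδ : 0 < δ)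
    (hloss : LossAtMost a Δ) (havail : AvailableAtLeast a δ) {t : ℝ} (ht : 0 ≤ t)
    (hat : a t = 0) : ∃ τ σ, 0 ≤ τ ∧ τ + δ ≤ σ ∧ σ < t ∧ t - σ ≤ Δ ∧ (τ = 0 ∨ a τ = 0) ∧
      (∀ s ∈ Ioc τ σ, a s = 1) ∧ (∀ s ∈ Ioc σ t, a s = 0) := by
  have ha0 : a 0 = 1 := havail.1 0 ⟨le_rfl, hδ.le⟩
  have hne : {s ∈ Icc 0 t | a s = 1}.Nonempty := ⟨0, ⟨le_rfl, ht⟩, ha0⟩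
  have h := ha.sSup_mem hne
  set σ := sSup {s ∈ Icc 0 t | a s = 1} with hσ
  obtain ⟨⟨hσ0, hσt⟩, haσ⟩ := h
  have hlt : σ < t := lt_of_le_of_ne hσt fun heq => by rw [heq, hat] at haσ; norm_num at haσ
  have hl : ∀ s ∈ Ioc σ t, a s = 0 := by
    intro s hs
    have hs0 : 0 ≤ s := hσ0.trans hs.1.le
    refine (ha.values s hs0).resolve_right fun h0 => ?_
    exact absurd (le_csSup ⟨t, fun x hx => hx.1.2⟩ (show s ∈ {s ∈ Icc 0 t | a s = 1} from
      ⟨⟨hs0, hs.2⟩, h0⟩)) (not_le.2 hs.1)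
  obtain ⟨τ, hτ0, hτσ, hτ, hav, hτlt⟩ := ha.exists_last_loss hσ0 haσ
  refine ⟨τ, σ, hτ0, ?_, hlt, hloss σ t hσ0 hlt hl, hτ, hav, hl⟩
  have hδ1 : ∀ s ∈ Ioc τ (τ + δ), a s = 1 := by
    by_cases h0 : a τ = 0
    · refine havail.2 τ hτ0 h0 ⟨σ - τ, sub_pos.2 (hτlt h0), fun s hs => hav s ⟨hs.1, ?_⟩⟩
      linarith [hs.2]
    · have : τ = 0 := hτ.resolve_right h0
      intro s hs
      rw [this, zero_add] at hs
      exact havail.1 s ⟨hs.1.le, hs.2⟩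
  -- If the available phase were shorter than `δ`, the time `min t (τ + δ)` would belong both to the
  -- loss and to the guaranteed availability.
  by_contra hcon
  push Not at hcon
  set s := min t (τ + δ) with hs
  have h1 : σ < s := lt_min hlt hcon
  have h2 := hl s ⟨h1, min_le_left _ _⟩
  have h3 := hδ1 s ⟨hτσ.trans_lt h1, min_le_right _ _⟩
  rw [h2] at h3; norm_num at h3

theorem shiftedFunnel_of_loss {φ₀ : ℝ → ℝ} {t : ℝ} (h : a t = 0) : shiftedFunnel a φ₀ t = 0 :=
  if_pos h

theorem shiftedFunnel_of_available {φ₀ : ℝ → ℝ} {τ t : ℝ} (hτ : 0 ≤ τ) (hτt : τ ≤ t)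
    (h0 : τ = 0 ∨ a τ = 0) (h : ∀ s ∈ Ioc τ t, a s = 1) (hat : a t = 1) :
    shiftedFunnel a φ₀ t = φ₀ (t - τ) := by
  rw [shiftedFunnel, if_neg (by rw [hat]; norm_num), lastLoss_eq hτ hτt h0 h]

theorem shiftedFunnel_mem_Icc (ha : IsAvailability a) {φ₀ : ℝ → ℝ}
    (hφ : ∀ t₁ t₂, 0 ≤ t₁ → t₁ ≤ t₂ → 0 < φ₀ t₁ ∧ φ₀ t₁ ≤ φ₀ t₂) {t T : ℝ} (ht : t ∈ Icc 0 T) :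
    shiftedFunnel a φ₀ t ∈ Icc 0 (φ₀ T) := by
  have hT : 0 ≤ φ₀ T := (hφ T T (ht.1.trans ht.2) le_rfl).1.le
  rcases ha.values t ht.1 with h | h
  · rw [shiftedFunnel_of_loss h]; exact ⟨le_rfl, hT⟩
  · obtain ⟨τ, hτ0, hτt, hτ, hav, -⟩ := ha.exists_last_loss ht.1 h
    rw [shiftedFunnel_of_available hτ0 hτt hτ hav h]
    have h1 := hφ (t - τ) T (sub_nonneg.2 hτt) (by linarith [ht.2])
    exact ⟨h1.1.le, h1.2⟩

/-! ### Continuity and measurability off the jump times -/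

/-- The jump times of the availability. -/
def jumpSet (a : ℝ → ℝ) : Set ℝ := {t ∈ Ici 0 | ¬ ContinuousWithinAt a (Ici 0) t}

theorem IsAvailability.countable_jumpSet (ha : IsAvailability a) : (jumpSet a).Countable := by
  have : jumpSet a = ⋃ n : ℕ, {t ∈ Icc 0 (n : ℝ) | ¬ ContinuousWithinAt a (Ici 0) t} := by
    ext t
    simp only [jumpSet, mem_ofPred_eq, mem_iUnion, mem_Icc, mem_Ici]
    constructor
    · rintro ⟨h0, h1⟩
      obtain ⟨n, hn⟩ := exists_nat_ge t
      exact ⟨n, ⟨h0, hn⟩, h1⟩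
    · rintro ⟨n, ⟨h0, -⟩, h1⟩; exact ⟨h0, h1⟩
  rw [this]
  exact countable_iUnion fun n => (ha.finite_jumps n).countable

theorem IsAvailability.eventuallyEq (ha : IsAvailability a) {t : ℝ} (ht : 0 ≤ t)
    (hj : t ∉ jumpSet a) : ∀ᶠ s in 𝓝[Ici 0] t, a s = a t := by
  have h : ContinuousWithinAt a (Ici 0) t := by
    by_contra h; exact hj ⟨ht, h⟩
  filter_upwards [h.eventually (Metric.ball_mem_nhds (a t) one_half_pos),
    self_mem_nhdsWithin] with s hs hs0
  rw [Real.dist_eq, abs_lt] at hs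
  rcases ha.values s hs0 with h3 | h3 <;> rcases ha.values t ht with h4 | h4 <;>
    linarith [hs.1, hs.2]

/-- Off the jumps the availability is locally constant. Near a lost time `φ` vanishes; near an
available one the last loss `τ` does not move, so `φ` is a fixed translate of `φ₀`. -/
theorem continuousWithinAt_shiftedFunnel (ha : IsAvailability a) {φ₀ : ℝ → ℝ}
    (hφ : ContinuousOn φ₀ (Ici 0)) {t : ℝ} (ht : 0 ≤ t) (hj : t ∉ jumpSet a) :
    ContinuousWithinAt (shiftedFunnel a φ₀) (Ici 0) t := by
  have hev := ha.eventuallyEq ht hj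
  rcases ha.values t ht with h | h
  · refine (continuousWithinAt_const (b := (0 : ℝ))).congr_of_eventuallyEq ?_
      (shiftedFunnel_of_loss h)
    filter_upwards [hev] with s hs
    exact shiftedFunnel_of_loss (hs.trans h)
  · obtain ⟨ε, hε, hεs⟩ := Metric.mem_nhdsWithin_iff.1 hev
    have hball : ∀ s, 0 ≤ s → |s - t| < ε → a s = 1 := fun s hs hst =>
      (hεs ⟨by rwa [Metric.mem_ball, Real.dist_eq], hs⟩).trans h
    obtain ⟨τ, hτ0, hτt, hτ, hav, hτlt⟩ := ha.exists_last_loss ht h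
    have heq : ∀ s, 0 ≤ s → |s - t| < ε → τ ≤ s ∧ shiftedFunnel a φ₀ s = φ₀ (s - τ) := by
      intro s hs hst
      have hτs : τ ≤ s := by
        by_contra hlt
        push Not at hlt
        have h0 : a τ = 0 := hτ.resolve_left fun h' => by linarith
        have : a τ = 1 := hball τ hτ0 (by rw [abs_lt] at hst ⊢; constructor <;> linarith)
        rw [h0] at this; norm_num at this
      refine ⟨hτs, shiftedFunnel_of_available hτ0 hτs hτ (fun x hx => ?_) (hball s hs hst)⟩
      rcases le_or_gt x t with hxt | hxt
      · exact hav x ⟨hx.1, hxt⟩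
      · refine hball x (hτ0.trans hx.1.le) ?_
        rw [abs_lt] at hst ⊢; constructor <;> linarith [hx.2]
    -- The truncation keeps the argument in `Ici 0`, the only place where `φ₀` is known to be
    -- continuous.
    have hc : ContinuousWithinAt (fun s => φ₀ (max (s - τ) 0)) (Ici 0) t := by
      have h1 : Continuous fun s : ℝ => max (s - τ) 0 := by fun_prop
      exact (hφ.comp_continuous h1 fun s => mem_Ici.2 (le_max_right _ _)).continuousWithinAt
    refine hc.congr_of_eventuallyEq ?_ ?_
    · filter_upwards [self_mem_nhdsWithin, mem_nhdsWithin_of_mem_nhds (Metric.ball_mem_nhds t hε)]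
        with s hs hst
      rw [Metric.mem_ball, Real.dist_eq] at hst
      obtain ⟨h1, h2⟩ := heq s hs hst
      rw [h2, max_eq_left (sub_nonneg.2 h1)]
    · obtain ⟨h1, h2⟩ := heq t ht (by simpa using hε)
      rw [h2, max_eq_left (sub_nonneg.2 h1)]

/-- The exceptional set is null, and `f` is continuous on the measurable rest. This serves for
right-hand sides that jump with the availability. -/
theorem aestronglyMeasurable_of_countable {E : Type*} [TopologicalSpace E]
    [TopologicalSpace.PseudoMetrizableSpace E] [SecondCountableTopology E] {f : ℝ → E}
    {S J : Set ℝ} (hS : MeasurableSet S) (hJ : J.Countable)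
    (hf : ∀ t ∈ S, t ∉ J → ContinuousWithinAt f S t) :
    AEStronglyMeasurable f (volume.restrict S) := by
  have hm : MeasurableSet (S \ J) := hS.diff hJ.measurableSet
  have h1 : ContinuousOn f (S \ J) := fun t ht => (hf t ht.1 ht.2).mono sdiff_subset
  have h2 := h1.aestronglyMeasurable (μ := volume) hm
  rwa [Measure.restrict_congr_set (sdiff_null_ae_eq_self (hJ.measure_zero volume))] at h2

end Availability

/-! ## The nonlinear gain and the auxiliary errors -/

section Gain

variable {m : ℕ}

theorem alpha_pos {s : ℝ} (hs : s < 1) : 0 < alpha s := one_div_pos.2 (sub_pos.2 hs)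

theorem alpha_mono {s t : ℝ} (hst : s ≤ t) (ht : t < 1) : alpha s ≤ alpha t :=
  one_div_le_one_div_of_le (sub_pos.2 ht) (by linarith)

theorem alphaTilde_nonneg {s : ℝ} (hs : 0 ≤ s) : 0 ≤ alphaTilde s := by
  unfold alphaTilde; positivity

theorem alphaTilde_mono {s t : ℝ} (hs : 0 ≤ s) (hst : s ≤ t) (ht : t < 1) :
    alphaTilde s ≤ alphaTilde t := by
  unfold alphaTilde
  have : 0 < 1 - t := sub_pos.2 ht
  have : 0 ≤ 1 + t := by linarith
  gcongr

theorem sq_lt_one {x : ℝ} (h0 : 0 ≤ x) (h1 : x < 1) : x ^ 2 < 1 := by nlinarith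

theorem alphaDagger_lt_one {z : ℝ} (hz : 0 ≤ z) : alphaDagger z < 1 := by
  unfold alphaDagger; rw [div_lt_one (by linarith)]; linarith

/-- `alphaDagger` inverts `w ↦ α(w) w` on `[0, 1)`. This is how a lower bound for a radius in the
design becomes enough damping on the corresponding sphere. -/
theorem le_alpha_mul_of_alphaDagger_le {z w : ℝ} (hz : 0 ≤ z) (hw : w < 1)
    (h : alphaDagger z ≤ w) : z ≤ alpha w * w := by
  unfold alphaDagger at h
  rw [div_le_iff₀ (by linarith)] at h
  rw [alpha, one_div, ← div_eq_inv_mul, le_div_iff₀ (sub_pos.2 hw)]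
  linarith

/-- The map `v ↦ α(‖v‖²) v`. -/
noncomputable def gain (v : Vec m) : Vec m := alpha (‖v‖ ^ 2) • v

theorem auxError_succ (φ : ℝ) (ε : ℕ → Vec m) (i : ℕ) :
    auxError φ ε (i + 1) = φ • ε i + gain (auxError φ ε i) := rfl

theorem auxError_zero (φ : ℝ) (ε : ℕ → Vec m) : auxError φ ε 0 = 0 := rfl

theorem gain_zero : gain (0 : Vec m) = 0 := smul_zero _

theorem norm_gain {v : Vec m} (hv : ‖v‖ < 1) : ‖gain v‖ = ‖v‖ * alpha (‖v‖ ^ 2) := by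
  rw [gain, norm_smul, Real.norm_of_nonneg (alpha_pos (sq_lt_one (norm_nonneg _) hv)).le, mul_comm]

theorem norm_gain_le {v : Vec m} {c : ℝ} (hv : ‖v‖ ≤ c) (hc : c < 1) :
    ‖gain v‖ ≤ c * alpha (c ^ 2) := by
  have h0 := norm_nonneg v
  have hv1 : ‖v‖ < 1 := hv.trans_lt hc
  rw [norm_gain hv1]
  refine mul_le_mul hv (alpha_mono ?_ (sq_lt_one (h0.trans hv) hc))
    (alpha_pos (sq_lt_one h0 hv1)).le (h0.trans hv)
  gcongr

theorem inner_gain (v : Vec m) : inner ℝ v (gain v) = alpha (‖v‖ ^ 2) * ‖v‖ ^ 2 := by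
  rw [gain, inner_smul_right, real_inner_self_eq_norm_sq]

/-- The chain rule for `v ↦ α(‖v‖²) v`, with the bound `α̃(c²)` of the derivative. -/
theorem exists_hasDerivWithinAt_gain {v : ℝ → Vec m} {v' : Vec m} {S : Set ℝ} {t c : ℝ}
    (hv : HasDerivWithinAt v v' S t) (hvc : ‖v t‖ ≤ c) (hc : c < 1) :
    ∃ g' : Vec m, HasDerivWithinAt (fun s => gain (v s)) g' S t ∧
      ‖g'‖ ≤ alphaTilde (c ^ 2) * ‖v'‖ := by
  have h0 := norm_nonneg (v t)
  have hs1 : ‖v t‖ ^ 2 < 1 := sq_lt_one h0 (hvc.trans_lt hc)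
  have hpos : 0 < 1 - ‖v t‖ ^ 2 := sub_pos.2 hs1
  have h1 : HasDerivWithinAt (fun s => ‖v s‖ ^ 2) (2 * inner ℝ (v t) v') S t := hv.norm_sq
  have h2 : HasDerivWithinAt (fun s => alpha (‖v s‖ ^ 2))
      (2 * inner ℝ (v t) v' / (1 - ‖v t‖ ^ 2) ^ 2) S t := by
    have := (h1.const_sub 1).fun_inv hpos.ne'
    simpa only [alpha, one_div, neg_neg] using this
  refine ⟨_, h2.smul hv, ?_⟩
  refine (norm_add_le _ _).trans ?_
  rw [norm_smul, norm_smul, Real.norm_of_nonneg (alpha_pos hs1).le]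
  have h3 : ‖2 * inner ℝ (v t) v' / (1 - ‖v t‖ ^ 2) ^ 2‖ ≤
      2 * (‖v t‖ * ‖v'‖) / (1 - ‖v t‖ ^ 2) ^ 2 := by
    rw [norm_div, norm_mul, Real.norm_two, Real.norm_of_nonneg (sq_nonneg (1 - ‖v t‖ ^ 2))]
    gcongr
    exact norm_inner_le_norm _ _
  calc alpha (‖v t‖ ^ 2) * ‖v'‖ + ‖2 * inner ℝ (v t) v' / (1 - ‖v t‖ ^ 2) ^ 2‖ * ‖v t‖
      ≤ alpha (‖v t‖ ^ 2) * ‖v'‖ + 2 * (‖v t‖ * ‖v'‖) / (1 - ‖v t‖ ^ 2) ^ 2 * ‖v t‖ := by gcongr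
    _ = alphaTilde (‖v t‖ ^ 2) * ‖v'‖ := by
        unfold alpha alphaTilde
        field_simp
        ring
    _ ≤ alphaTilde (c ^ 2) * ‖v'‖ := by
        refine mul_le_mul_of_nonneg_right (alphaTilde_mono (sq_nonneg _) ?_
          (sq_lt_one (h0.trans hvc) hc)) (norm_nonneg _)
        gcongr

/-! ### Freezing the gain -/

/-- The map `v ↦ α(‖v‖²) v` with the gain frozen outside the ball of radius `k`. -/
noncomputable def cutGain (k : ℝ) (v : Vec m) : Vec m := alpha ((min ‖v‖ k) ^ 2) • v

theorem cutGain_eq_gain {k : ℝ} {v : Vec m} (hv : ‖v‖ ≤ k) : cutGain k v = gain v := by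
  rw [cutGain, gain, min_eq_left hv]

theorem cutGain_zero (k : ℝ) : cutGain k (0 : Vec m) = 0 := smul_zero _

/-- A Lipschitz constant of `cutGain k`. -/
noncomputable def cutGainLip (k : ℝ) : ℝ := 1 / (1 - k ^ 2) + 2 / (1 - k ^ 2) ^ 2

theorem cutGainLip_nonneg {k : ℝ} (h0 : 0 ≤ k) (h1 : k < 1) : 0 ≤ cutGainLip k := by
  have : 0 < 1 - k ^ 2 := sub_pos.2 (sq_lt_one h0 h1)
  unfold cutGainLip; positivity

theorem norm_cutGain_sub_le {k : ℝ} (h0 : 0 ≤ k) (h1 : k < 1) (v w : Vec m) :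
    ‖cutGain k v - cutGain k w‖ ≤ cutGainLip k * ‖v - w‖ := by
  wlog hwv : ‖w‖ ≤ ‖v‖ generalizing v w
  · rw [norm_sub_rev, norm_sub_rev v w]
    exact this w v (le_of_not_ge hwv)
  have hk : 0 < 1 - k ^ 2 := sub_pos.2 (sq_lt_one h0 h1)
  set p := min ‖v‖ k with hp
  set p' := min ‖w‖ k with hp'
  have hp0 : 0 ≤ p := le_min (norm_nonneg _) h0
  have hp0' : 0 ≤ p' := le_min (norm_nonneg _) h0
  have hpk : p ≤ k := min_le_right _ _
  have hpk' : p' ≤ k := min_le_right _ _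
  have hpp : p' ≤ p := min_le_min_right _ hwv
  have hq : 1 - k ^ 2 ≤ 1 - p ^ 2 := by gcongr
  have hq' : 1 - k ^ 2 ≤ 1 - p' ^ 2 := by gcongr
  have hα : |alpha (p ^ 2)| ≤ 1 / (1 - k ^ 2) := by
    rw [alpha, abs_of_pos (one_div_pos.2 (hk.trans_le hq))]
    exact one_div_le_one_div_of_le hk hq
  -- The gain does not vary beyond radius `k`, so only `‖w‖ < k` matters; then the factor `‖w‖` is
  -- at most one and `p - p' ≤ ‖v‖ - ‖w‖`.
  have hdiff : |alpha (p ^ 2) - alpha (p' ^ 2)| * ‖w‖ ≤ 2 / (1 - k ^ 2) ^ 2 * ‖v - w‖ := by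
    rcases le_or_gt k ‖w‖ with hkw | hkw
    · have : p = p' := by rw [hp, hp', min_eq_right hkw, min_eq_right (hkw.trans hwv)]
      rw [this, sub_self, abs_zero, zero_mul]; positivity
    · have hsub : p - p' ≤ ‖v - w‖ := by
        have h2 : p' = ‖w‖ := min_eq_left hkw.le
        have h3 : p ≤ ‖v‖ := min_le_left _ _
        have h4 := norm_sub_norm_le v w
        linarith
      have hw1 : ‖w‖ ≤ 1 := (hkw.trans h1).le
      have heq : alpha (p ^ 2) - alpha (p' ^ 2) =
          (p - p') * (p + p') / ((1 - p ^ 2) * (1 - p' ^ 2)) := by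
        have := (hk.trans_le hq).ne'
        have := (hk.trans_le hq').ne'
        unfold alpha; field_simp; ring
      rw [heq, abs_of_nonneg (by
        have := hk.trans_le hq
        have := hk.trans_le hq'
        have := sub_nonneg.2 hpp
        positivity)]
      calc (p - p') * (p + p') / ((1 - p ^ 2) * (1 - p' ^ 2)) * ‖w‖
          ≤ ‖v - w‖ * 2 / ((1 - k ^ 2) * (1 - k ^ 2)) * 1 := by
            have := sub_nonneg.2 hpp
            have : p + p' ≤ 2 := by linarith
            have := hk.trans_le hq
            have := hk.trans_le hq'
            gcongr
        _ = 2 / (1 - k ^ 2) ^ 2 * ‖v - w‖ := by ring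
  have hdec : cutGain k v - cutGain k w =
      alpha (p ^ 2) • (v - w) + (alpha (p ^ 2) - alpha (p' ^ 2)) • w := by
    simp only [cutGain, ← hp, ← hp']
    module
  rw [hdec]
  refine (norm_add_le _ _).trans ?_
  rw [norm_smul, norm_smul, Real.norm_eq_abs, Real.norm_eq_abs, cutGainLip, add_mul]
  exact add_le_add (mul_le_mul_of_nonneg_right hα (norm_nonneg _)) hdiff

theorem continuous_cutGain {k : ℝ} (h0 : 0 ≤ k) (h1 : k < 1) :
    Continuous (cutGain k : Vec m → Vec m) := by
  refine (LipschitzWith.of_dist_le_mul (K := Real.toNNReal (cutGainLip k)) fun v w => ?_).continuous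
  rw [dist_eq_norm, dist_eq_norm, Real.coe_toNNReal _ (cutGainLip_nonneg h0 h1)]
  exact norm_cutGain_sub_le h0 h1 v w

/-- The auxiliary errors, with the gain frozen outside the ball of radius `k`. -/
noncomputable def cutError (k φ : ℝ) (ε : ℕ → Vec m) : ℕ → Vec m
  | 0 => 0
  | i + 1 => φ • ε i + cutGain k (cutError k φ ε i)

theorem cutError_succ (k φ : ℝ) (ε : ℕ → Vec m) (i : ℕ) :
    cutError k φ ε (i + 1) = φ • ε i + cutGain k (cutError k φ ε i) := rfl

/-- Only indices below `n` are tested, since the error of index `n` does not involve its own gain.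
This version is for bounds known for the original errors; the next is for bounds known for the
frozen ones, which are the continuous ones. -/
theorem cutError_eq_of_auxError_le {k φ : ℝ} {ε : ℕ → Vec m} {n : ℕ}
    (h : ∀ j < n, ‖auxError φ ε j‖ ≤ k) : ∀ i ≤ n, cutError k φ ε i = auxError φ ε i := by
  intro i
  induction i with
  | zero => intro _; rfl
  | succ i ih =>
    intro hi
    rw [cutError_succ, auxError_succ, ih (by omega), cutGain_eq_gain (h i hi)]

theorem cutError_eq_of_cutError_le {k φ : ℝ} {ε : ℕ → Vec m} {n : ℕ}
    (h : ∀ j < n, ‖cutError k φ ε j‖ ≤ k) : ∀ i ≤ n, cutError k φ ε i = auxError φ ε i := by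
  intro i
  induction i with
  | zero => intro _; rfl
  | succ i ih =>
    intro hi
    rw [cutError_succ, auxError_succ, cutGain_eq_gain (h i hi), ih (by omega)]

theorem auxError_congr {φ : ℝ} {ε ε' : ℕ → Vec m} {n : ℕ} (h : ∀ j < n, ε j = ε' j) :
    ∀ i ≤ n, auxError φ ε i = auxError φ ε' i := by
  intro i
  induction i with
  | zero => intro _; rfl
  | succ i ih =>
    intro hi
    rw [auxError_succ, auxError_succ, ih (by omega), h i hi]

theorem auxError_zero_left (ε : ℕ → Vec m) (i : ℕ) : auxError 0 ε i = 0 := by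
  induction i with
  | zero => rfl
  | succ i ih => rw [auxError_succ, ih, gain_zero, zero_smul, add_zero]

theorem cutError_continuousWithinAt {k : ℝ} (h0 : 0 ≤ k) (h1 : k < 1) {φ : ℝ → ℝ}
    {ε : ℝ → ℕ → Vec m} {S : Set ℝ} {t : ℝ} {n : ℕ} (hφ : ContinuousWithinAt φ S t)
    (hε : ∀ i < n, ContinuousWithinAt (fun s => ε s i) S t) :
    ∀ i ≤ n, ContinuousWithinAt (fun s => cutError k (φ s) (ε s) i) S t := by
  intro i
  induction i with
  | zero => intro _; exact continuousWithinAt_const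
  | succ i ih =>
    intro hi
    simp only [cutError_succ]
    exact (hφ.smul (hε i hi)).add
      ((continuous_cutGain h0 h1).continuousAt.comp_continuousWithinAt (ih (by omega)))

/-- The errors from the auxiliary errors. -/
theorem norm_le_of_auxError {φ : ℝ} (hφ : 0 < φ) (ε : ℕ → Vec m) {i : ℕ} {c c' : ℝ}
    (h1 : ‖auxError φ ε (i + 1)‖ ≤ c') (h2 : ‖auxError φ ε i‖ ≤ c) (hc : c < 1) :
    ‖ε i‖ ≤ (c' + c * alpha (c ^ 2)) / φ := by
  rw [le_div_iff₀ hφ]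
  have h3 : φ • ε i = auxError φ ε (i + 1) - gain (auxError φ ε i) := by
    rw [auxError_succ, add_sub_cancel_right]
  calc ‖ε i‖ * φ = ‖φ • ε i‖ := by rw [norm_smul, Real.norm_of_nonneg hφ.le, mul_comm]
    _ ≤ _ := by
      rw [h3]
      exact (norm_sub_le _ _).trans (add_le_add h1 (norm_gain_le h2 hc))

end Gain

/-! ## Barrier estimates -/

section Barrier

variable {m : ℕ}

theorem norm_sq_sub_norm_sq (x y : Vec m) : ‖x‖ ^ 2 - ‖y‖ ^ 2 = inner ℝ (x - y) (x + y) := by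
  rw [inner_sub_left, inner_add_right, inner_add_right, real_inner_self_eq_norm_sq,
    real_inner_self_eq_norm_sq, real_inner_comm x y]
  ring

/-- A curve `ψ (p - b) + h` with a Lipschitz continuous `b` does not leave the ball of radius `c`
if its right derivative points inwards on the boundary, whatever the slopes of `b` are. -/
theorem norm_le_of_inner_lt {p p' h h' b : ℝ → Vec m} {ψ ψ' : ℝ → ℝ} {M c t₁ t₂ : ℝ}
    (hψ0 : ∀ s ∈ Icc t₁ t₂, 0 ≤ ψ s)
    (hψ : ∀ s ∈ Ico t₁ t₂, HasDerivWithinAt ψ (ψ' s) (Ici s) s)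
    (hp : ∀ s ∈ Ico t₁ t₂, HasDerivWithinAt p (p' s) (Ici s) s)
    (hh : ∀ s ∈ Ico t₁ t₂, HasDerivWithinAt h (h' s) (Ici s) s)
    (hb : ∀ s ∈ Icc t₁ t₂, ∀ z ∈ Icc t₁ t₂, ‖b z - b s‖ ≤ M * |z - s|)
    (hv : ContinuousOn (fun s => ψ s • (p s - b s) + h s) (Icc t₁ t₂))
    (hc : 0 ≤ c) (h0 : ‖ψ t₁ • (p t₁ - b t₁) + h t₁‖ ≤ c)
    (hneg : ∀ s ∈ Ico t₁ t₂, ‖ψ s • (p s - b s) + h s‖ = c →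
      inner ℝ (ψ s • (p s - b s) + h s) (ψ' s • (p s - b s) + ψ s • p' s + h' s) +
        ψ s * M * c < 0) :
    ∀ s ∈ Icc t₁ t₂, ‖ψ s • (p s - b s) + h s‖ ≤ c := by
  set v : ℝ → Vec m := fun s => ψ s • (p s - b s) + h s with hvdef
  set w : ℝ → Vec m := fun s => ψ' s • (p s - b s) + ψ s • p' s + h' s with hwdef
  -- The comparison principle for `‖v‖²` with the constant barrier `c²` asks only for an upper bound
  -- on right slopes, so `b` needs no derivative.
  have key := image_le_of_liminf_slope_right_lt_deriv_boundary' (f := fun s => ‖v s‖ ^ 2)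
    (f' := fun s => inner ℝ (w s) (v s + v s) + ψ s * (M * ‖v s + v s‖))
    (B := fun _ => c ^ 2) (B' := fun _ => 0) (hv.norm.pow 2) ?_ (by gcongr) continuousOn_const
    (fun s _ => (hasDerivWithinAt_const _ _ _)) ?_
  · intro s hs
    exact le_of_sq_le_sq (key hs) hc
  · intro s hs r hr
    have hsI : s ∈ Icc t₁ t₂ := ⟨hs.1, hs.2.le⟩
    have hIoi : Icc t₁ t₂ ∈ 𝓝[>] s := by
      refine mem_of_superset (Ioo_mem_nhdsGT hs.2) fun z hz => ⟨hs.1.trans hz.1.le, hz.2.le⟩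
    -- With `b` held at its value at `s` the curve is differentiable; the increment of `b` is split
    -- off in `hvz` and enters through `M` alone.
    have hD : HasDerivWithinAt (fun z => ψ z • (p z - b s) + h z) (w s) (Ici s) s := by
      have := ((hψ s hs).smul ((hp s hs).sub_const (b s))).add (hh s hs)
      refine this.congr_deriv ?_
      simp only [hwdef]
      abel
    have hD' : Tendsto (slope (fun z => ψ z • (p z - b s) + h z) s) (𝓝[>] s) (𝓝 (w s)) := by
      have := hasDerivWithinAt_iff_tendsto_slope.1 hD
      rwa [Ici_sdiff_left] at this
    have hvs : Tendsto v (𝓝[>] s) (𝓝 (v s)) :=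
      (hv s hsI).mono_of_mem_nhdsWithin hIoi
    have hψs : Tendsto ψ (𝓝[>] s) (𝓝 (ψ s)) :=
      ((hψ s hs).continuousWithinAt.mono Ioi_subset_Ici_self)
    have hlim : Tendsto (fun z => inner ℝ (slope (fun z => ψ z • (p z - b s) + h z) s z)
        (v z + v s) + ψ z * (M * ‖v z + v s‖)) (𝓝[>] s)
        (𝓝 (inner ℝ (w s) (v s + v s) + ψ s * (M * ‖v s + v s‖))) :=
      (hD'.inner (hvs.add_const _)).add (hψs.mul ((hvs.add_const _).norm.const_mul M))
    refine Eventually.frequently ?_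
    filter_upwards [hlim.eventually (gt_mem_nhds hr), hIoi, self_mem_nhdsWithin] with z hz hzI hzs
    refine lt_of_le_of_lt ?_ hz
    have hzs' : 0 < z - s := sub_pos.2 hzs
    have hvz : v z - v s = (ψ z • (p z - b s) + h z - (ψ s • (p s - b s) + h s)) -
        ψ z • (b z - b s) := by
      simp only [hvdef]; module
    have hsl : slope (fun s => ‖v s‖ ^ 2) s z = (z - s)⁻¹ * inner ℝ (v z - v s) (v z + v s) := by
      rw [slope_def_field, div_eq_inv_mul]
      congr 1
      exact norm_sq_sub_norm_sq (v z) (v s)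
    rw [hsl, hvz, inner_sub_left, mul_sub, sub_eq_add_neg]
    refine add_le_add (le_of_eq ?_) ?_
    · rw [slope_def_module, real_inner_smul_left]
    · rw [real_inner_smul_left, ← mul_neg, ← mul_neg]
      calc (z - s)⁻¹ * (ψ z * -inner ℝ (b z - b s) (v z + v s))
          ≤ (z - s)⁻¹ * (ψ z * (M * (z - s) * ‖v z + v s‖)) := by
            have h1 : -inner ℝ (b z - b s) (v z + v s) ≤ M * (z - s) * ‖v z + v s‖ := by
              refine (neg_le_abs _).trans ((abs_real_inner_le_norm _ _).trans ?_)
              have := hb s hsI z hzI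
              rw [abs_of_pos hzs'] at this
              gcongr
            have := hψ0 z hzI
            gcongr
        _ = ψ z * (M * ‖v z + v s‖) := by field_simp
  · intro s hs hsc
    have hsc' : ‖v s‖ = c := by
      have h1 : ‖v s‖ ^ 2 = c ^ 2 := hsc
      exact (pow_left_inj₀ (norm_nonneg _) hc two_ne_zero).1 h1
    have h2 := hneg s hs hsc'
    have h3 : ‖v s + v s‖ = 2 * c := by
      rw [← two_smul ℝ (v s), norm_smul, Real.norm_two, hsc']
    have h4 : inner ℝ (w s) (v s + v s) = 2 * inner ℝ (v s) (w s) := by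
      rw [inner_add_right, real_inner_comm]; ring
    show inner ℝ (w s) (v s + v s) + ψ s * (M * ‖v s + v s‖) < 0
    rw [h3, h4]
    have h2' : inner ℝ (v s) (w s) + ψ s * M * c < 0 := h2
    linarith

/-- The estimate of an auxiliary error below the top one. -/
theorem lower_error_bound {x x' g g' : ℝ → Vec m} {ψ ψ' : ℝ → ℝ} {μ₀ ζ γ N c t₁ t₂ : ℝ}
    (hμ₀ : 0 ≤ μ₀)
    (hψ0 : ∀ s ∈ Icc t₁ t₂, 0 < ψ s)
    (hψ : ∀ s ∈ Ico t₁ t₂, HasDerivWithinAt ψ (ψ' s) (Ici s) s)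
    (hψ' : ∀ s ∈ Ico t₁ t₂, |ψ' s| ≤ μ₀ * ψ s)
    (hx : ∀ s ∈ Ico t₁ t₂, HasDerivWithinAt x (x' s) (Ici s) s)
    (hg : ∀ s ∈ Ico t₁ t₂, HasDerivWithinAt g (g' s) (Ici s) s)
    (hgζ : ∀ s ∈ Ico t₁ t₂, ‖g s‖ ≤ ζ) (hgγ : ∀ s ∈ Ico t₁ t₂, ‖g' s‖ ≤ γ)
    (hcont : ContinuousOn (fun s => ψ s • x s + g s) (Icc t₁ t₂))
    (hw : ∀ s ∈ Ico t₁ t₂, ‖ψ s • x' s + gain (ψ s • x s + g s)‖ ≤ 1)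
    (hv : ∀ s ∈ Ico t₁ t₂, ‖ψ s • x s + g s‖ ≤ 1)
    (hN : 1 + μ₀ * (1 + ζ) + γ ≤ N) (hN0 : 0 < N) (hcN : alphaDagger N ≤ c ^ 2) (hc0 : 0 ≤ c)
    (hc1 : c < 1) (h0 : ‖ψ t₁ • x t₁ + g t₁‖ ≤ c) :
    (∀ s ∈ Icc t₁ t₂, ‖ψ s • x s + g s‖ ≤ c) ∧
    ∀ s ∈ Ico t₁ t₂, HasDerivWithinAt (fun s => ψ s • x s + g s)
      (ψ' s • x s + ψ s • x' s + g' s) (Ici s) s ∧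
      ‖ψ' s • x s + ψ s • x' s + g' s‖ ≤ N + c * alpha (c ^ 2) := by
  have hc2 : c ^ 2 < 1 := sq_lt_one hc0 hc1
  have hψx : ∀ s ∈ Ico t₁ t₂, ‖ψ' s • x s‖ ≤ μ₀ * (1 + ζ) := by
    intro s hs
    have hp := hψ0 s ⟨hs.1, hs.2.le⟩
    rw [norm_smul, Real.norm_eq_abs]
    calc |ψ' s| * ‖x s‖ ≤ μ₀ * ψ s * ‖x s‖ := by gcongr; exact hψ' s hs
      _ = μ₀ * ‖(ψ s • x s + g s) - g s‖ := by
        rw [add_sub_cancel_right, norm_smul, Real.norm_of_nonneg hp.le, mul_assoc]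
      _ ≤ μ₀ * (1 + ζ) := by
        refine mul_le_mul_of_nonneg_left ((norm_sub_le _ _).trans ?_) hμ₀
        exact add_le_add (hv s hs) (hgζ s hs)
  -- The sum `ψ • x' + gain (ψ • x + g)` is the next auxiliary error, of norm at most one;
  -- separating it leaves the damping term `-gain`.
  have hdec : ∀ s, ψ' s • x s + ψ s • x' s + g' s =
      (ψ' s • x s + (ψ s • x' s + gain (ψ s • x s + g s)) + g' s) -
        gain (ψ s • x s + g s) := fun s => by abel
  have hrest : ∀ s ∈ Ico t₁ t₂,
      ‖ψ' s • x s + (ψ s • x' s + gain (ψ s • x s + g s)) + g' s‖ ≤ N := by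
    intro s hs
    have h1 := hψx s hs
    have h2 := hw s hs
    have h3 := hgγ s hs
    refine (norm_add₃_le).trans ?_
    linarith
  -- Below the top error every term is differentiable, so the whole curve is taken as `p`, with
  -- weight `1` and `b = 0`.
  have hmain := norm_le_of_inner_lt (p := fun s => ψ s • x s + g s)
    (p' := fun s => ψ' s • x s + ψ s • x' s + g' s) (h := fun _ => 0) (h' := fun _ => 0)
    (b := fun _ => 0) (ψ := fun _ => 1) (ψ' := fun _ => 0) (M := 0) (c := c) (t₁ := t₁) (t₂ := t₂)
    (fun _ _ => zero_le_one) (fun s _ => hasDerivWithinAt_const _ _ _)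
    (fun s hs => ((((hψ s hs).smul (hx s hs)).add (hg s hs)).congr_deriv (by abel)))
    (fun s _ => hasDerivWithinAt_const _ _ _) (by simp) (by simpa using hcont) hc0 (by simpa using h0)
    (by
      intro s hs hsc
      simp only [one_smul, sub_zero, add_zero, zero_smul, zero_add, mul_zero, zero_mul] at hsc ⊢
      rw [hdec, inner_sub_right, inner_gain, hsc]
      have h1 := le_alpha_mul_of_alphaDagger_le hN0.le hc2 hcN
      have h2 := real_inner_le_norm (ψ s • x s + g s)
        (ψ' s • x s + (ψ s • x' s + gain (ψ s • x s + g s)) + g' s)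
      rw [hsc] at h2
      have h3 := mul_le_mul_of_nonneg_left (hrest s hs) hc0
      -- Strictness comes from `c < 1`; the design only gives `N ≤ α(c²) c²`.
      have h4 : c * N < 1 * N := mul_lt_mul_of_pos_right hc1 hN0
      linarith)
  simp only [one_smul, sub_zero, add_zero] at hmain
  refine ⟨hmain, fun s hs => ⟨((((hψ s hs).smul (hx s hs)).add (hg s hs)).congr_deriv (by abel)), ?_⟩⟩
  rw [hdec]
  exact (norm_sub_le _ _).trans (add_le_add (hrest s hs)
    (norm_gain_le (hmain s ⟨hs.1, hs.2.le⟩) hc1))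

/-- The estimate of the top auxiliary error. -/
theorem top_error_bound {p f b g g' : ℝ → Vec m} {ψ ψ' : ℝ → ℝ} {Γ : Vec m → Vec m}
    {μ₀ ψ₀ ζ γ K M κ c t₁ t₂ : ℝ} (hμ₀ : 0 ≤ μ₀) (hψ₀ : 0 < ψ₀) (hζ : 0 ≤ ζ) (hγ : 0 ≤ γ)
    (hψ0 : ∀ s ∈ Icc t₁ t₂, ψ₀ ≤ ψ s)
    (hψ : ∀ s ∈ Ico t₁ t₂, HasDerivWithinAt ψ (ψ' s) (Ici s) s)
    (hψ' : ∀ s ∈ Ico t₁ t₂, |ψ' s| ≤ μ₀ * ψ s)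
    (hΓ : ∀ v, κ * ‖v‖ ^ 2 ≤ inner ℝ v (Γ v))
    (hp : ∀ s ∈ Ico t₁ t₂, HasDerivWithinAt p
      (f s - alpha (‖ψ s • (p s - b s) + g s‖ ^ 2) • Γ (ψ s • (p s - b s) + g s)) (Ici s) s)
    (hf : ∀ s ∈ Ico t₁ t₂, ‖f s‖ ≤ K)
    (hb : ∀ s ∈ Icc t₁ t₂, ∀ z ∈ Icc t₁ t₂, ‖b z - b s‖ ≤ M * |z - s|)
    (hg : ∀ s ∈ Ico t₁ t₂, HasDerivWithinAt g (g' s) (Ici s) s)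
    (hgζ : ∀ s ∈ Ico t₁ t₂, ‖g s‖ ≤ ζ) (hgγ : ∀ s ∈ Ico t₁ t₂, ‖g' s‖ ≤ γ)
    (hcont : ContinuousOn (fun s => ψ s • (p s - b s) + g s) (Icc t₁ t₂))
    (hM : 0 ≤ M) (hK : 0 ≤ K)
    (hc0 : 0 < c) (hc1 : c < 1)
    (hcK : (μ₀ * (1 + ζ) + γ) / ψ₀ + K + M < κ * (alpha (c ^ 2) * c ^ 2))
    (h0 : ‖ψ t₁ • (p t₁ - b t₁) + g t₁‖ ≤ c) :
    ∀ s ∈ Icc t₁ t₂, ‖ψ s • (p s - b s) + g s‖ ≤ c := by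
  have hc2 : c ^ 2 < 1 := sq_lt_one hc0.le hc1
  refine norm_le_of_inner_lt (M := M) (fun s hs => hψ₀.le.trans (hψ0 s hs)) hψ hp hg hb hcont
    hc0.le h0 ?_
  intro s hs hsc
  have hps : ψ₀ ≤ ψ s := hψ0 s ⟨hs.1, hs.2.le⟩
  have hpos : 0 < ψ s := hψ₀.trans_le hps
  set v := ψ s • (p s - b s) + g s with hv
  have h1 : inner ℝ v (ψ' s • (p s - b s)) ≤ c * (μ₀ * (1 + ζ)) := by
    refine (real_inner_le_norm _ _).trans ?_
    rw [hsc]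
    refine mul_le_mul_of_nonneg_left ?_ hc0.le
    rw [norm_smul, Real.norm_eq_abs]
    calc |ψ' s| * ‖p s - b s‖ ≤ μ₀ * ψ s * ‖p s - b s‖ := by gcongr; exact hψ' s hs
      _ = μ₀ * ‖v - g s‖ := by
        rw [hv, add_sub_cancel_right, norm_smul, Real.norm_of_nonneg hpos.le, mul_assoc]
      _ ≤ μ₀ * (1 + ζ) := by
        refine mul_le_mul_of_nonneg_left ((norm_sub_le _ _).trans ?_) hμ₀
        exact add_le_add (hsc.le.trans hc1.le) (hgζ s hs)
  have h2 : inner ℝ v (g' s) ≤ c * γ := by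
    refine (real_inner_le_norm _ _).trans ?_
    rw [hsc]
    exact mul_le_mul_of_nonneg_left (hgγ s hs) hc0.le
  have h3 : inner ℝ v (f s) ≤ c * K := by
    refine (real_inner_le_norm _ _).trans ?_
    rw [hsc]
    exact mul_le_mul_of_nonneg_left (hf s hs) hc0.le
  have h4 : κ * (alpha (c ^ 2) * c ^ 2) ≤ alpha (c ^ 2) * inner ℝ v (Γ v) := by
    have := mul_le_mul_of_nonneg_left (hΓ v) (alpha_pos hc2).le
    rw [hsc] at this
    linarith
  rw [inner_add_right, inner_add_right, real_inner_smul_right v _ (ψ s), inner_sub_right v (f s),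
    hsc, real_inner_smul_right v _ (alpha (c ^ 2))]
  -- The drift, the input and the slope of `b` all carry the factor `ψ s`. The remaining terms are
  -- compared with `ψ s / ψ₀ ≥ 1`, so that `ψ s` factors out of the whole inequality.
  have h5 : c * (μ₀ * (1 + ζ)) + c * γ ≤ ψ s * (c * ((μ₀ * (1 + ζ) + γ) / ψ₀)) := by
    have hnn : 0 ≤ μ₀ * (1 + ζ) + γ := by positivity
    have : μ₀ * (1 + ζ) + γ ≤ ψ s * ((μ₀ * (1 + ζ) + γ) / ψ₀) := by
      rw [← mul_div_assoc, le_div_iff₀ hψ₀, mul_comm]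
      exact mul_le_mul_of_nonneg_right hps hnn
    nlinarith
  have h6 : c * ((μ₀ * (1 + ζ) + γ) / ψ₀) + c * K + c * M < alpha (c ^ 2) * inner ℝ v (Γ v) := by
    have hnn : 0 ≤ (μ₀ * (1 + ζ) + γ) / ψ₀ + K + M := by positivity
    have := mul_le_mul_of_nonneg_right hc1.le hnn
    linarith
  have h7 := mul_lt_mul_of_pos_left h6 hpos
  have h8 := mul_le_mul_of_nonneg_left h3 hpos.le
  linarith

end Barrier

/-! ## The phases in which the measurement is available -/

section Available

variable {m r : ℕ}

/-- The constants bounding the auxiliary errors below the top one. -/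
structure ErrorConsts (r : ℕ) (μ₀ : ℝ) (c μ : ℕ → ℝ) : Prop where
  mu0_nonneg : 0 ≤ μ₀
  c_zero : c 0 = 0
  mu_zero : μ 0 = μ₀
  mu_succ : ∀ k, μ (k + 1) = 1 + μ₀ * (1 + c k * alpha (c k ^ 2)) +
    alphaTilde (c k ^ 2) * (μ k + c k * alpha (c k ^ 2))
  c_pos : ∀ k, 1 ≤ k → k < r → 0 < c k
  c_lt_one : ∀ k < r, c k < 1
  dagger : ∀ k, k + 1 < r → alphaDagger (if k = 0 then 1 + μ₀ else μ (k + 1)) ≤ c (k + 1) ^ 2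

namespace ErrorConsts

variable {μ₀ : ℝ} {c μ : ℕ → ℝ}

theorem c_nonneg (h : ErrorConsts r μ₀ c μ) {k : ℕ} (hk : k < r) : 0 ≤ c k := by
  rcases Nat.eq_zero_or_pos k with h0 | h0
  · rw [h0, h.c_zero]
  · exact (h.c_pos k h0 hk).le

theorem gain_nonneg (h : ErrorConsts r μ₀ c μ) {k : ℕ} (hk : k < r) :
    0 ≤ c k * alpha (c k ^ 2) :=
  mul_nonneg (h.c_nonneg hk) (alpha_pos (sq_lt_one (h.c_nonneg hk) (h.c_lt_one k hk))).le

theorem mu_nonneg (h : ErrorConsts r μ₀ c μ) : ∀ k ≤ r, 0 ≤ μ k := by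
  intro k
  induction k with
  | zero => intro _; rw [h.mu_zero]; exact h.mu0_nonneg
  | succ k ih =>
    intro hk
    rw [h.mu_succ]
    have h1 := ih (by omega)
    have h2 := h.gain_nonneg (k := k) (by omega)
    have h3 := alphaTilde_nonneg (sq_nonneg (c k))
    have h4 := h.mu0_nonneg
    positivity

end ErrorConsts

theorem continuousAt_gain {v : Vec m} (hv : ‖v‖ < 1) : ContinuousAt gain v := by
  have h1 : (1 : ℝ) - ‖v‖ ^ 2 ≠ 0 := (sub_pos.2 (sq_lt_one (norm_nonneg _) hv)).ne'
  unfold gain alpha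
  fun_prop (disch := assumption)

theorem auxError_continuousOn {φ : ℝ → ℝ} {ε : ℝ → ℕ → Vec m} {S : Set ℝ} {n : ℕ}
    (hφ : ContinuousOn φ S) (hε : ∀ i < n, ContinuousOn (fun s => ε s i) S)
    (h : ∀ s ∈ S, ∀ i < n, ‖auxError (φ s) (ε s) i‖ < 1) :
    ∀ i ≤ n, ContinuousOn (fun s => auxError (φ s) (ε s) i) S := by
  intro i
  induction i with
  | zero => intro _; exact continuousOn_const
  | succ i ih =>
    intro hi
    simp only [auxError_succ]
    refine (hφ.smul (hε i hi)).add fun s hs => ?_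
    exact ContinuousAt.comp_continuousWithinAt (f := fun s => auxError (φ s) (ε s) i) (g := gain)
      (continuousAt_gain (h s hs i hi)) (ih (by omega) s hs)

/-- The bound for the `i`-th auxiliary error. -/
noncomputable def errorBd (r : ℕ) (c : ℕ → ℝ) (C : ℝ) (i : ℕ) : ℝ := if i < r then c i else C

theorem errorBd_of_lt {c : ℕ → ℝ} {C : ℝ} {i : ℕ} (h : i < r) : errorBd r c C i = c i := if_pos h

theorem errorBd_self {c : ℕ → ℝ} {C : ℝ} : errorBd r c C r = C := if_neg (lt_irrefl _)

/-- As long as all auxiliary errors lie in the open unit ball, they satisfy the bounds that they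
satisfy initially. -/
theorem auxError_le_errorBd (hr : 1 ≤ r) {μ₀ : ℝ} {c μ : ℕ → ℝ} (hc : ErrorConsts r μ₀ c μ)
    {X Y : ℕ → ℝ → Vec m} {ψ ψ' : ℝ → ℝ} {f : ℝ → Vec m} {Γ : Vec m → Vec m}
    {ψ₀ κ K M C t₁ t₂ : ℝ} (hψ₀ : 0 < ψ₀) (hM : 0 ≤ M) (hK : 0 ≤ K)
    (hψ0 : ∀ s ∈ Icc t₁ t₂, ψ₀ ≤ ψ s) (hψc : ContinuousOn ψ (Icc t₁ t₂))
    (hψ : ∀ s ∈ Ico t₁ t₂, HasDerivWithinAt ψ (ψ' s) (Ici s) s)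
    (hψ' : ∀ s ∈ Ico t₁ t₂, |ψ' s| ≤ μ₀ * ψ s)
    (hXc : ∀ i < r, ContinuousOn (X i) (Icc t₁ t₂))
    (hYc : ∀ i < r, ContinuousOn (Y i) (Icc t₁ t₂))
    (hX : ∀ i, i + 1 < r → ∀ s ∈ Ico t₁ t₂, HasDerivWithinAt (X i) (X (i + 1) s) (Ici s) s)
    (hY : ∀ i, i + 1 < r → ∀ s ∈ Ico t₁ t₂, HasDerivWithinAt (Y i) (Y (i + 1) s) (Ici s) s)
    (hb : ∀ s ∈ Icc t₁ t₂, ∀ z ∈ Icc t₁ t₂, ‖Y (r - 1) z - Y (r - 1) s‖ ≤ M * |z - s|)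
    (hΓ : ∀ v, κ * ‖v‖ ^ 2 ≤ inner ℝ v (Γ v))
    (hf : ∀ s ∈ Ico t₁ t₂, HasDerivWithinAt (X (r - 1))
      (f s - alpha (‖auxError (ψ s) (fun i => X i s - Y i s) r‖ ^ 2) •
        Γ (auxError (ψ s) (fun i => X i s - Y i s) r)) (Ici s) s)
    (hfK : ∀ s ∈ Ico t₁ t₂, (∀ i < r, ‖X i s - Y i s‖ ≤ (1 + c i * alpha (c i ^ 2)) / ψ₀) →
      ‖f s‖ ≤ K)
    (hC0 : 0 < C) (hC1 : C < 1) (hCK : μ r / ψ₀ + K + M < κ * (alpha (C ^ 2) * C ^ 2))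
    (hreg : ∀ s ∈ Icc t₁ t₂, ∀ i ≤ r, ‖auxError (ψ s) (fun i => X i s - Y i s) i‖ < 1)
    (h0 : ∀ i ≤ r, 1 ≤ i → ‖auxError (ψ t₁) (fun i => X i t₁ - Y i t₁) i‖ ≤ errorBd r c C i) :
    ∀ s ∈ Icc t₁ t₂, ∀ i ≤ r, 1 ≤ i →
      ‖auxError (ψ s) (fun i => X i s - Y i s) i‖ ≤ errorBd r c C i := by
  set e : ℕ → ℝ → Vec m := fun i s => auxError (ψ s) (fun i => X i s - Y i s) i with he
  have he_succ : ∀ i s, e (i + 1) s = ψ s • (X i s - Y i s) + gain (e i s) := fun i s => rfl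
  have hψpos : ∀ s ∈ Icc t₁ t₂, 0 < ψ s := fun s hs => hψ₀.trans_le (hψ0 s hs)
  have hec : ∀ i ≤ r, ContinuousOn (e i) (Icc t₁ t₂) :=
    auxError_continuousOn hψc (fun i hi => (hXc i hi).sub (hYc i hi))
      fun s hs i hi => hreg s hs i hi.le
  rcases (Icc t₁ t₂).eq_empty_or_nonempty with hemp | hne
  · intro s hs; rw [hemp] at hs; exact hs.elim
  have ht₁ : t₁ ∈ Icc t₁ t₂ := left_mem_Icc.2 (nonempty_Icc.1 hne)
  -- The induction runs upwards, because the equation for `e_{k+1}` contains the derivative of `gain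
  -- e_k`. The error above enters only through `hreg`, with the crude bound one.
  have hlow : ∀ k < r, (∀ s ∈ Icc t₁ t₂, ‖e k s‖ ≤ c k) ∧ ∃ g' : ℝ → Vec m, ∀ s ∈ Ico t₁ t₂,
      HasDerivWithinAt (fun s => gain (e k s)) (g' s) (Ici s) s ∧
      ‖g' s‖ ≤ if k = 0 then 0 else alphaTilde (c k ^ 2) * (μ k + c k * alpha (c k ^ 2)) := by
    intro k
    induction k with
    | zero =>
      intro _
      refine ⟨fun s _ => by simp [he, auxError_zero, hc.c_zero], fun _ => 0, fun s _ => ⟨?_, by simp⟩⟩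
      simp only [he, auxError_zero]
      exact hasDerivWithinAt_const _ _ _
    | succ k ih =>
      intro hk
      obtain ⟨hek, g', hg'⟩ := ih (by omega)
      have hck := hc.gain_nonneg (k := k) (by omega)
      have hμk := hc.mu_nonneg k (by omega)
      have hμ₀ := hc.mu0_nonneg
      have hαk := alphaTilde_nonneg (sq_nonneg (c k))
      -- For `e_1` there is no preceding gain, so the design uses `1 + μ₀`, which is at most `μ 1`;
      -- the derivative bound passed upwards still uses `μ 1`.
      have hN : 1 + μ₀ * (1 + c k * alpha (c k ^ 2)) + (if k = 0 then 0 else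
          alphaTilde (c k ^ 2) * (μ k + c k * alpha (c k ^ 2))) ≤
          if k = 0 then 1 + μ₀ else μ (k + 1) := by
        split_ifs with h0
        · subst h0; simp [hc.c_zero]
        · rw [hc.mu_succ]
      have hNμ : (if k = 0 then 1 + μ₀ else μ (k + 1)) ≤ μ (k + 1) := by
        split_ifs with h0
        · rw [hc.mu_succ]
          have : 0 ≤ alphaTilde (c k ^ 2) * (μ k + c k * alpha (c k ^ 2)) := by positivity
          nlinarith [mul_nonneg hμ₀ hck]
        · exact le_rfl
      have hN0 : 0 < if k = 0 then 1 + μ₀ else μ (k + 1) := by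
        split_ifs
        · linarith
        · rw [hc.mu_succ]; positivity
      have hck1 := hc.c_nonneg hk
      obtain ⟨hb1, hb2⟩ := lower_error_bound (x := fun s => X k s - Y k s)
        (x' := fun s => X (k + 1) s - Y (k + 1) s) (g := fun s => gain (e k s)) (g' := g')
        (c := c (k + 1)) hc.mu0_nonneg hψpos hψ hψ'
        (fun s hs => (hX k hk s hs).sub (hY k hk s hs)) (fun s hs => (hg' s hs).1)
        (fun s hs => norm_gain_le (hek s ⟨hs.1, hs.2.le⟩) (hc.c_lt_one k (by omega)))
        (fun s hs => (hg' s hs).2) (hec (k + 1) hk.le)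
        (fun s hs => (hreg s ⟨hs.1, hs.2.le⟩ (k + 2) hk).le)
        (fun s hs => (hreg s ⟨hs.1, hs.2.le⟩ (k + 1) hk.le).le) hN hN0 (hc.dagger k hk) hck1
        (hc.c_lt_one _ hk) (by
          have := h0 (k + 1) hk.le (by omega)
          rwa [errorBd_of_lt hk] at this)
      refine ⟨hb1, ?_⟩
      have hex : ∀ s, ∃ g' : Vec m, s ∈ Ico t₁ t₂ →
          HasDerivWithinAt (fun s => gain (e (k + 1) s)) g' (Ici s) s ∧
          ‖g'‖ ≤ alphaTilde (c (k + 1) ^ 2) * (μ (k + 1) + c (k + 1) * alpha (c (k + 1) ^ 2)) := by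
        intro s
        by_cases hs : s ∈ Ico t₁ t₂
        · obtain ⟨hd, hd'⟩ := hb2 s hs
          obtain ⟨G, hG, hG'⟩ := exists_hasDerivWithinAt_gain (v := e (k + 1)) hd
            (hb1 s ⟨hs.1, hs.2.le⟩) (hc.c_lt_one _ hk)
          refine ⟨G, fun _ => ⟨hG, hG'.trans (mul_le_mul_of_nonneg_left ?_
            (alphaTilde_nonneg (sq_nonneg _)))⟩⟩
          linarith
        · exact ⟨0, fun h => absurd h hs⟩
      choose G hG using hex
      exact ⟨G, fun s hs => by simpa using hG s hs⟩
  intro s hs i hi hi1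
  rcases hi.lt_or_eq with hlt | rfl
  · rw [errorBd_of_lt hlt]; exact (hlow i hlt).1 s hs
  obtain ⟨n, rfl⟩ : ∃ n, i = n + 1 := ⟨i - 1, by omega⟩
  rw [errorBd_self]
  have hn : n < n + 1 := Nat.lt_succ_self n
  obtain ⟨hen, g', hg'⟩ := hlow n hn
  have hcn := hc.gain_nonneg hn
  have hμn := hc.mu_nonneg n hn.le
  have hμ₀ := hc.mu0_nonneg
  have hαn := alphaTilde_nonneg (sq_nonneg (c n))
  refine top_error_bound (p := X n) (b := Y n) (f := f) (g := fun s => gain (e n s)) (g' := g')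
    (Γ := Γ) (ζ := c n * alpha (c n ^ 2)) (K := K) (M := M) (ψ₀ := ψ₀) (κ := κ)
    (γ := alphaTilde (c n ^ 2) * (μ n + c n * alpha (c n ^ 2))) hμ₀ hψ₀ hcn (by positivity)
    hψ0 hψ hψ' hΓ hf ?_ hb (fun s hs => (hg' s hs).1)
    (fun s hs => norm_gain_le (hen s ⟨hs.1, hs.2.le⟩) (hc.c_lt_one n hn))
    (fun s hs => (hg' s hs).2.trans ?_) (hec (n + 1) le_rfl) hM hK hC0 hC1 (lt_of_le_of_lt ?_ hCK)
    ?_ s hs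
  · intro s hs
    have hsI : s ∈ Icc t₁ t₂ := ⟨hs.1, hs.2.le⟩
    -- Two consecutive auxiliary errors determine `ψ • e^{(i)}`, and `ψ ≥ ψ₀` makes the resulting
    -- bound independent of time.
    refine hfK s hs fun i hi => ?_
    refine (norm_le_of_auxError (hψpos s hsI) (fun i => X i s - Y i s) (hreg s hsI (i + 1) hi).le
      ((hlow i hi).1 s hsI) (hc.c_lt_one i hi)).trans ?_
    have := hc.gain_nonneg hi
    exact div_le_div_of_nonneg_left (by positivity) hψ₀ (hψ0 s hsI)
  · split_ifs
    · positivity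
    · exact le_rfl
  · gcongr
    rw [hc.mu_succ]
    linarith
  · have := h0 (n + 1) le_rfl (by omega)
    rwa [errorBd_self] at this

end Available

/-! ## Trajectories -/

section Trajectory

variable {m r : ℕ}

/-- The constant bounding `∑ i, R_i y^{(i-1)}` while the measurement is available. -/
noncomputable def driftBound (R : Fin r → Matrix (Fin m) (Fin m) ℝ) (c : ℕ → ℝ) (KY ψ₀ : ℝ) : ℝ :=
  ∑ i : Fin r, matNorm (R i) * (KY + (1 + c i * alpha (c i ^ 2)) / ψ₀)

/-- The standing assumptions on the feedback, the reference derivatives `Y i` and the constants. -/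
structure Design (R : Fin r → Matrix (Fin m) (Fin m) ℝ) (Γ : Matrix (Fin m) (Fin m) ℝ)
    (Y : ℕ → ℝ → Vec m) (a φ₀ : ℝ → ℝ) (d : ℝ) (c μ : ℕ → ℝ) (C k M KY κ : ℝ) : Prop where
  one_le : 1 ≤ r
  avail : IsAvailability a
  funnel : φ₀ ∈ funnelFunctions
  growth : IsGrowthConst φ₀ d
  refCont : ∀ i < r, ContinuousOn (Y i) (Ici 0)
  refDeriv : ∀ i, i + 1 < r → ∀ t, 0 ≤ t → HasDerivWithinAt (Y i) (Y (i + 1) t) (Ici 0) t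
  refBound : ∀ i < r, ∀ t, 0 ≤ t → ‖Y i t‖ ≤ KY
  refLip : ∀ s t, 0 ≤ s → 0 ≤ t → ‖Y (r - 1) t - Y (r - 1) s‖ ≤ M * |t - s|
  M_nonneg : 0 ≤ M
  KY_nonneg : 0 ≤ KY
  consts : ErrorConsts r (muZero d φ₀) c μ
  gainPos : ∀ v : Vec m, κ * ‖v‖ ^ 2 ≤ inner ℝ v (Matrix.toEuclideanLin Γ v)
  C_pos : 0 < C
  C_lt_one : C < 1
  top : μ r / φ₀ 0 + driftBound R c KY (φ₀ 0) + M < κ * (alpha (C ^ 2) * C ^ 2)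
  k_lt_one : k < 1
  lt_k : ∀ i ≤ r, errorBd r c C i < k

/-- A curve with a chain of derivatives, the last of which is the integral of `f`, where `f` is
the right-hand side of the closed loop whenever all auxiliary errors are at most `k`. -/
structure IsTrajectory (R : Fin r → Matrix (Fin m) (Fin m) ℝ) (Γ : Matrix (Fin m) (Fin m) ℝ)
    (Y : ℕ → ℝ → Vec m) (a φ₀ : ℝ → ℝ) (k : ℝ) (ω : EReal) (X : ℕ → ℝ → Vec m)
    (f : ℝ → Vec m) : Prop where
  cont : ∀ i < r, ContinuousOn (X i) (timeDomain ω)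
  deriv : ∀ i, i + 1 < r → ∀ t ∈ timeDomain ω,
    HasDerivWithinAt (X i) (X (i + 1) t) (timeDomain ω) t
  integrable : ∀ t ∈ timeDomain ω, IntervalIntegrable f volume 0 t
  integral : ∀ t ∈ timeDomain ω, X (r - 1) t = X (r - 1) 0 + ∫ s in 0..t, f s
  rhs : ∀ t ∈ timeDomain ω,
    (∀ i ≤ r, ‖auxError (shiftedFunnel a φ₀ t) (fun i => X i t - Y i t) i‖ ≤ k) →
    f t = ∑ i : Fin r, Matrix.toEuclideanLin (R i) (X i t) + Matrix.toEuclideanLin Γ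
      (-(a t * alpha (‖auxError (shiftedFunnel a φ₀ t) (fun i => X i t - Y i t) r‖ ^ 2)) •
        auxError (shiftedFunnel a φ₀ t) (fun i => X i t - Y i t) r)

theorem norm_toEuclideanLin_le (A : Matrix (Fin m) (Fin m) ℝ) (v : Vec m) :
    ‖Matrix.toEuclideanLin A v‖ ≤ matNorm A * ‖v‖ :=
  Matrix.l2_opNorm_mulVec A v

open scoped Matrix.Norms.L2Operator in
theorem matNorm_nonneg (A : Matrix (Fin m) (Fin m) ℝ) : 0 ≤ matNorm A := norm_nonneg A

theorem continuous_toEuclideanLin (A : Matrix (Fin m) (Fin m) ℝ) :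
    Continuous (Matrix.toEuclideanLin A : Vec m → Vec m) :=
  LinearMap.continuous_of_finiteDimensional _

theorem continuousOn_linear_sum {R : Fin r → Matrix (Fin m) (Fin m) ℝ} {X : ℕ → ℝ → Vec m}
    {S : Set ℝ} (h : ∀ i < r, ContinuousOn (X i) S) :
    ContinuousOn (fun s => ∑ i : Fin r, Matrix.toEuclideanLin (R i) (X i s)) S :=
  continuousOn_finsetSum _ fun i _ => (continuous_toEuclideanLin _).comp_continuousOn (h i i.2)

/-- The right derivative of an integral whose integrand is continuous to the right. -/
theorem hasDerivWithinAt_of_integral {x f F : ℝ → Vec m} {x₀ : Vec m} {t₁ t₂ : ℝ}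
    (hfi : ∀ t ∈ Icc t₁ t₂, IntervalIntegrable f volume 0 t)
    (hx : ∀ t ∈ Icc t₁ t₂, x t = x₀ + ∫ s in 0..t, f s)
    (hF : ContinuousOn F (Icc t₁ t₂)) (hfF : EqOn f F (Ioc t₁ t₂)) :
    ∀ s ∈ Ico t₁ t₂, HasDerivWithinAt x (F s) (Ici s) s := by
  intro s hs
  have hsI : s ∈ Icc t₁ t₂ := ⟨hs.1, hs.2.le⟩
  have hmem : Icc s t₂ ∈ 𝓝[Ici s] s := Icc_mem_nhdsGE hs.2
  have hmem' : Icc t₁ t₂ ∈ 𝓝[Ici s] s := mem_of_superset hmem (Icc_subset_Icc_left hs.1)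
  have hd : HasDerivWithinAt (fun z => ∫ y in s..z, F y) (F s) (Ici s) s := by
    refine intervalIntegral.integral_hasDerivWithinAt_right (by simp) ⟨Icc t₁ t₂, ?_, ?_⟩ ?_
    · exact nhdsWithin_mono s Ioi_subset_Ici_self hmem'
    · exact hF.aestronglyMeasurable measurableSet_Icc
    · exact ((hF s hsI).mono_of_mem_nhdsWithin hmem').mono Ioi_subset_Ici_self
  have heq : ∀ z ∈ Icc s t₂, x z = x s + ∫ y in s..z, F y := by
    intro z hz
    have hzI : z ∈ Icc t₁ t₂ := ⟨hs.1.trans hz.1, hz.2⟩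
    have h1 : (∫ y in s..z, F y) = ∫ y in s..z, f y := by
      refine intervalIntegral.integral_congr_ae (Eventually.of_forall fun y hy => ?_)
      rw [uIoc_of_le hz.1] at hy
      exact (hfF ⟨hs.1.trans_lt hy.1, hy.2.trans hz.2⟩).symm
    rw [h1, hx z hzI, hx s hsI, ← intervalIntegral.integral_interval_sub_left (hfi z hzI)
      (hfi s hsI)]
    abel
  refine (hd.const_add (x s)).congr_of_eventuallyEq ?_ (heq s ⟨le_rfl, hs.2.le⟩)
  filter_upwards [hmem] with z hz using heq z hz

section

variable {R : Fin r → Matrix (Fin m) (Fin m) ℝ} {Γ : Matrix (Fin m) (Fin m) ℝ}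
  {Y : ℕ → ℝ → Vec m} {a φ₀ : ℝ → ℝ} {d : ℝ} {c μ : ℕ → ℝ} {C k M KY κ : ℝ}

namespace Design

theorem funnel_pos (D : Design R Γ Y a φ₀ d c μ C k M KY κ) {t : ℝ} (ht : 0 ≤ t) : 0 < φ₀ t :=
  (D.funnel.2.1 t t ht le_rfl).1

theorem funnel_mono (D : Design R Γ Y a φ₀ d c μ C k M KY κ) {s t : ℝ} (hs : 0 ≤ s)
    (hst : s ≤ t) : φ₀ s ≤ φ₀ t := (D.funnel.2.1 s t hs hst).2

/-- Since `φ₀` stays above its initial value, `(1 + φ₀) / φ₀` is at most its value at `0`. Thus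
`muZero` bounds the logarithmic derivative of the funnel function. -/
theorem funnel_deriv_le (D : Design R Γ Y a φ₀ d c μ C k M KY κ) {t : ℝ} (ht : 0 ≤ t) :
    |derivWithin φ₀ (Ici 0) t| ≤ muZero d φ₀ * φ₀ t := by
  refine (D.growth.2 t ht).trans ?_
  have h0 := D.funnel_pos le_rfl
  have h1 := D.funnel_mono le_rfl ht
  have h2 := D.growth.1
  rw [muZero, div_mul_eq_mul_div, le_div_iff₀ h0]
  nlinarith

theorem funnel_cont (D : Design R Γ Y a φ₀ d c μ C k M KY κ) : ContinuousOn φ₀ (Ici 0) :=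
  D.funnel.1.continuousOn

theorem shift_hasDerivWithinAt (D : Design R Γ Y a φ₀ d c μ C k M KY κ) {τ t : ℝ} (ht : τ ≤ t) :
    HasDerivWithinAt (fun s => φ₀ (s - τ)) (derivWithin φ₀ (Ici 0) (t - τ)) (Ici t) t := by
  have h1 : HasDerivWithinAt φ₀ (derivWithin φ₀ (Ici 0) (t - τ)) (Ici 0) (t - τ) :=
    ((D.funnel.1.differentiableOn (by simp)) (t - τ) (sub_nonneg.2 ht)).hasDerivWithinAt
  have h2 := h1.scomp t (h := fun s => s - τ) (s := Ici t)
    ((hasDerivWithinAt_id t _).sub_const τ) fun s hs => sub_nonneg.2 (ht.trans hs)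
  exact h2.congr_deriv (by simp)

theorem shift_continuousOn (D : Design R Γ Y a φ₀ d c μ C k M KY κ) (τ : ℝ) :
    ContinuousOn (fun s => φ₀ (s - τ)) (Ici τ) :=
  D.funnel_cont.comp (by fun_prop) fun _ hs => mem_Ici.2 (sub_nonneg.2 hs)

theorem driftBound_nonneg (D : Design R Γ Y a φ₀ d c μ C k M KY κ) :
    0 ≤ driftBound R c KY (φ₀ 0) := by
  refine Finset.sum_nonneg fun i _ => mul_nonneg (matNorm_nonneg _) ?_
  have h1 := D.consts.gain_nonneg i.2
  have h2 := D.funnel_pos le_rfl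
  have h3 := D.KY_nonneg
  positivity

theorem errorBd_lt_one (D : Design R Γ Y a φ₀ d c μ C k M KY κ) {i : ℕ} (hi : i ≤ r) :
    errorBd r c C i < 1 := (D.lt_k i hi).trans D.k_lt_one

theorem k_pos (D : Design R Γ Y a φ₀ d c μ C k M KY κ) : 0 < k := by
  have := D.lt_k r le_rfl
  rw [errorBd_self] at this
  exact D.C_pos.trans this

end Design

/-- While the measurement is available, the auxiliary errors keep the bounds that they satisfy when
the measurement becomes available. -/
theorem IsTrajectory.available_bound (D : Design R Γ Y a φ₀ d c μ C k M KY κ) {ω : EReal}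
    {X : ℕ → ℝ → Vec m} {f : ℝ → Vec m} (hX : IsTrajectory R Γ Y a φ₀ k ω X f) {τ T : ℝ}
    (hτ : 0 ≤ τ) (hT : T ∈ timeDomain ω) (hτ0 : τ = 0 ∨ a τ = 0)
    (hav : ∀ s ∈ Ioc τ T, a s = 1)
    (hstart : ∀ i ≤ r, 1 ≤ i → ‖auxError (φ₀ 0) (fun i => X i τ - Y i τ) i‖ ≤ errorBd r c C i) :
    ∀ t ∈ Icc τ T, ∀ i ≤ r, 1 ≤ i →
      ‖auxError (φ₀ (t - τ)) (fun i => X i t - Y i t) i‖ ≤ errorBd r c C i := by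
  have hr := D.one_le
  have hsub : Icc τ T ⊆ timeDomain ω := fun s hs => Icc_subset_timeDomain hT ⟨hτ.trans hs.1, hs.2⟩
  have hXc : ∀ i < r, ContinuousOn (X i) (Icc τ T) := fun i hi => (hX.cont i hi).mono hsub
  have hYc : ∀ i < r, ContinuousOn (Y i) (Icc τ T) := fun i hi =>
    (D.refCont i hi).mono fun s hs => hτ.trans hs.1
  have hψc : ContinuousOn (fun s => φ₀ (s - τ)) (Icc τ T) :=
    (D.shift_continuousOn τ).mono Icc_subset_Ici_self
  have hk0 := D.k_pos.le
  -- The frozen errors are continuous on the whole interval, whereas the original ones could cross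
  -- the singularity of `α`; continuation is therefore run on the frozen ones. The weight `φ₀ (s -
  -- τ)` is used at `s = τ` too, although `shiftedFunnel` is zero there after a loss.
  set e : ℕ → ℝ → Vec m := fun i s => cutError k (φ₀ (s - τ)) (fun i => X i s - Y i s) i with he
  have hec : ∀ i ≤ r, ContinuousOn (e i) (Icc τ T) := fun i hi s hs =>
    cutError_continuousWithinAt hk0 D.k_lt_one (hψc s hs)
      (fun j hj => (hXc j hj s hs).sub (hYc j hj s hs)) i hi
  have hcut : ∀ s, (∀ i ≤ r, 1 ≤ i → ‖e i s‖ ≤ k) → ∀ i ≤ r,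
      e i s = auxError (φ₀ (s - τ)) (fun i => X i s - Y i s) i := by
    intro s hs i hi
    refine cutError_eq_of_cutError_le (n := r) (fun j hj => ?_) i hi
    rcases Nat.eq_zero_or_pos j with rfl | h
    · simpa [cutError] using hk0
    · exact hs j hj.le h
  have haux : ∀ s, (∀ i ≤ r, 1 ≤ i →
      ‖auxError (φ₀ (s - τ)) (fun i => X i s - Y i s) i‖ ≤ errorBd r c C i) → ∀ i ≤ r,
      e i s = auxError (φ₀ (s - τ)) (fun i => X i s - Y i s) i := by
    intro s hs i hi
    refine cutError_eq_of_auxError_le (n := r) (fun j hj => ?_) i hi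
    rcases Nat.eq_zero_or_pos j with rfl | h
    · simpa [auxError] using hk0
    · exact (hs j hj.le h).trans (D.lt_k j hj.le).le
  have key : Icc τ T ⊆ {t | ∀ i ≤ r, 1 ≤ i → ‖e i t‖ ≤ errorBd r c C i} := by
    rcases lt_or_ge T τ with hTτ | hτT
    · rw [Icc_eq_empty (not_le.2 hTτ)]; exact empty_subset _
    refine IsClosed.Icc_subset_of_forall_exists_gt ?_ ?_ ?_
    · have : {t | ∀ i ≤ r, 1 ≤ i → ‖e i t‖ ≤ errorBd r c C i} ∩ Icc τ T =
          Icc τ T ∩ ⋂ (i : ℕ) (_ : i ≤ r) (_ : 1 ≤ i),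
            (Icc τ T ∩ (fun t => ‖e i t‖) ⁻¹' Iic (errorBd r c C i)) := by
        ext t
        simp only [mem_inter_iff, mem_ofPred_eq, mem_iInter, mem_preimage, mem_Iic]
        constructor
        · rintro ⟨h1, h2⟩; exact ⟨h2, fun i hi hi1 => ⟨h2, h1 i hi hi1⟩⟩
        · rintro ⟨h1, h2⟩; exact ⟨fun i hi hi1 => (h2 i hi hi1).2, h1⟩
      rw [this]
      refine isClosed_Icc.inter (isClosed_iInter fun i => isClosed_iInter fun hi =>
        isClosed_iInter fun _ => ?_)
      exact (hec i hi).norm.preimage_isClosed_of_isClosed isClosed_Icc isClosed_Iic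
    · intro i hi hi1
      have h1 := haux τ (by simpa using hstart) i hi
      rw [h1]
      simpa using hstart i hi hi1
    · rintro t ⟨htS, htI⟩ y hy
      -- The gap between `errorBd` and `k` keeps the errors below `k` for a short time. On that
      -- interval frozen and original errors agree and `f` is the true right-hand side, so
      -- `auxError_le_errorBd` restores the sharper bounds.
      have hev : ∀ᶠ s in 𝓝[≥] t, ∀ i ∈ Finset.Icc 1 r, ‖e i s‖ < k := by
        rw [Finset.eventually_all]
        intro i hi
        rw [Finset.mem_Icc] at hi
        have hcw : ContinuousWithinAt (fun s => ‖e i s‖) (Ici t) t := by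
          refine ((hec i hi.2).norm t ⟨htI.1, htI.2.le⟩).mono_of_mem_nhdsWithin ?_
          exact mem_of_superset (Icc_mem_nhdsGE htI.2) (Icc_subset_Icc_left htI.1)
        exact hcw.eventually (gt_mem_nhds ((htS i hi.2 hi.1).trans_lt (D.lt_k i hi.2)))
      obtain ⟨u, hu, huS⟩ := mem_nhdsGE_iff_exists_Icc_subset.1 hev
      set t' := min u (min y T) with ht'
      have htt' : t < t' := lt_min hu (lt_min hy htI.2)
      have ht'u : t' ≤ u := min_le_left _ _
      have ht'y : t' ≤ y := (min_le_right _ _).trans (min_le_left _ _)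
      have ht'T : t' ≤ T := (min_le_right _ _).trans (min_le_right _ _)
      have hsubt : Icc t t' ⊆ Icc τ T := Icc_subset_Icc htI.1 ht'T
      have hlt : ∀ s ∈ Icc t t', ∀ i ≤ r, 1 ≤ i → ‖e i s‖ < k := fun s hs i hi hi1 =>
        huS ⟨hs.1, hs.2.trans ht'u⟩ i (Finset.mem_Icc.2 ⟨hi1, hi⟩)
      have heq : ∀ s ∈ Icc t t', ∀ i ≤ r,
          e i s = auxError (φ₀ (s - τ)) (fun i => X i s - Y i s) i := fun s hs =>
        hcut s fun i hi hi1 => (hlt s hs i hi hi1).le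
      have hle : ∀ s ∈ Icc t t', ∀ i ≤ r,
          ‖auxError (φ₀ (s - τ)) (fun i => X i s - Y i s) i‖ < k := by
        intro s hs i hi
        rcases Nat.eq_zero_or_pos i with rfl | h
        · simpa [auxError] using D.k_pos
        · rw [← heq s hs i hi]; exact hlt s hs i hi h
      have hec' := auxError_continuousOn (n := r) (hψc.mono hsubt)
        (fun i hi => ((hXc i hi).sub (hYc i hi)).mono hsubt)
        (fun s hs i hi => (hle s hs i hi.le).trans D.k_lt_one) r le_rfl
      -- The integrand is replaced by a function continuous up to the left end. At `t = τ` the two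
      -- may differ, because the measurement may still be missing at that instant; agreement on the
      -- half-open interval is enough.
      have hder := hasDerivWithinAt_of_integral (x := X (r - 1)) (f := f) (t₁ := t) (t₂ := t')
        (F := fun s => ∑ i : Fin r, Matrix.toEuclideanLin (R i) (X i s) -
          alpha (‖auxError (φ₀ (s - τ)) (fun i => X i s - Y i s) r‖ ^ 2) •
            Matrix.toEuclideanLin Γ (auxError (φ₀ (s - τ)) (fun i => X i s - Y i s) r))
        (fun s hs => hX.integrable s (hsub (hsubt hs)))
        (fun s hs => hX.integral s (hsub (hsubt hs)))
        (by
          refine (continuousOn_linear_sum fun i hi => (hXc i hi).mono hsubt).sub ?_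
          have h1 : ContinuousOn (fun s => gain (auxError (φ₀ (s - τ))
              (fun i => X i s - Y i s) r)) (Icc t t') := fun s hs =>
            ContinuousAt.comp_continuousWithinAt
              (f := fun s => auxError (φ₀ (s - τ)) (fun i => X i s - Y i s) r) (g := gain)
              (continuousAt_gain ((hle s hs r le_rfl).trans D.k_lt_one)) (hec' s hs)
          refine ((continuous_toEuclideanLin Γ).comp_continuousOn h1).congr fun s _ => ?_
          simp [gain])
        (by
          intro s hs
          have hsI : s ∈ Icc t t' := ⟨hs.1.le, hs.2⟩
          have hτs : τ < s := htI.1.trans_lt hs.1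
          have hsT : s ≤ T := hs.2.trans ht'T
          have hφs : shiftedFunnel a φ₀ s = φ₀ (s - τ) :=
            shiftedFunnel_of_available hτ hτs.le hτ0
              (fun x hx => hav x ⟨hx.1, hx.2.trans hsT⟩) (hav s ⟨hτs, hsT⟩)
          have := hX.rhs s (hsub (hsubt hsI)) (by
            rw [hφs]; exact fun i hi => (hle s hsI i hi).le)
          rw [this, hφs, hav s ⟨hτs, hsT⟩, one_mul, neg_smul, map_neg, map_smul]
          exact (sub_eq_add_neg _ _).symm)
      have hIci : ∀ s ∈ Ico t t', timeDomain ω ∈ 𝓝[≥] s := fun s hs =>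
        timeDomain_mem_nhdsGE (hsub (hsubt ⟨hs.1, hs.2.le⟩))
      have hs0 : ∀ s ∈ Icc t t', 0 ≤ s := fun s hs => hτ.trans (htI.1.trans hs.1)
      have hsτ : ∀ s ∈ Icc t t', 0 ≤ s - τ := fun s hs => sub_nonneg.2 (htI.1.trans hs.1)
      have hres := auxError_le_errorBd hr D.consts (X := X) (Y := Y)
        (ψ := fun s => φ₀ (s - τ)) (ψ' := fun s => derivWithin φ₀ (Ici 0) (s - τ))
        (f := fun s => ∑ i : Fin r, Matrix.toEuclideanLin (R i) (X i s))
        (Γ := Matrix.toEuclideanLin Γ) (t₁ := t) (t₂ := t') (D.funnel_pos le_rfl) D.M_nonneg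
        D.driftBound_nonneg
        (fun s hs => D.funnel_mono le_rfl (hsτ s hs)) (hψc.mono hsubt)
        (fun s hs => D.shift_hasDerivWithinAt (htI.1.trans hs.1))
        (fun s hs => D.funnel_deriv_le (hsτ s ⟨hs.1, hs.2.le⟩))
        (fun i hi => (hXc i hi).mono hsubt) (fun i hi => (hYc i hi).mono hsubt)
        (fun i hi s hs => (hX.deriv i hi s (hsub (hsubt ⟨hs.1, hs.2.le⟩))).mono_of_mem_nhdsWithin
          (hIci s hs))
        (fun i hi s hs => (D.refDeriv i hi s (hs0 s ⟨hs.1, hs.2.le⟩)).mono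
          (Ici_subset_Ici.2 (hs0 s ⟨hs.1, hs.2.le⟩)))
        (fun s hs z hz => D.refLip s z (hs0 s hs) (hs0 z hz)) D.gainPos hder
        (by
          intro s hs hε
          refine (norm_sum_le _ _).trans (Finset.sum_le_sum fun i _ => ?_)
          refine (norm_toEuclideanLin_le _ _).trans
            (mul_le_mul_of_nonneg_left ?_ (matNorm_nonneg _))
          have h1 := hε i i.2
          have h2 := D.refBound i i.2 s (hs0 s ⟨hs.1, hs.2.le⟩)
          calc ‖X i s‖ = ‖Y i s + (X i s - Y i s)‖ := by rw [add_sub_cancel]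
            _ ≤ _ := (norm_add_le _ _).trans (add_le_add h2 h1))
        D.C_pos D.C_lt_one D.top
        (fun s hs i hi => (hle s hs i hi).trans D.k_lt_one)
        (fun i hi hi1 => by
          have := htS i hi hi1
          rwa [heq t ⟨le_rfl, htt'.le⟩ i hi] at this)
      have ht'I : t' ∈ Icc t t' := ⟨htt'.le, le_rfl⟩
      refine ⟨t', fun i hi hi1 => ?_, htt', ht'y⟩
      rw [heq t' ht'I i hi]
      exact hres t' ht'I i hi hi1
  intro t ht i hi hi1
  have h1 := key ht
  rw [← hcut t (fun j hj hj1 => (h1 j hj hj1).trans (D.lt_k j hj).le) i hi]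
  exact h1 i hi hi1

end

end Trajectory

/-! ## The phases in which the measurement is lost -/

section Loss

variable {m r : ℕ}

/-- The vector `(x_0, …, x_{r-1})` in Euclidean `ℝ^{rm}`. -/
noncomputable def stack (r : ℕ) (x : ℕ → Vec m) : PiLp 2 (fun _ : Fin r => Vec m) :=
  WithLp.toLp 2 (fun i : Fin r => x i)

theorem norm_stack_sq (x : ℕ → Vec m) : ‖stack r x‖ ^ 2 = ∑ i ∈ Finset.range r, ‖x i‖ ^ 2 := by
  rw [PiLp.norm_sq_eq_of_L2, Finset.sum_range]; rfl

theorem norm_le_norm_stack (x : ℕ → Vec m) {i : ℕ} (hi : i < r) : ‖x i‖ ≤ ‖stack r x‖ :=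
  PiLp.norm_apply_le (stack r x) ⟨i, hi⟩

theorem norm_stack_le_sum (x : ℕ → Vec m) : ‖stack r x‖ ≤ ∑ i ∈ Finset.range r, ‖x i‖ := by
  refine le_of_sq_le_sq ?_ (Finset.sum_nonneg fun _ _ => norm_nonneg _)
  rw [norm_stack_sq]
  exact Finset.sum_sq_le_sq_sum_of_nonneg fun _ _ => norm_nonneg _

theorem stack_sub (x y : ℕ → Vec m) : stack r (fun i => x i - y i) = stack r x - stack r y := rfl

/-- The growth of the companion form of a chain of integrators with a linear feedback. -/
theorem norm_companion_le (hr : 1 ≤ r) (x : ℕ → Vec m) (v : Vec m) {ρ : ℝ} (hρ : 0 ≤ ρ)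
    (hv : ‖v‖ ≤ ρ * ‖stack r x‖) :
    ‖stack r (fun i => if i + 1 < r then x (i + 1) else v)‖ ≤ (1 + ρ) * ‖stack r x‖ := by
  obtain ⟨n, rfl⟩ : ∃ n, r = n + 1 := ⟨r - 1, by omega⟩
  refine le_of_sq_le_sq ?_ (by positivity)
  have h1 : ‖v‖ ^ 2 ≤ ρ ^ 2 * ‖stack (n + 1) x‖ ^ 2 := by
    rw [← mul_pow]; exact pow_le_pow_left₀ (norm_nonneg _) hv 2
  have h2 : ∑ i ∈ Finset.range n, ‖x (i + 1)‖ ^ 2 ≤ ‖stack (n + 1) x‖ ^ 2 := by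
    rw [norm_stack_sq, Finset.sum_range_succ']
    exact le_add_of_nonneg_right (sq_nonneg _)
  have h3 : ∑ i ∈ Finset.range n, ‖if i + 1 < n + 1 then x (i + 1) else v‖ ^ 2 =
      ∑ i ∈ Finset.range n, ‖x (i + 1)‖ ^ 2 := by
    refine Finset.sum_congr rfl fun i hi => ?_
    rw [if_pos (by have := Finset.mem_range.1 hi; omega)]
  rw [norm_stack_sq, Finset.sum_range_succ, h3, if_neg (lt_irrefl _), mul_pow]
  -- What remains is `1 + ρ² ≤ (1 + ρ)²`, times the squared norm of the state.
  nlinarith [mul_nonneg hρ (sq_nonneg ‖stack (n + 1) x‖)]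

instance continuousSMul_stack : ContinuousSMul ℝ (PiLp 2 (fun _ : Fin r => Vec m)) :=
  NormedSpace.toIsBoundedSMul.continuousSMul

theorem stack_hasDerivWithinAt {x : ℝ → ℕ → Vec m} {x' : ℕ → Vec m} {S : Set ℝ} {t : ℝ}
    (h : ∀ i < r, HasDerivWithinAt (fun s => x s i) (x' i) S t) :
    HasDerivWithinAt (fun s => stack r (x s)) (stack r x') S t := by
  have h1 : HasDerivWithinAt (fun s => fun i : Fin r => x s i) (fun i : Fin r => x' i) S t := by
    rw [hasDerivWithinAt_pi]
    exact fun i => h i i.2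
  exact (PiLp.hasFDerivAt_toLp (𝕜 := ℝ) 2 _).comp_hasDerivWithinAt t h1

theorem stack_continuousOn {x : ℝ → ℕ → Vec m} {S : Set ℝ}
    (h : ∀ i < r, ContinuousOn (fun s => x s i) S) : ContinuousOn (fun s => stack r (x s)) S :=
  (PiLp.continuous_toLp 2 _).comp_continuousOn (continuousOn_pi.2 fun i => h i i.2)

theorem norm_linear_sum_le (R : Fin r → Matrix (Fin m) (Fin m) ℝ) (x : ℕ → Vec m) :
    ‖∑ i : Fin r, Matrix.toEuclideanLin (R i) (x i)‖ ≤ (∑ i, matNorm (R i)) * ‖stack r x‖ := by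
  rw [Finset.sum_mul]
  refine (norm_sum_le _ _).trans (Finset.sum_le_sum fun i _ => ?_)
  exact (norm_toEuclideanLin_le _ _).trans
    (mul_le_mul_of_nonneg_left (norm_le_norm_stack x i.2) (matNorm_nonneg _))

/-- Small errors at the end of a loss give small auxiliary errors. -/
theorem norm_auxError_le_of_small {φ E q : ℝ} {ε : ℕ → Vec m} (hφ : 0 ≤ φ) (hE : 0 ≤ E)
    (hq0 : 0 ≤ q) (hq1 : q < 1) (hε : ∀ i < r, ‖ε i‖ ≤ E) (h : φ * E * designA r q ≤ q) :
    ∀ i ≤ r, ‖auxError φ ε i‖ ≤ q := by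
  have hα : 0 ≤ alpha (q ^ 2) := (alpha_pos (sq_lt_one hq0 hq1)).le
  -- The error bounds obey `b ↦ φ E + α(q²) b` as long as the previous error is at most `q`; the
  -- partial geometric sums stay below `designA`, which keeps this hypothesis alive.
  have hgeom : ∀ i ≤ r, φ * E * ∑ j ∈ Finset.range i, alpha (q ^ 2) ^ j ≤ q := by
    intro i hi
    refine le_trans (mul_le_mul_of_nonneg_left ?_ (mul_nonneg hφ hE)) h
    exact Finset.sum_le_sum_of_subset_of_nonneg (Finset.range_subset_range.2 (by omega))
      fun _ _ _ => pow_nonneg hα _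
  have hind : ∀ i ≤ r, ‖auxError φ ε i‖ ≤ φ * E * ∑ j ∈ Finset.range i, alpha (q ^ 2) ^ j := by
    intro i
    induction i with
    | zero => intro _; simp [auxError_zero]
    | succ i ih =>
      intro hi
      have h1 := ih (by omega)
      have h2 : ‖auxError φ ε i‖ ≤ q := h1.trans (hgeom i (by omega))
      rw [auxError_succ, Finset.sum_range_succ', pow_zero]
      refine (norm_add_le _ _).trans ?_
      have h3 : ‖gain (auxError φ ε i)‖ ≤ ‖auxError φ ε i‖ * alpha (q ^ 2) := by
        rw [norm_gain (h2.trans_lt hq1)]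
        refine mul_le_mul_of_nonneg_left (alpha_mono ?_ (sq_lt_one hq0 hq1)) (norm_nonneg _)
        exact pow_le_pow_left₀ (norm_nonneg _) h2 2
      have h4 : ‖φ • ε i‖ ≤ φ * E := by
        rw [norm_smul, Real.norm_of_nonneg hφ]
        exact mul_le_mul_of_nonneg_left (hε i (by omega)) hφ
      have h5 := mul_le_mul_of_nonneg_right h1 hα
      have h6 : ∑ j ∈ Finset.range i, alpha (q ^ 2) ^ (j + 1) =
          (∑ j ∈ Finset.range i, alpha (q ^ 2) ^ j) * alpha (q ^ 2) := by
        rw [Finset.sum_mul]; simp only [pow_succ]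
      rw [h6]
      nlinarith
  exact fun i hi => (hind i hi).trans (hgeom i hi)

section

variable {R : Fin r → Matrix (Fin m) (Fin m) ℝ} {Γ : Matrix (Fin m) (Fin m) ℝ}
  {Y : ℕ → ℝ → Vec m} {a φ₀ : ℝ → ℝ} {d : ℝ} {c μ : ℕ → ℝ} {C k M KY κ : ℝ}

/-- Exponential growth of the state during a loss. -/
theorem IsTrajectory.loss_growth (D : Design R Γ Y a φ₀ d c μ C k M KY κ) {ω : EReal}
    {X : ℕ → ℝ → Vec m} {f : ℝ → Vec m} (hX : IsTrajectory R Γ Y a φ₀ k ω X f) {σ T β : ℝ}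
    (hσ : 0 ≤ σ) (hσT : σ ≤ T) (hT : T ∈ timeDomain ω) (hav : ∀ s ∈ Ioc σ T, a s = 0)
    (hβ : ∑ i, matNorm (R i) ≤ β - 1) :
    ‖stack r (fun i => X i T)‖ ≤ ‖stack r (fun i => X i σ)‖ * Real.exp (β * (T - σ)) := by
  have hr := D.one_le
  have hsub : Icc σ T ⊆ timeDomain ω := fun s hs => Icc_subset_timeDomain hT ⟨hσ.trans hs.1, hs.2⟩
  have hXc : ∀ i < r, ContinuousOn (X i) (Icc σ T) := fun i hi => (hX.cont i hi).mono hsub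
  have hder := hasDerivWithinAt_of_integral (x := X (r - 1)) (f := f) (t₁ := σ) (t₂ := T)
    (F := fun s => ∑ i : Fin r, Matrix.toEuclideanLin (R i) (X i s))
    (fun s hs => hX.integrable s (hsub hs)) (fun s hs => hX.integral s (hsub hs))
    (continuousOn_linear_sum hXc) (by
      intro s hs
      have has := hav s hs
      have := hX.rhs s (hsub ⟨hs.1.le, hs.2⟩) (by
        intro i _
        rw [shiftedFunnel_of_loss has, auxError_zero_left, norm_zero]
        exact D.k_pos.le)
      rw [this, has]
      simp)
  have hρ : 0 ≤ ∑ i, matNorm (R i) := Finset.sum_nonneg fun i _ => matNorm_nonneg _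
  -- With vanishing input the companion system is linear, with growth rate at most `1 + ∑ ‖R_i‖ ≤
  -- β`.
  have hg := norm_le_gronwallBound_of_norm_deriv_right_le (f := fun s => stack r (fun i => X i s))
    (f' := fun s => stack r (fun i => if i + 1 < r then X (i + 1) s else
      ∑ i : Fin r, Matrix.toEuclideanLin (R i) (X i s))) (a := σ) (b := T)
    (δ := ‖stack r (fun i => X i σ)‖) (K := β) (ε := 0)
    (stack_continuousOn hXc) (by
      intro s hs
      refine stack_hasDerivWithinAt fun i hi => ?_
      split_ifs with h
      · exact (hX.deriv i h s (hsub ⟨hs.1, hs.2.le⟩)).mono_of_mem_nhdsWithin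
          (timeDomain_mem_nhdsGE (hsub ⟨hs.1, hs.2.le⟩))
      · have : i = r - 1 := by omega
        rw [this]; exact hder s hs) le_rfl (by
      intro s _
      rw [add_zero]
      refine (norm_companion_le hr (fun i => X i s) _ hρ (norm_linear_sum_le R _)).trans ?_
      exact mul_le_mul_of_nonneg_right (by linarith) (norm_nonneg _)) T ⟨hσT, le_rfl⟩
  rwa [gronwallBound_ε0] at hg

/-- The a priori bounds along every trajectory. -/
theorem IsTrajectory.bounds (D : Design R Γ Y a φ₀ d c μ C k M KY κ) {ω : EReal}
    {X : ℕ → ℝ → Vec m} {f : ℝ → Vec m} (hX : IsTrajectory R Γ Y a φ₀ k ω X f)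
    {Δ δ β q E xr : ℝ} (hδ : 0 < δ) (hloss : LossAtMost a Δ)
    (havail : AvailableAtLeast a δ) (hβ : ∑ i, matNorm (R i) ≤ β - 1)
    (hxr : ∀ t, 0 ≤ t → ‖stack r (fun i => Y i t)‖ ≤ xr)
    (hE : xr * (1 + Real.exp (β * Δ)) + Real.exp (β * Δ) ≤ E)
    (hchi : ∑ i ∈ Finset.Icc 1 (r - 1), (c i + c (i - 1) * alpha (c (i - 1) ^ 2)) +
      (1 + c (r - 1) * alpha (c (r - 1) ^ 2)) ≤ φ₀ δ)
    (hq0 : 0 ≤ q) (hq1 : q < 1) (hqE : φ₀ 0 * E * designA r q ≤ q)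
    (hqc : ∀ i ≤ r, 1 ≤ i → q ≤ errorBd r c C i)
    (hinit : ∀ i ≤ r, 1 ≤ i → ‖auxError (φ₀ 0) (fun i => X i 0 - Y i 0) i‖ ≤ errorBd r c C i) :
    ∀ t ∈ timeDomain ω,
      (a t = 1 → ∀ i ≤ r, 1 ≤ i →
        ‖auxError (shiftedFunnel a φ₀ t) (fun i => X i t - Y i t) i‖ ≤ errorBd r c C i) ∧
      (a t = 0 → ‖stack r (fun i => X i t - Y i t)‖ ≤ E) := by
  have hr := D.one_le
  have hxr0 : 0 ≤ xr := (norm_nonneg _).trans (hxr 0 le_rfl)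
  have hE0 : 0 ≤ E := le_trans (by positivity) hE
  have hβ0 : 0 ≤ β := by
    have : 0 ≤ ∑ i, matNorm (R i) := Finset.sum_nonneg fun i _ => matNorm_nonneg _
    linarith
  -- The estimate at a lost time needs the bounds only at the start of the preceding available
  -- phase, which lies at least `δ` earlier. This gap is what drives the induction below.
  have hgoodloss : ∀ t ∈ timeDomain ω, a t = 0 → (∀ τ, 0 ≤ τ → τ + δ ≤ t → (τ = 0 ∨ a τ = 0) →
      ∀ i ≤ r, 1 ≤ i → ‖auxError (φ₀ 0) (fun i => X i τ - Y i τ) i‖ ≤ errorBd r c C i) →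
      ‖stack r (fun i => X i t - Y i t)‖ ≤ E := by
    intro t ht hat hgood
    obtain ⟨τ, σ, hτ, hτσ, hσt, htσ, hτ0, hav, hl⟩ :=
      D.avail.exists_loss_interval hδ hloss havail ht.1 hat
    have hσ : 0 ≤ σ := by linarith
    have hτσ' : τ ≤ σ := by linarith
    have hσD : σ ∈ timeDomain ω := Icc_subset_timeDomain ht ⟨hσ, hσt.le⟩
    have hb := hX.available_bound D hτ hσD hτ0 hav (hgood τ hτ (by linarith) hτ0) σ
      ⟨hτσ', le_rfl⟩
    have hpos : 0 < φ₀ (σ - τ) := D.funnel_pos (by linarith)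
    -- The Euclidean norm is dominated by the sum of the norms, and this by `χ / φ₀ (σ - τ)` with `σ
    -- - τ ≥ δ`. The top error contributes `1` to `χ`, so `C` does not appear.
    have hsum : ‖stack r (fun i => X i σ - Y i σ)‖ ≤ 1 := by
      refine (norm_stack_le_sum _).trans ?_
      have h1 : ∀ i ∈ Finset.range r, ‖X i σ - Y i σ‖ ≤
          ((if i + 1 < r then c (i + 1) else 1) + c i * alpha (c i ^ 2)) / φ₀ (σ - τ) := by
        intro i hi
        have hi := Finset.mem_range.1 hi
        refine norm_le_of_auxError hpos (fun i => X i σ - Y i σ) ?_ ?_ (D.consts.c_lt_one i hi)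
        · have := hb (i + 1) hi (by omega)
          split_ifs with h
          · rwa [errorBd_of_lt h] at this
          · exact this.trans (D.errorBd_lt_one hi).le
        · rcases Nat.eq_zero_or_pos i with rfl | h
          · rw [auxError_zero, norm_zero, D.consts.c_zero]
          · have := hb i hi.le h
            rwa [errorBd_of_lt hi] at this
      refine (Finset.sum_le_sum h1).trans ?_
      rw [← Finset.sum_div, div_le_one hpos]
      have h2 : ∑ i ∈ Finset.range r, ((if i + 1 < r then c (i + 1) else 1) +
          c i * alpha (c i ^ 2)) = ∑ i ∈ Finset.Icc 1 (r - 1),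
            (c i + c (i - 1) * alpha (c (i - 1) ^ 2)) +
            (1 + c (r - 1) * alpha (c (r - 1) ^ 2)) := by
        obtain ⟨n, rfl⟩ : ∃ n, r = n + 1 := ⟨r - 1, by omega⟩
        rw [Finset.sum_range_succ, if_neg (lt_irrefl _), Nat.add_sub_cancel]
        congr 1
        rw [← Finset.Ico_add_one_right_eq_Icc, Finset.sum_Ico_eq_sum_range, Nat.add_sub_cancel]
        refine Finset.sum_congr rfl fun i hi => ?_
        have := Finset.mem_range.1 hi
        rw [if_pos (by omega), add_comm 1 i, Nat.add_sub_cancel]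
      rw [h2]
      exact hchi.trans (D.funnel_mono hδ.le (by linarith))
    have hXσ : ‖stack r (fun i => X i σ)‖ ≤ xr + 1 := by
      have h1 : stack r (fun i => X i σ) = stack r (fun i => Y i σ) +
          stack r (fun i => X i σ - Y i σ) := by
        rw [stack_sub, add_sub_cancel]
      rw [h1]
      exact (norm_add_le _ _).trans (add_le_add (hxr σ hσ) hsum)
    have hg := hX.loss_growth D hσ hσt.le ht hl hβ
    have hexp : Real.exp (β * (t - σ)) ≤ Real.exp (β * Δ) :=
      Real.exp_le_exp.2 (mul_le_mul_of_nonneg_left htσ hβ0)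
    calc ‖stack r (fun i => X i t - Y i t)‖
        ≤ ‖stack r (fun i => X i t)‖ + ‖stack r (fun i => Y i t)‖ := by
          rw [stack_sub]; exact norm_sub_le _ _
      _ ≤ (xr + 1) * Real.exp (β * Δ) + xr := by
          refine add_le_add (hg.trans ?_) (hxr t ht.1)
          gcongr
      _ = xr * (1 + Real.exp (β * Δ)) + Real.exp (β * Δ) := by ring
      _ ≤ E := hE
  have hgood : ∀ n : ℕ, ∀ τ ∈ timeDomain ω, τ ≤ n * δ → (τ = 0 ∨ a τ = 0) →
      ∀ i ≤ r, 1 ≤ i → ‖auxError (φ₀ 0) (fun i => X i τ - Y i τ) i‖ ≤ errorBd r c C i := by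
    intro n
    induction n with
    | zero =>
      intro τ hτ hτn _
      have : τ = 0 := le_antisymm (by simpa using hτn) hτ.1
      rw [this]; exact hinit
    | succ n ih =>
      intro τ hτ hτn hτ0
      by_cases h0 : τ = 0
      · rw [h0]; exact hinit
      have haτ := hτ0.resolve_left h0
      have hs := hgoodloss τ hτ haτ fun τ' hτ' hτ'δ hτ'0 => ih τ'
        (Icc_subset_timeDomain hτ ⟨hτ', by linarith⟩) (by push_cast at hτn; linarith) hτ'0
      intro i hi hi1
      -- At the restart the errors are at most `E`, and `φ₀ 0` is small enough to bring all
      -- auxiliary errors below `q`, the common lower bound of the radii.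
      refine (norm_auxError_le_of_small (D.funnel_pos le_rfl).le hE0 hq0 hq1 (fun j hj => ?_) hqE i
        hi).trans (hqc i hi hi1)
      exact (norm_le_norm_stack (fun i => X i τ - Y i τ) hj).trans hs
  have hgood' : ∀ τ ∈ timeDomain ω, (τ = 0 ∨ a τ = 0) →
      ∀ i ≤ r, 1 ≤ i → ‖auxError (φ₀ 0) (fun i => X i τ - Y i τ) i‖ ≤ errorBd r c C i := by
    intro τ hτ hτ0
    obtain ⟨n, hn⟩ := exists_nat_ge (τ / δ)
    exact hgood n τ hτ ((div_le_iff₀ hδ).1 hn) hτ0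
  intro t ht
  refine ⟨fun hat => ?_, fun hat => ?_⟩
  · obtain ⟨τ, hτ, hτt, hτ0, hav, -⟩ := D.avail.exists_last_loss ht.1 hat
    rw [shiftedFunnel_of_available hτ hτt hτ0 hav hat]
    exact hX.available_bound D hτ ht hτ0 hav
      (hgood' τ (Icc_subset_timeDomain ht ⟨hτ, hτt⟩) hτ0) t ⟨hτt, le_rfl⟩
  · exact hgoodloss t ht hat fun τ hτ hτδ hτ0 =>
      hgood' τ (Icc_subset_timeDomain ht ⟨hτ, by linarith⟩) hτ0

end

end Loss

/-! ## The closed loop with frozen gain -/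

section CutLoop

variable {m r : ℕ}

/-- A Lipschitz constant of `cutError`. -/
noncomputable def cutErrorLip (k Φ : ℝ) : ℕ → ℝ
  | 0 => 0
  | i + 1 => Φ + cutGainLip k * cutErrorLip k Φ i

theorem cutErrorLip_nonneg {k Φ : ℝ} (h0 : 0 ≤ k) (h1 : k < 1) (hΦ : 0 ≤ Φ) :
    ∀ i, 0 ≤ cutErrorLip k Φ i
  | 0 => le_rfl
  | i + 1 => add_nonneg hΦ (mul_nonneg (cutGainLip_nonneg h0 h1) (cutErrorLip_nonneg h0 h1 hΦ i))

theorem norm_cutError_sub_le {k φ Φ B : ℝ} (h0 : 0 ≤ k) (h1 : k < 1) (hφ : φ ∈ Icc 0 Φ)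
    {ε ε' : ℕ → Vec m} {n : ℕ} (hB : ∀ i < n, ‖ε i - ε' i‖ ≤ B) :
    ∀ i ≤ n, ‖cutError k φ ε i - cutError k φ ε' i‖ ≤ cutErrorLip k Φ i * B := by
  intro i
  induction i with
  | zero => intro _; simp [cutError, cutErrorLip]
  | succ i ih =>
    intro hi
    rw [cutError_succ, cutError_succ, add_sub_add_comm, ← smul_sub, cutErrorLip, add_mul]
    refine (norm_add_le _ _).trans (add_le_add ?_ ?_)
    · rw [norm_smul, Real.norm_of_nonneg hφ.1]
      exact mul_le_mul hφ.2 (hB i hi) (norm_nonneg _) (hφ.1.trans hφ.2)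
    · refine (norm_cutGain_sub_le h0 h1 _ _).trans ?_
      rw [mul_assoc]
      exact mul_le_mul_of_nonneg_left (ih (by omega)) (cutGainLip_nonneg h0 h1)

theorem cutError_zero_right (k φ : ℝ) (i : ℕ) : cutError k φ (fun _ => (0 : Vec m)) i = 0 := by
  induction i with
  | zero => rfl
  | succ i ih => rw [cutError_succ, ih, cutGain_zero, smul_zero, add_zero]

/-- The extension of a state by zero. -/
def pad (x : Fin r → Vec m) (i : ℕ) : Vec m := if h : i < r then x ⟨i, h⟩ else 0

theorem pad_of_lt (x : Fin r → Vec m) {i : ℕ} (h : i < r) : pad x i = x ⟨i, h⟩ := dif_pos h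

theorem pad_coe (x : Fin r → Vec m) (i : Fin r) : pad x i = x i := pad_of_lt x i.2

theorem norm_pad_sub_le (x y : Fin r → Vec m) (i : ℕ) : ‖pad x i - pad y i‖ ≤ ‖x - y‖ := by
  unfold pad
  split_ifs with h
  · exact norm_le_pi_norm (x - y) ⟨i, h⟩
  · simp

/-- The right-hand side of the `r`-th order equation with frozen gain. -/
noncomputable def cutTop (R : Fin r → Matrix (Fin m) (Fin m) ℝ) (Γ : Matrix (Fin m) (Fin m) ℝ)
    (Y : ℕ → ℝ → Vec m) (a φ₀ : ℝ → ℝ) (k t : ℝ) (x : ℕ → Vec m) : Vec m :=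
  ∑ i : Fin r, Matrix.toEuclideanLin (R i) (x i) + Matrix.toEuclideanLin Γ
    (-a t • cutGain k (cutError k (shiftedFunnel a φ₀ t) (fun i => x i - Y i t) r))

/-- The right-hand side of the first order system with frozen gain. -/
noncomputable def cutField (R : Fin r → Matrix (Fin m) (Fin m) ℝ) (Γ : Matrix (Fin m) (Fin m) ℝ)
    (Y : ℕ → ℝ → Vec m) (a φ₀ : ℝ → ℝ) (k t : ℝ) (x : Fin r → Vec m) : Fin r → Vec m :=
  fun i => if (i : ℕ) + 1 < r then pad x (i + 1) else cutTop R Γ Y a φ₀ k t (pad x)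

variable {R : Fin r → Matrix (Fin m) (Fin m) ℝ} {Γ : Matrix (Fin m) (Fin m) ℝ}
  {Y : ℕ → ℝ → Vec m} {a φ₀ : ℝ → ℝ} {d : ℝ} {c μ : ℕ → ℝ} {C k M KY κ : ℝ}

/-- A Lipschitz constant of `cutField` on `[0, T]`. -/
noncomputable def cutFieldLip (R : Fin r → Matrix (Fin m) (Fin m) ℝ)
    (Γ : Matrix (Fin m) (Fin m) ℝ) (k Φ : ℝ) : ℝ :=
  1 + ((∑ i, matNorm (R i)) + matNorm Γ * (cutGainLip k * cutErrorLip k Φ r))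

theorem norm_availability_le (ha : IsAvailability a) {t : ℝ} (ht : 0 ≤ t) : |a t| ≤ 1 := by
  rcases ha.values t ht with h | h <;> rw [h] <;> norm_num

namespace Design

theorem cutTopLip_nonneg (D : Design R Γ Y a φ₀ d c μ C k M KY κ) {T : ℝ} (hT : 0 ≤ T) :
    0 ≤ (∑ i, matNorm (R i)) + matNorm Γ * (cutGainLip k * cutErrorLip k (φ₀ T) r) :=
  add_nonneg (Finset.sum_nonneg fun _ _ => matNorm_nonneg _)
    (mul_nonneg (matNorm_nonneg Γ) (mul_nonneg (cutGainLip_nonneg D.k_pos.le D.k_lt_one)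
      (cutErrorLip_nonneg D.k_pos.le D.k_lt_one (D.funnel_pos hT).le r)))

theorem cutFieldLip_nonneg (D : Design R Γ Y a φ₀ d c μ C k M KY κ) {T : ℝ} (hT : 0 ≤ T) :
    0 ≤ cutFieldLip R Γ k (φ₀ T) := by
  exact add_nonneg zero_le_one (D.cutTopLip_nonneg hT)

theorem norm_cutTop_sub_le (D : Design R Γ Y a φ₀ d c μ C k M KY κ) {t T : ℝ} (ht : t ∈ Icc 0 T)
    {x y : ℕ → Vec m} {B : ℝ} (hB : ∀ i < r, ‖x i - y i‖ ≤ B) :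
    ‖cutTop R Γ Y a φ₀ k t x - cutTop R Γ Y a φ₀ k t y‖ ≤
      ((∑ i, matNorm (R i)) + matNorm Γ * (cutGainLip k * cutErrorLip k (φ₀ T) r)) * B := by
  have hk0 := D.k_pos.le
  rw [cutTop, cutTop, add_sub_add_comm, ← Finset.sum_sub_distrib, add_mul]
  refine (norm_add_le _ _).trans (add_le_add ?_ ?_)
  · rw [Finset.sum_mul]
    refine (norm_sum_le _ _).trans (Finset.sum_le_sum fun i _ => ?_)
    rw [← map_sub]
    exact (norm_toEuclideanLin_le _ _).trans
      (mul_le_mul_of_nonneg_left (hB i i.2) (matNorm_nonneg _))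
  · rw [← map_sub, ← smul_sub, mul_assoc]
    refine (norm_toEuclideanLin_le _ _).trans (mul_le_mul_of_nonneg_left ?_ (matNorm_nonneg _))
    rw [norm_smul, norm_neg, Real.norm_eq_abs, mul_assoc]
    refine (mul_le_of_le_one_left (norm_nonneg _) (norm_availability_le D.avail ht.1)).trans ?_
    refine (norm_cutGain_sub_le hk0 D.k_lt_one _ _).trans
      (mul_le_mul_of_nonneg_left ?_ (cutGainLip_nonneg hk0 D.k_lt_one))
    refine norm_cutError_sub_le (n := r) hk0 D.k_lt_one
      (shiftedFunnel_mem_Icc D.avail D.funnel.2.1 ht) (fun i hi => ?_) r le_rfl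
    simpa using hB i hi

theorem norm_cutField_sub_le (D : Design R Γ Y a φ₀ d c μ C k M KY κ) {t T : ℝ}
    (ht : t ∈ Icc 0 T) (x y : Fin r → Vec m) :
    ‖cutField R Γ Y a φ₀ k t x - cutField R Γ Y a φ₀ k t y‖ ≤
      cutFieldLip R Γ k (φ₀ T) * ‖x - y‖ := by
  have hL := D.cutFieldLip_nonneg (ht.1.trans ht.2)
  refine (pi_norm_le_iff_of_nonneg (mul_nonneg hL (norm_nonneg _))).2 fun i => ?_
  rw [Pi.sub_apply, cutField, cutField, cutFieldLip, add_mul, one_mul]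
  split_ifs
  · exact le_add_of_le_of_nonneg (norm_pad_sub_le x y _)
      (mul_nonneg (D.cutTopLip_nonneg (ht.1.trans ht.2)) (norm_nonneg _))
  · exact le_add_of_nonneg_of_le (norm_nonneg _)
      (D.norm_cutTop_sub_le ht fun i _ => norm_pad_sub_le x y i)

/-- The availability and the funnel function are the only discontinuous ingredients, and both jump
only on `jumpSet a`. -/
theorem cutControl_continuousWithinAt (D : Design R Γ Y a φ₀ d c μ C k M KY κ)
    {x : ℝ → ℕ → Vec m} {S : Set ℝ} (hS : S ⊆ Ici 0) {t : ℝ} (ht : t ∈ S) (hj : t ∉ jumpSet a)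
    (hx : ∀ i < r, ContinuousWithinAt (fun s => x s i) S t) :
    ContinuousWithinAt (fun t => -a t • cutGain k (cutError k (shiftedFunnel a φ₀ t)
      (fun i => x t i - Y i t) r)) S t := by
  have ha : ContinuousWithinAt a S t := by
    by_contra h
    exact hj ⟨hS ht, fun h' => h (h'.mono hS)⟩
  refine ha.neg.smul ((continuous_cutGain D.k_pos.le D.k_lt_one).continuousAt.comp_continuousWithinAt
    (cutError_continuousWithinAt (n := r) D.k_pos.le D.k_lt_one
      ((continuousWithinAt_shiftedFunnel D.avail D.funnel_cont (hS ht) hj).mono hS)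
      (fun i hi => (hx i hi).sub ((D.refCont i hi t (hS ht)).mono hS)) r le_rfl))

theorem cutTop_continuousWithinAt (D : Design R Γ Y a φ₀ d c μ C k M KY κ) {x : ℝ → ℕ → Vec m}
    {S : Set ℝ} (hS : S ⊆ Ici 0) {t : ℝ} (ht : t ∈ S) (hj : t ∉ jumpSet a)
    (hx : ∀ i < r, ContinuousWithinAt (fun s => x s i) S t) :
    ContinuousWithinAt (fun t => cutTop R Γ Y a φ₀ k t (x t)) S t := by
  refine ContinuousWithinAt.add (tendsto_finsetSum _ fun i _ => ?_) ?_
  · exact (continuous_toEuclideanLin (R i)).continuousAt.comp_continuousWithinAt (hx i i.2)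
  · exact (continuous_toEuclideanLin Γ).continuousAt.comp_continuousWithinAt
      (D.cutControl_continuousWithinAt hS ht hj hx)

/-- Measurability comes from continuity off the countable jump set, boundedness from the values at
the zero state and the Lipschitz estimate. -/
theorem intervalIntegrable_cutField (D : Design R Γ Y a φ₀ d c μ C k M KY κ) {T : ℝ} (hT : 0 ≤ T)
    {x : ℝ → Fin r → Vec m} (hx : ContinuousOn x (Icc 0 T)) :
    IntervalIntegrable (fun t => cutField R Γ Y a φ₀ k t (x t)) volume 0 T := by
  rw [intervalIntegrable_iff_integrableOn_Icc_of_le hT]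
  have hpad : ∀ t ∈ Icc 0 T, ∀ i, ContinuousWithinAt (fun s => pad (x s) i) (Icc 0 T) t := by
    intro t ht i
    unfold pad
    split_ifs with h
    · exact (continuous_apply (⟨i, h⟩ : Fin r)).continuousAt.comp_continuousWithinAt (hx t ht)
    · exact continuousWithinAt_const
  have hmeas : AEStronglyMeasurable (fun t => cutField R Γ Y a φ₀ k t (x t))
      (volume.restrict (Icc 0 T)) := by
    refine aestronglyMeasurable_of_countable measurableSet_Icc D.avail.countable_jumpSet
      fun t ht hj => ?_
    rw [continuousWithinAt_pi]
    intro i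
    unfold cutField
    by_cases h : (i : ℕ) + 1 < r
    · simp only [if_pos h]; exact hpad t ht _
    · simp only [if_neg h]
      exact D.cutTop_continuousWithinAt Icc_subset_Ici_self ht hj fun i _ => hpad t ht i
  obtain ⟨B, hB⟩ := isCompact_Icc.exists_bound_of_continuousOn hx
  obtain ⟨B', hB'⟩ : ∃ B', ∀ t ∈ Icc 0 T, ‖cutField R Γ Y a φ₀ k t 0‖ ≤ B' := by
    refine ⟨matNorm Γ * (cutGainLip k * (cutErrorLip k (φ₀ T) r * KY)), fun t ht => ?_⟩
    have h2 := matNorm_nonneg Γ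
    have h3 := cutGainLip_nonneg D.k_pos.le D.k_lt_one
    have h4 := cutErrorLip_nonneg D.k_pos.le D.k_lt_one (D.funnel_pos (ht.1.trans ht.2)).le r
    have h5 := D.KY_nonneg
    have hp0 : pad (0 : Fin r → Vec m) = fun _ => 0 := by
      ext1 i; unfold pad; split_ifs <;> rfl
    have hnn := mul_nonneg h2 (mul_nonneg h3 (mul_nonneg h4 h5))
    refine (pi_norm_le_iff_of_nonneg hnn).2 fun i => ?_
    rw [cutField, hp0]
    split_ifs
    · rw [norm_zero]; exact hnn
    · rw [cutTop]
      simp only [map_zero, Finset.sum_const_zero, zero_add, zero_sub]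
      refine (norm_toEuclideanLin_le _ _).trans (mul_le_mul_of_nonneg_left ?_ h2)
      rw [norm_smul, norm_neg, Real.norm_eq_abs]
      refine (mul_le_of_le_one_left (norm_nonneg _) (norm_availability_le D.avail ht.1)).trans ?_
      have h6 := norm_cutGain_sub_le D.k_pos.le D.k_lt_one (cutError k (shiftedFunnel a φ₀ t)
        (fun i => -Y i t) r) 0
      rw [cutGain_zero, sub_zero, sub_zero] at h6
      refine h6.trans (mul_le_mul_of_nonneg_left ?_ h3)
      have h7 := norm_cutError_sub_le (n := r) D.k_pos.le D.k_lt_one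
        (shiftedFunnel_mem_Icc D.avail D.funnel.2.1 ht) (ε := fun i => -Y i t) (ε' := fun _ => 0)
        (fun i hi => by simpa using D.refBound i hi t ht.1) r le_rfl
      rwa [cutError_zero_right, sub_zero] at h7
  refine IntegrableOn.of_bound (by simp) hmeas
    (B' + cutFieldLip R Γ k (φ₀ T) * B) ?_
  rw [ae_restrict_iff' measurableSet_Icc]
  refine Eventually.of_forall fun t ht => ?_
  have h1 := D.norm_cutField_sub_le ht (x t) 0
  rw [sub_zero] at h1
  calc ‖cutField R Γ Y a φ₀ k t (x t)‖
      = ‖cutField R Γ Y a φ₀ k t 0 +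
        (cutField R Γ Y a φ₀ k t (x t) - cutField R Γ Y a φ₀ k t 0)‖ := by
          rw [add_sub_cancel]
    _ ≤ _ := (norm_add_le _ _).trans (add_le_add (hB' t ht) (h1.trans
        (mul_le_mul_of_nonneg_left (hB t ht) (D.cutFieldLip_nonneg hT))))

/-- Where the auxiliary errors are at most `k`, freezing the gain has no effect. -/
theorem cutControl_eq {t : ℝ} {x : ℕ → Vec m}
    (h : ∀ i ≤ r, ‖auxError (shiftedFunnel a φ₀ t) (fun i => x i - Y i t) i‖ ≤ k) :
    -a t • cutGain k (cutError k (shiftedFunnel a φ₀ t) (fun i => x i - Y i t) r) =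
      -(a t * alpha (‖auxError (shiftedFunnel a φ₀ t) (fun i => x i - Y i t) r‖ ^ 2)) •
        auxError (shiftedFunnel a φ₀ t) (fun i => x i - Y i t) r := by
  rw [cutError_eq_of_auxError_le (fun j hj => h j hj.le) r le_rfl, cutGain_eq_gain (h r le_rfl),
    gain, smul_smul, neg_mul]

end Design

theorem pi_integral_apply {x : ℝ → Fin r → Vec m} {t : ℝ}
    (hx : IntervalIntegrable x volume 0 t) (i : Fin r) :
    (∫ s in 0..t, x s) i = ∫ s in 0..t, x s i :=
  ((ContinuousLinearMap.proj (R := ℝ) (φ := fun _ : Fin r => Vec m)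
    i).intervalIntegral_comp_comm hx).symm

/-- The loop with frozen gain has global trajectories. -/
theorem Design.exists_isTrajectory (D : Design R Γ Y a φ₀ d c μ C k M KY κ) (x₀ : Fin r → Vec m) :
    ∃ (X : ℕ → ℝ → Vec m) (f : ℝ → Vec m), IsTrajectory R Γ Y a φ₀ k ⊤ X f ∧
      (∀ i : Fin r, X i 0 = x₀ i) ∧ ContinuousOn (fun t => fun i : Fin r => X i t) (Ici 0) ∧
      ∀ t, 0 ≤ t → (fun i : Fin r => X i t) = x₀ +
        ∫ s in 0..t, cutField R Γ Y a φ₀ k s (fun i : Fin r => X i s) := by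
  have hr := D.one_le
  obtain ⟨x, hxc, hx⟩ := exists_integral_solution (F := cutField R Γ Y a φ₀ k)
    (L := fun T => cutFieldLip R Γ k (φ₀ T)) (fun T hT => D.cutFieldLip_nonneg hT)
    (fun T t ht => D.norm_cutField_sub_le ht)
    (fun T hT x hx => D.intervalIntegrable_cutField hT hx) x₀
  have hint : ∀ t, 0 ≤ t → IntervalIntegrable (fun s => cutField R Γ Y a φ₀ k s (x s)) volume 0 t :=
    fun t ht => D.intervalIntegrable_cutField ht (hxc.mono Icc_subset_Ici_self)
  have hx0 : x 0 = x₀ := by simpa using hx 0 le_rfl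
  have hpc : ∀ i, ContinuousOn (fun s => pad (x s) i) (Ici 0) := by
    intro i
    unfold pad
    split_ifs with h
    · exact (continuous_apply (⟨i, h⟩ : Fin r)).comp_continuousOn hxc
    · exact continuousOn_const
  have hpi : ∀ (i : ℕ) (hi : i < r) (t : ℝ), 0 ≤ t → pad (x t) i = pad (x 0) i +
      ∫ s in 0..t, cutField R Γ Y a φ₀ k s (x s) ⟨i, hi⟩ := by
    intro i hi t ht
    rw [pad_of_lt _ hi, pad_of_lt _ hi, ← pi_integral_apply (hint t ht), hx t ht, hx0]
    rfl
  have hxx : ∀ t, (fun i : Fin r => pad (x t) i) = x t := fun t => funext fun i => pad_coe _ i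
  have hr1 : r - 1 < r := by omega
  have htop : ∀ s, cutField R Γ Y a φ₀ k s (x s) ⟨r - 1, hr1⟩ =
      cutTop R Γ Y a φ₀ k s (pad (x s)) := fun s => if_neg (by simp; omega)
  refine ⟨fun i t => pad (x t) i, fun t => cutTop R Γ Y a φ₀ k t (pad (x t)),
    ⟨fun i _ => ?_, ?_, ?_, ?_, ?_⟩, fun i => ?_, ?_, ?_⟩
  · rw [timeDomain_top]; exact hpc i
  · intro i hi t ht
    rw [timeDomain_top] at ht ⊢
    refine hasDerivWithinAt_Ici_of_integral (hpc (i + 1)) (fun s hs => ?_) ht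
    rw [hpi i (by omega) s hs]
    congr 1
    exact intervalIntegral.integral_congr fun y _ => if_pos hi
  · intro t ht
    have h1 := hint t ht.1
    simp only [← htop]
    exact ⟨Integrable.eval h1.1 _, Integrable.eval h1.2 _⟩
  · intro t ht
    rw [hpi (r - 1) hr1 t ht.1]
    simp only [htop]
  · intro t _ h
    show cutTop R Γ Y a φ₀ k t (pad (x t)) = _
    rw [cutTop, Design.cutControl_eq h]
  · exact (pad_coe _ i).trans (congrFun hx0 i)
  · exact hxc.congr fun t _ => hxx t
  · intro t ht
    simp only [hxx]
    exact hx t ht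

theorem IsTrajectory.intervalIntegrable {ω : EReal} {X : ℕ → ℝ → Vec m} {f : ℝ → Vec m}
    (hX : IsTrajectory R Γ Y a φ₀ k ω X f) {i : ℕ} (hi : i < r) {t : ℝ} (ht : t ∈ timeDomain ω) :
    IntervalIntegrable (X i) volume 0 t := by
  refine ContinuousOn.intervalIntegrable ?_
  rw [uIcc_of_le ht.1]
  exact (hX.cont _ hi).mono (Icc_subset_timeDomain ht)

theorem IsTrajectory.integral_succ {ω : EReal} {X : ℕ → ℝ → Vec m} {f : ℝ → Vec m}
    (hX : IsTrajectory R Γ Y a φ₀ k ω X f) {i : ℕ} (hi : i + 1 < r) {t : ℝ}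
    (ht : t ∈ timeDomain ω) : X i t = X i 0 + ∫ s in 0..t, X (i + 1) s := by
  have hsub : Icc 0 t ⊆ timeDomain ω := Icc_subset_timeDomain ht
  rw [intervalIntegral.integral_eq_sub_of_hasDeriv_right_of_le ht.1
    ((hX.cont i (by omega)).mono hsub) (fun s hs => ?_) (hX.intervalIntegrable hi ht),
    add_sub_cancel]
  exact ((hX.deriv i hi s (hsub ⟨hs.1.le, hs.2.le⟩)).mono_of_mem_nhdsWithin
    (timeDomain_mem_nhdsGE (hsub ⟨hs.1.le, hs.2.le⟩))).mono Ioi_subset_Ici_self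

/-- Trajectories with auxiliary errors at most `k` solve the first order system with frozen
gain. -/
theorem IsTrajectory.integral_cutField (D : Design R Γ Y a φ₀ d c μ C k M KY κ) {ω : EReal}
    {X : ℕ → ℝ → Vec m} {f : ℝ → Vec m} (hX : IsTrajectory R Γ Y a φ₀ k ω X f)
    (hk : ∀ t ∈ timeDomain ω, ∀ i ≤ r,
      ‖auxError (shiftedFunnel a φ₀ t) (fun i => X i t - Y i t) i‖ ≤ k) {t : ℝ}
    (ht : t ∈ timeDomain ω) :
    (fun i : Fin r => X i t) = (fun i : Fin r => X i 0) +
      ∫ s in 0..t, cutField R Γ Y a φ₀ k s (fun i : Fin r => X i s) := by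
  have hsub : Icc 0 t ⊆ timeDomain ω := Icc_subset_timeDomain ht
  have hxc : ContinuousOn (fun s => fun i : Fin r => X i s) (Icc 0 t) :=
    continuousOn_pi.2 fun i => (hX.cont i i.2).mono hsub
  have hpad : ∀ s, ∀ i < r, pad (fun i : Fin r => X i s) i = X i s := fun s i hi => pad_of_lt _ hi
  ext1 i
  rw [Pi.add_apply, pi_integral_apply (D.intervalIntegrable_cutField ht.1 hxc)]
  by_cases hi : (i : ℕ) + 1 < r
  · have h1 : (∫ s in 0..t, cutField R Γ Y a φ₀ k s (fun i : Fin r => X i s) i) =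
        ∫ s in 0..t, X (i + 1) s := by
      refine intervalIntegral.integral_congr fun s _ => ?_
      show cutField R Γ Y a φ₀ k s (fun i : Fin r => X i s) i = X (i + 1) s
      rw [cutField, if_pos hi, hpad s _ hi]
    rw [h1]
    exact hX.integral_succ hi ht
  · have hir : (i : ℕ) = r - 1 := by have := i.2; omega
    have h1 : (∫ s in 0..t, cutField R Γ Y a φ₀ k s (fun i : Fin r => X i s) i) =
        ∫ s in 0..t, f s := by
      refine intervalIntegral.integral_congr fun s hs => ?_
      rw [uIcc_of_le ht.1] at hs
      have hsD := hsub hs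
      show cutField R Γ Y a φ₀ k s (fun i : Fin r => X i s) i = f s
      -- Padding changes nothing at indices below `r`, the only ones that the auxiliary errors up to
      -- index `r` involve.
      have h2 : ∀ i ≤ r, ‖auxError (shiftedFunnel a φ₀ s)
          (fun i => pad (fun i : Fin r => X i s) i - Y i s) i‖ ≤ k := by
        intro i hi
        rw [auxError_congr (n := r) (ε' := fun i => X i s - Y i s)
          (fun j hj => by simp only [hpad s j hj]) i hi]
        exact hk s hsD i hi
      rw [cutField, if_neg hi, cutTop, Design.cutControl_eq h2, hX.rhs s hsD (hk s hsD),
        auxError_congr (n := r) (ε' := fun i => X i s - Y i s)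
          (fun j hj => by simp only [hpad s j hj]) r le_rfl]
      simp only [pad_coe]
    rw [h1, hir]
    exact hX.integral t ht

end CutLoop

/-! ## Trajectories and solutions -/

section Solutions

variable {m r : ℕ} {R : Fin r → Matrix (Fin m) (Fin m) ℝ} {Γ : Matrix (Fin m) (Fin m) ℝ}
  {yref : ℝ → Vec m} {a φ₀ : ℝ → ℝ} {y₀ : Fin r → Vec m}

/-- The right-hand side of the closed loop along `y`. -/
noncomputable def loopRHS (R : Fin r → Matrix (Fin m) (Fin m) ℝ) (Γ : Matrix (Fin m) (Fin m) ℝ)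
    (yref : ℝ → Vec m) (a φ₀ : ℝ → ℝ) (ω : EReal) (y : ℝ → Vec m) (t : ℝ) : Vec m :=
  ∑ i : Fin r, Matrix.toEuclideanLin (R i) (iteratedDerivWithin (i : ℕ) y (timeDomain ω) t)
    + Matrix.toEuclideanLin Γ (control r yref a φ₀ ω y t)

/-- The formula for `f` holds by definition at all times, so no bound on the auxiliary errors is
presupposed and `k` is free. The content is the integral form of the equation, from absolute
continuity. -/
theorem IsSolution.isTrajectory {ω : EReal} {y : ℝ → Vec m}
    (hy : IsSolution R Γ yref a φ₀ y₀ ω y) (k : ℝ) :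
    IsTrajectory R Γ (fun i => iteratedDerivWithin i yref (Ici 0)) a φ₀ k ω
      (fun i => iteratedDerivWithin i y (timeDomain ω)) (loopRHS R Γ yref a φ₀ ω y) := by
  have hu : UniqueDiffOn ℝ (timeDomain ω) := uniqueDiffOn_timeDomain
  have hac : ∀ t ∈ timeDomain ω, IntervalIntegrable (loopRHS R Γ yref a φ₀ ω y) volume 0 t ∧
      iteratedDerivWithin (r - 1) y (timeDomain ω) t =
        iteratedDerivWithin (r - 1) y (timeDomain ω) 0 +
          ∫ s in 0..t, loopRHS R Γ yref a φ₀ ω y s := by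
    intro t ht
    refine integral_of_absolutelyContinuous (hy.absCont t ht) ?_
    filter_upwards [hy.ode] with s hs hsI
    rw [uIoc_of_le ht.1] at hsI
    exact hs (Icc_subset_timeDomain ht ⟨hsI.1.le, hsI.2⟩)
  refine ⟨fun i hi => ?_, fun i hi t ht => ?_, fun t ht => (hac t ht).1, fun t ht => (hac t ht).2,
    fun t _ _ => rfl⟩
  · refine hy.contDiffOn.continuousOn_iteratedDerivWithin ?_ hu
    exact_mod_cast (show i ≤ r - 1 by omega)
  · have hd := hy.contDiffOn.differentiableOn_iteratedDerivWithin (m := i)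
      (by exact_mod_cast (show i < r - 1 by omega)) hu
    simp only [iteratedDerivWithin_succ]
    exact (hd t ht).hasDerivWithinAt

/-- A global trajectory with auxiliary errors at most `k` and a bounded right-hand side is a
solution. -/
theorem IsTrajectory.isSolution (hr : 1 ≤ r) {k F : ℝ} {X : ℕ → ℝ → Vec m} {f : ℝ → Vec m}
    (hX : IsTrajectory R Γ (fun i => iteratedDerivWithin i yref (Ici 0)) a φ₀ k ⊤ X f)
    (h0 : ∀ i : Fin r, X i 0 = y₀ i)
    (hk : ∀ t, 0 ≤ t → ∀ i ≤ r, ‖auxError (shiftedFunnel a φ₀ t)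
      (fun i => X i t - iteratedDerivWithin i yref (Ici 0) t) i‖ ≤ k)
    (hF : ∀ t, 0 ≤ t → ‖f t‖ ≤ F) :
    IsSolution R Γ yref a φ₀ y₀ ⊤ (X 0) ∧
      ∀ i < r, EqOn (iteratedDerivWithin i (X 0) (Ici 0)) (X i) (Ici 0) := by
  have hD : timeDomain ⊤ = Ici 0 := timeDomain_top
  have hmem : ∀ {t : ℝ}, 0 ≤ t → t ∈ timeDomain ⊤ := fun ht => hD ▸ ht
  have hu : UniqueDiffOn ℝ (Ici (0 : ℝ)) := uniqueDiffOn_Ici 0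
  have hXd : ∀ i, i + 1 < r → ∀ t ∈ Ici (0 : ℝ), HasDerivWithinAt (X i) (X (i + 1) t) (Ici 0) t := by
    intro i hi t ht
    have := hX.deriv i hi t (hmem ht)
    rwa [hD] at this
  have hXc : ∀ i < r, ContinuousOn (X i) (Ici 0) := by
    intro i hi
    have := hX.cont i hi
    rwa [hD] at this
  have hI : ∀ i < r, EqOn (iteratedDerivWithin i (X 0) (Ici 0)) (X i) (Ici 0) :=
    eqOn_iteratedDerivWithin hu (fun _ _ => rfl) hXd
  have hr1 : r - 1 < r := by omega
  have hctrl : ∀ t, 0 ≤ t → ∑ i : Fin r, Matrix.toEuclideanLin (R i)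
      (iteratedDerivWithin (i : ℕ) (X 0) (Ici 0) t) +
        Matrix.toEuclideanLin Γ (control r yref a φ₀ ⊤ (X 0) t) = f t := by
    intro t ht
    rw [hX.rhs t (hmem ht) (hk t ht), control, loopError,
      auxError_congr (n := r) (ε' := fun i => X i t - iteratedDerivWithin i yref (Ici 0) t)
        (fun j hj => ?_) r le_rfl]
    · congr 1
      exact Finset.sum_congr rfl fun i _ => by rw [hI i i.2 ht]
    · rw [errDeriv, hD, hI j hj ht]
  refine ⟨⟨by simp, ?_, ?_, ?_, ?_⟩, hI⟩
  · rw [hD]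
    refine (contDiffOn_nat_iff_continuousOn_differentiableOn_deriv hu).2 ⟨?_, ?_⟩
    · intro i hi
      exact (hXc i (by omega)).congr (hI i (by omega))
    · intro i hi t ht
      exact ((hXd i (by omega) t ht).congr (hI i (by omega))
        (hI i (by omega) ht)).differentiableWithinAt
  · intro i
    rw [hD, hI i i.2 (mem_Ici.2 le_rfl)]
    exact h0 i
  · intro T hT
    rw [hD]
    have hT0 : 0 ≤ T := hT.1
    -- The bound on `f` makes its integral Lipschitz.
    refine LipschitzOnWith.absolutelyContinuousOnInterval (K := Real.toNNReal F)
      (LipschitzOnWith.of_dist_le_mul fun s hs t ht => ?_)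
    rw [uIcc_of_le hT0] at hs ht
    have hF0 : 0 ≤ F := (norm_nonneg _).trans (hF 0 le_rfl)
    rw [hI _ hr1 (mem_Ici.2 hs.1), hI _ hr1 (mem_Ici.2 ht.1), hX.integral s (hmem hs.1),
      hX.integral t (hmem ht.1), dist_eq_norm, add_sub_add_left_eq_sub,
      intervalIntegral.integral_interval_sub_left (hX.integrable s (hmem hs.1))
        (hX.integrable t (hmem ht.1)), Real.coe_toNNReal _ hF0, Real.dist_eq]
    refine intervalIntegral.norm_integral_le_of_norm_le_const fun x hx => hF x ?_
    exact (le_min ht.1 hs.1).trans hx.1.le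
  -- Lebesgue's differentiation theorem is applied on each `[0, n]`; the time `0` is discarded
  -- because the integral formula is known only to its right.
  · have hae : ∀ n : ℕ, ∀ᵐ t : ℝ, t ∈ uIcc 0 (n : ℝ) →
        HasDerivAt (fun x => ∫ s in 0..x, f s) (f t) t := by
      intro n
      filter_upwards [(hX.integrable n (hmem n.cast_nonneg)).ae_hasDerivAt_integral] with t ht htI
      exact ht htI 0 left_mem_uIcc
    have h0ae : ∀ᵐ t : ℝ, t ≠ 0 := by simp [ae_iff, measure_singleton]
    filter_upwards [ae_all_iff.2 hae, h0ae] with t ht ht0 htD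
    have ht0' : 0 < t := lt_of_le_of_ne htD.1 (Ne.symm ht0)
    rw [hD, hctrl t htD.1]
    obtain ⟨n, hn⟩ := exists_nat_ge t
    have hd := (ht n (by rw [uIcc_of_le n.cast_nonneg]; exact ⟨htD.1, hn⟩)).const_add (X (r - 1) 0)
    refine hd.congr_of_eventuallyEq ?_
    filter_upwards [Ici_mem_nhds ht0'] with s hs
    rw [hI _ hr1 hs, hX.integral s (hmem hs)]

end Solutions

/-! ## The design constants -/

section Constants

variable {m r : ℕ}

theorem cmu_fst_succ (q d : ℝ) (φ₀ : ℝ → ℝ) (ε₀ : ℕ → Vec m) (k : ℕ) :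
    (cmu q d φ₀ ε₀ (k + 1)).1 = √(max (max (‖auxError (φ₀ 0) ε₀ (k + 1)‖ ^ 2)
      (alphaDagger (if k = 0 then 1 + muZero d φ₀ else (cmu q d φ₀ ε₀ (k + 1)).2))) (q ^ 2)) := rfl

theorem cmu_snd_succ (q d : ℝ) (φ₀ : ℝ → ℝ) (ε₀ : ℕ → Vec m) (k : ℕ) :
    (cmu q d φ₀ ε₀ (k + 1)).2 =
      1 + muZero d φ₀ * (1 + (cmu q d φ₀ ε₀ k).1 * alpha ((cmu q d φ₀ ε₀ k).1 ^ 2)) +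
        alphaTilde ((cmu q d φ₀ ε₀ k).1 ^ 2) *
          ((cmu q d φ₀ ε₀ k).2 + (cmu q d φ₀ ε₀ k).1 * alpha ((cmu q d φ₀ ε₀ k).1 ^ 2)) := rfl

/-- The two entries of the maximum serve different phases: the initial error starts the first one,
and `q` the restart after each loss. -/
theorem le_cmu_fst (q d : ℝ) (φ₀ : ℝ → ℝ) (ε₀ : ℕ → Vec m) (k : ℕ) :
    q ≤ (cmu q d φ₀ ε₀ (k + 1)).1 ∧ ‖auxError (φ₀ 0) ε₀ (k + 1)‖ ≤ (cmu q d φ₀ ε₀ (k + 1)).1 := by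
  rw [cmu_fst_succ]
  exact ⟨Real.le_sqrt_of_sq_le (le_max_right _ _),
    Real.le_sqrt_of_sq_le ((le_max_left _ _).trans (le_max_left _ _))⟩

/-- Each entry of the maximum is less than one. The index `r`, beyond those occurring in `χ`, is
included because its value will bound `C` from below. -/
theorem cmu_bounds {q d : ℝ} {φ₀ : ℝ → ℝ} {ε₀ : ℕ → Vec m} (hd : 0 ≤ d) (hφ : 0 < φ₀ 0)
    (hq : q ∈ Ioo (0 : ℝ) 1) (h : ∀ i ∈ Finset.Icc 1 r, ‖auxError (φ₀ 0) ε₀ i‖ < 1) :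
    ∀ k ≤ r, 0 ≤ (cmu q d φ₀ ε₀ k).1 ∧ (cmu q d φ₀ ε₀ k).1 < 1 ∧ 0 ≤ (cmu q d φ₀ ε₀ k).2 := by
  have hμ₀ : 0 ≤ muZero d φ₀ := by unfold muZero; positivity
  intro k
  induction k with
  | zero => exact fun _ => ⟨le_rfl, one_pos, hμ₀⟩
  | succ k ih =>
    intro hk
    obtain ⟨h0, h1, h2⟩ := ih (by omega)
    have hμ : 0 ≤ (cmu q d φ₀ ε₀ (k + 1)).2 := by
      rw [cmu_snd_succ]
      have := (alpha_pos (sq_lt_one h0 h1)).le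
      have := alphaTilde_nonneg (sq_nonneg (cmu q d φ₀ ε₀ k).1)
      positivity
    refine ⟨hq.1.le.trans (le_cmu_fst q d φ₀ ε₀ k).1, ?_, hμ⟩
    rw [cmu_fst_succ, Real.sqrt_lt' one_pos, one_pow]
    refine max_lt (max_lt ?_ (alphaDagger_lt_one ?_)) (sq_lt_one hq.1.le hq.2)
    · exact sq_lt_one (norm_nonneg _) (h _ (Finset.mem_Icc.2 ⟨by omega, hk⟩))
    · split_ifs
      · linarith
      · exact hμ

theorem errorConsts_cmu {q d : ℝ} {φ₀ : ℝ → ℝ} {ε₀ : ℕ → Vec m} (hd : 0 ≤ d) (hφ : 0 < φ₀ 0)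
    (hq : q ∈ Ioo (0 : ℝ) 1) (h : ∀ i ∈ Finset.Icc 1 r, ‖auxError (φ₀ 0) ε₀ i‖ < 1) :
    ErrorConsts r (muZero d φ₀) (fun k => (cmu q d φ₀ ε₀ k).1) (fun k => (cmu q d φ₀ ε₀ k).2) where
  mu0_nonneg := by unfold muZero; have := hφ.le; positivity
  c_zero := rfl
  mu_zero := rfl
  mu_succ k := cmu_snd_succ q d φ₀ ε₀ k
  c_pos k hk _ := by
    obtain ⟨k, rfl⟩ := Nat.exists_eq_add_of_le' hk
    exact hq.1.trans_le (le_cmu_fst q d φ₀ ε₀ k).1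
  c_lt_one k hk := (cmu_bounds hd hφ hq h k hk.le).2.1
  dagger k hk := by
    show _ ≤ (cmu q d φ₀ ε₀ (k + 1)).1 ^ 2
    rw [cmu_fst_succ, Real.sq_sqrt (le_max_of_le_right (sq_nonneg q))]
    exact (le_max_right _ _).trans (le_max_left _ _)

open Matrix in
/-- A matrix with positive definite symmetric part is coercive. -/
theorem exists_coercive {Γ : Matrix (Fin m) (Fin m) ℝ} (h : (Γ + Γ.transpose).PosDef) :
    ∃ κ > 0, ∀ v : Vec m, κ * ‖v‖ ^ 2 ≤ inner ℝ v (Matrix.toEuclideanLin Γ v) := by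
  have hinner : ∀ v : Vec m, inner ℝ v (Matrix.toEuclideanLin Γ v) =
      (1 / 2 : ℝ) * (v.ofLp ⬝ᵥ (Γ + Γᵀ) *ᵥ v.ofLp) := by
    intro v
    have h1 : inner ℝ v (Matrix.toEuclideanLin Γ v) = v.ofLp ⬝ᵥ Γ *ᵥ v.ofLp := by
      rw [EuclideanSpace.inner_eq_star_dotProduct, star_trivial, dotProduct_comm]
      rfl
    have h2 : v.ofLp ⬝ᵥ Γᵀ *ᵥ v.ofLp = v.ofLp ⬝ᵥ Γ *ᵥ v.ofLp := by
      rw [mulVec_transpose, dotProduct_comm, ← dotProduct_mulVec]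
    rw [h1, add_mulVec, dotProduct_add, h2]
    ring
  have hpos : ∀ v : Vec m, v ≠ 0 → 0 < inner ℝ v (Matrix.toEuclideanLin Γ v) := by
    intro v hv
    have h1 : v.ofLp ≠ 0 := fun h0 => hv (by ext i; exact congrFun h0 i)
    have := h.dotProduct_mulVec_pos h1
    rw [star_trivial] at this
    rw [hinner]
    positivity
  have hcont : Continuous fun v : Vec m => inner ℝ v (Matrix.toEuclideanLin Γ v) :=
    continuous_id.inner (continuous_toEuclideanLin Γ)
  obtain ⟨κ, hκ, hle⟩ : ∃ κ > 0, ∀ v ∈ Metric.sphere (0 : Vec m) 1,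
      κ ≤ inner ℝ v (Matrix.toEuclideanLin Γ v) := by
    -- The sphere is empty for `m = 0`, where any `κ` will do.
    rcases (Metric.sphere (0 : Vec m) 1).eq_empty_or_nonempty with he | hne
    · exact ⟨1, one_pos, fun v hv => by simp [he] at hv⟩
    · obtain ⟨w, hw, hmin⟩ := (isCompact_sphere (0 : Vec m) 1).exists_isMinOn hne hcont.continuousOn
      refine ⟨_, hpos w fun h0 => ?_, hmin⟩
      rw [h0] at hw
      simp at hw
  refine ⟨κ, hκ, fun v => ?_⟩
  rcases eq_or_ne v 0 with rfl | hv
  · simp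
  · have hn : 0 < ‖v‖ := norm_pos_iff.2 hv
    have h1 := hle (‖v‖⁻¹ • v) (by
      rw [mem_sphere_zero_iff_norm, norm_smul, norm_inv, norm_norm, inv_mul_cancel₀ hn.ne'])
    rw [map_smul, real_inner_smul_left, real_inner_smul_right, ← mul_assoc, ← mul_inv,
      ← div_eq_inv_mul, le_div_iff₀ (mul_pos hn hn)] at h1
    rwa [sq]

/-- The gain exceeds every bound close to the boundary of the funnel. -/
theorem exists_lt_alpha_mul {κ K b : ℝ} (hκ : 0 < κ) (hK : 0 ≤ K) (hb : b < 1) :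
    ∃ C, b ≤ C ∧ 0 < C ∧ C < 1 ∧ K < κ * (alpha (C ^ 2) * C ^ 2) := by
  have hz : 0 ≤ K / κ := by positivity
  -- This `w` solves `α(w) w = K / κ + 1`; the summand `1` makes the final inequality strict.
  set w : ℝ := alphaDagger (K / κ + 1) with hw
  have hw1 : w < 1 := alphaDagger_lt_one (by linarith)
  have hw0 : 0 < w := by rw [hw, alphaDagger]; positivity
  refine ⟨max b √w, le_max_left _ _, lt_max_of_lt_right (Real.sqrt_pos.2 hw0), ?_, ?_⟩
  · exact max_lt hb (by rwa [Real.sqrt_lt' one_pos, one_pow])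
  · have hC0 : 0 ≤ max b √w := le_max_of_le_right (Real.sqrt_nonneg _)
    have hC1 : max b √w < 1 := max_lt hb (by rwa [Real.sqrt_lt' one_pos, one_pow])
    have h1 : w ≤ max b √w ^ 2 := (Real.sq_sqrt hw0.le).ge.trans
      (pow_le_pow_left₀ (Real.sqrt_nonneg _) (le_max_right _ _) 2)
    have h2 := le_alpha_mul_of_alphaDagger_le (by linarith) (sq_lt_one hC0 hC1) h1
    have h3 : K = κ * (K / κ) := by field_simp
    nlinarith

/-- Finitely many bounds below one leave room for `k`, the radius outside which the gain is frozen;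
the gap is needed for continuation in the available phases. -/
theorem exists_errorBd_lt {c : ℕ → ℝ} {C : ℝ} (hc : ∀ i < r, c i < 1) (hC : C < 1) :
    ∃ k < 1, ∀ i ≤ r, errorBd r c C i < k := by
  have h : ∀ᶠ k in 𝓝[<] (1 : ℝ), ∀ i ∈ Finset.range (r + 1), errorBd r c C i < k := by
    refine (Filter.eventually_all_finset _).2 fun i _ => ?_
    refine mem_nhdsWithin_of_mem_nhds (Ioi_mem_nhds ?_)
    unfold errorBd
    split_ifs with hi
    · exact hc i hi
    · exact hC
  obtain ⟨k, hk, hk1⟩ := (h.and self_mem_nhdsWithin).exists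
  exact ⟨k, hk1, fun i hi => hk i (Finset.mem_range.2 (by omega))⟩

end Constants

/-! ## The closed loop -/

section ClosedLoop

variable {m r : ℕ} {R : Fin r → Matrix (Fin m) (Fin m) ℝ} {Γ : Matrix (Fin m) (Fin m) ℝ}
  {Y : ℕ → ℝ → Vec m} {yref : ℝ → Vec m} {a φ₀ : ℝ → ℝ} {y₀ : Fin r → Vec m} {d : ℝ}
  {c μ : ℕ → ℝ} {C k M KY κ : ℝ}

theorem norm_control_le (ha : IsAvailability a) {t : ℝ} (ht : 0 ≤ t) (hk : k < 1) {v : Vec m}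
    (hv : ‖v‖ ≤ k) : ‖-(a t * alpha (‖v‖ ^ 2)) • v‖ ≤ k * alpha (k ^ 2) := by
  have h := norm_gain_le hv hk
  have h1 : -(a t * alpha (‖v‖ ^ 2)) • v = -a t • gain v := by rw [gain, smul_smul, neg_mul]
  rw [h1, norm_smul, norm_neg, Real.norm_eq_abs]
  exact (mul_le_of_le_one_left (norm_nonneg _) (norm_availability_le ha ht)).trans h

theorem IsTrajectory.norm_rhs_le {ω : EReal} {X : ℕ → ℝ → Vec m} {f : ℝ → Vec m}
    (hX : IsTrajectory R Γ Y a φ₀ k ω X f) (ha : IsAvailability a) (hk : k < 1) {B t : ℝ}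
    (ht : t ∈ timeDomain ω)
    (h : ∀ i ≤ r, ‖auxError (shiftedFunnel a φ₀ t) (fun i => X i t - Y i t) i‖ ≤ k)
    (hB : ∀ i < r, ‖X i t‖ ≤ B) :
    ‖f t‖ ≤ ∑ i : Fin r, matNorm (R i) * B + matNorm Γ * (k * alpha (k ^ 2)) := by
  rw [hX.rhs t ht h]
  refine (norm_add_le _ _).trans (add_le_add ?_ ?_)
  · refine (norm_sum_le _ _).trans (Finset.sum_le_sum fun i _ => ?_)
    exact (norm_toEuclideanLin_le _ _).trans
      (mul_le_mul_of_nonneg_left (hB i i.2) (matNorm_nonneg _))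
  · exact (norm_toEuclideanLin_le _ _).trans
      (mul_le_mul_of_nonneg_left (norm_control_le ha ht.1 hk (h r le_rfl)) (matNorm_nonneg _))

/-- The bounds of the auxiliary errors and of the errors during losses bound the state. -/
theorem Design.bounded_of_bounds (D : Design R Γ Y a φ₀ d c μ C k M KY κ) {E t : ℝ}
    {x : ℕ → Vec m} (ht : 0 ≤ t)
    (h1 : a t = 1 → ∀ i ≤ r, 1 ≤ i →
      ‖auxError (shiftedFunnel a φ₀ t) (fun i => x i - Y i t) i‖ ≤ errorBd r c C i)
    (h0 : a t = 0 → ‖stack r (fun i => x i - Y i t)‖ ≤ E) :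
    (∀ i ≤ r, ‖auxError (shiftedFunnel a φ₀ t) (fun i => x i - Y i t) i‖ ≤ k) ∧
      ∀ i < r, ‖x i‖ ≤ max ((k + k * alpha (k ^ 2)) / φ₀ 0) E + KY := by
  have hk0 := D.k_pos.le
  have haux : ∀ i ≤ r, ‖auxError (shiftedFunnel a φ₀ t) (fun i => x i - Y i t) i‖ ≤ k := by
    intro i hi
    rcases D.avail.values t ht with h | h
    · rw [shiftedFunnel_of_loss h, auxError_zero_left, norm_zero]
      exact hk0
    · rcases Nat.eq_zero_or_pos i with rfl | hi0
      · rw [auxError_zero, norm_zero]; exact hk0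
      · exact (h1 h i hi hi0).trans (D.lt_k i hi).le
  refine ⟨haux, fun i hi => ?_⟩
  have herr : ‖x i - Y i t‖ ≤ max ((k + k * alpha (k ^ 2)) / φ₀ 0) E := by
    rcases D.avail.values t ht with h | h
    · exact le_max_of_le_right ((norm_le_norm_stack (fun i => x i - Y i t) hi).trans (h0 h))
    · obtain ⟨τ, hτ0, hτt, hτ, hav, -⟩ := D.avail.exists_last_loss ht h
      have hφ : φ₀ 0 ≤ shiftedFunnel a φ₀ t := by
        rw [shiftedFunnel_of_available hτ0 hτt hτ hav h]
        exact D.funnel_mono le_rfl (by linarith)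
      have hφ0 := D.funnel_pos le_rfl
      refine le_max_of_le_left ((norm_le_of_auxError (hφ0.trans_le hφ) (fun i => x i - Y i t)
        (haux (i + 1) hi) (haux i hi.le) D.k_lt_one).trans ?_)
      have := (alpha_pos (sq_lt_one hk0 D.k_lt_one)).le
      gcongr
  calc ‖x i‖ = ‖(x i - Y i t) + Y i t‖ := by rw [sub_add_cancel]
    _ ≤ _ := (norm_add_le _ _).trans (add_le_add herr (D.refBound i hi t ht))

/-- The loop has a global solution, which extends every solution, if all trajectories satisfy
a priori bounds. -/
theorem Design.exists_global_solution
    (D : Design R Γ (fun i => iteratedDerivWithin i yref (Ici 0)) a φ₀ d c μ C k M KY κ)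
    (hB : ∀ (ω : EReal) (X : ℕ → ℝ → Vec m) (f : ℝ → Vec m),
      IsTrajectory R Γ (fun i => iteratedDerivWithin i yref (Ici 0)) a φ₀ k ω X f →
      (∀ i : Fin r, X i 0 = y₀ i) → ∃ B, ∀ t ∈ timeDomain ω,
        (∀ i ≤ r, ‖auxError (shiftedFunnel a φ₀ t)
          (fun i => X i t - iteratedDerivWithin i yref (Ici 0) t) i‖ ≤ k) ∧
        ∀ i < r, ‖X i t‖ ≤ B) :
    ∃ y, IsSolution R Γ yref a φ₀ y₀ ⊤ y ∧
      ∀ ω z, IsSolution R Γ yref a φ₀ y₀ ω z → EqOn y z (timeDomain ω) := by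
  have hr := D.one_le
  obtain ⟨X, f, hX, hX0, hXc, hXi⟩ := D.exists_isTrajectory y₀
  obtain ⟨B, hXB⟩ := hB ⊤ X f hX hX0
  have hmem : ∀ t : ℝ, 0 ≤ t → t ∈ timeDomain ⊤ := fun t ht => timeDomain_top ▸ ht
  obtain ⟨hs, -⟩ := hX.isSolution (F := ∑ i : Fin r, matNorm (R i) * B +
      matNorm Γ * (k * alpha (k ^ 2))) hr hX0 (fun t ht => (hXB t (hmem t ht)).1) fun t ht =>
    hX.norm_rhs_le D.avail D.k_lt_one (hmem t ht) (hXB t (hmem t ht)).1 (hXB t (hmem t ht)).2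
  refine ⟨X 0, hs, fun ω z hz t ht => ?_⟩
  have hZ := hz.isTrajectory k
  obtain ⟨B', hZB⟩ := hB ω _ _ hZ hz.initial
  have hsub := Icc_subset_timeDomain ht
  have hZc : ContinuousOn (fun s => fun i : Fin r => iteratedDerivWithin (i : ℕ) z (timeDomain ω) s)
      (Icc 0 t) := continuousOn_pi.2 fun i => (hZ.cont i i.2).mono hsub
  have hXc' := hXc.mono (Icc_subset_Ici_self : Icc 0 t ⊆ Ici 0)
  -- The a priori bounds make freezing ineffective along both functions, so they solve the same
  -- Lipschitz equation. As the global solution is independent of `z`, no continuation argument for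
  -- maximal solutions is needed.
  have key := integral_solution_unique (F := cutField R Γ
      (fun i => iteratedDerivWithin i yref (Ici 0)) a φ₀ k) (T := t) (x₀ := y₀)
    (fun s hs => D.norm_cutField_sub_le hs) hXc' hZc
    (fun s hs => D.intervalIntegrable_cutField hs.1 (hXc'.mono (Icc_subset_Icc_right hs.2)))
    (fun s hs => D.intervalIntegrable_cutField hs.1 (hZc.mono (Icc_subset_Icc_right hs.2)))
    (fun s hs => hXi s hs.1) fun s hs => ?_
  · have := congrFun (key ⟨ht.1, le_rfl⟩) ⟨0, hr⟩
    simpa using this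
  · rw [hZ.integral_cutField D (fun t ht => (hZB t ht).1) (hsub hs)]
    congr 1
    exact funext hz.initial

/-- Boundedness of the input and of the output along global solutions. -/
theorem Design.bounded_of_isSolution
    (D : Design R Γ (fun i => iteratedDerivWithin i yref (Ici 0)) a φ₀ d c μ C k M KY κ)
    {y : ℝ → Vec m} (hy : IsSolution R Γ yref a φ₀ y₀ ⊤ y) {B : ℝ}
    (hB : ∀ t, 0 ≤ t → (∀ i ≤ r, ‖loopError yref a φ₀ ⊤ y i t‖ ≤ k) ∧
      ∀ i < r, ‖iteratedDerivWithin i y (Ici 0) t‖ ≤ B) :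
    MemLp (control r yref a φ₀ ⊤ y) ∞ (volume.restrict (Ici 0)) ∧ MemSobolevInf r y := by
  have hr := D.one_le
  have hD : timeDomain ⊤ = Ici 0 := timeDomain_top
  have hmem : ∀ t : ℝ, 0 ≤ t → t ∈ timeDomain ⊤ := fun t ht => hD ▸ ht
  have hX := hy.isTrajectory k
  have hcont : ∀ i < r, ContinuousOn (iteratedDerivWithin i y (Ici 0)) (Ici 0) := by
    intro i hi
    have := hX.cont i hi
    rwa [hD] at this
  -- Along the solution the control equals its frozen version, which is continuous off the jumps.
  have hmeas : AEStronglyMeasurable (control r yref a φ₀ ⊤ y) (volume.restrict (Ici 0)) := by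
    refine (aestronglyMeasurable_of_countable measurableSet_Ici D.avail.countable_jumpSet
      fun t ht hj => D.cutControl_continuousWithinAt (x := fun t i =>
        iteratedDerivWithin i y (timeDomain ⊤) t) subset_rfl ht hj fun i hi => ?_).congr ?_
    · rw [hD]; exact hcont i hi t ht
    · rw [Filter.EventuallyEq, ae_restrict_iff' measurableSet_Ici]
      exact Eventually.of_forall fun t ht => Design.cutControl_eq (hB t ht).1
  have hcbd : ∀ t, 0 ≤ t → ‖control r yref a φ₀ ⊤ y t‖ ≤ k * alpha (k ^ 2) := fun t ht =>
    norm_control_le D.avail ht D.k_lt_one ((hB t ht).1 r le_rfl)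
  have hctrl : MemLp (control r yref a φ₀ ⊤ y) ∞ (volume.restrict (Ici 0)) := by
    refine memLp_top_of_bound hmeas (k * alpha (k ^ 2)) ?_
    rw [ae_restrict_iff' measurableSet_Ici]
    exact Eventually.of_forall hcbd
  have hrhs : MemLp (loopRHS R Γ yref a φ₀ ⊤ y) ∞ (volume.restrict (Ici 0)) := by
    refine memLp_top_of_bound (AEStronglyMeasurable.add ?_
      ((continuous_toEuclideanLin Γ).comp_aestronglyMeasurable hmeas)) _
      ((ae_restrict_iff' measurableSet_Ici).2 (Eventually.of_forall fun t ht =>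
        hX.norm_rhs_le D.avail D.k_lt_one (B := B) (hmem t ht) (hB t ht).1 ?_))
    · rw [hD]
      exact (continuousOn_linear_sum hcont).aestronglyMeasurable measurableSet_Ici
    · rw [hD]; exact (hB t ht).2
  -- The classical derivatives serve up to order `r - 1`; the right-hand side of the equation is the
  -- weak derivative of order `r`.
  refine ⟨hctrl, fun i => if i < r then iteratedDerivWithin i y (Ici 0)
    else loopRHS R Γ yref a φ₀ ⊤ y, ?_, fun i _ => ?_, fun i hi => ?_⟩
  · exact (if_pos (Nat.lt_of_succ_le hr)).trans iteratedDerivWithin_zero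
  · show MemLp (if i < r then _ else _) _ _
    split_ifs with hi
    · exact memLp_top_of_continuousOn (hcont i hi) fun t ht => (hB t ht).2 i hi
    · exact hrhs
  · show HasWeakDeriv (if i < r then _ else _) (if i + 1 < r then _ else _)
    rw [if_pos hi]
    split_ifs with hi1
    · refine hasWeakDeriv_of_integral (fun T hT => ?_) fun t ht => ?_
      · have := hX.intervalIntegrable hi1 (hmem T hT)
        rwa [hD] at this
      · have := hX.integral_succ hi1 (hmem t ht)
        rwa [hD] at this
    · obtain rfl : i = r - 1 := by omega
      refine hasWeakDeriv_of_integral (fun T hT => hX.integrable T (hmem T hT)) fun t ht => ?_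
      have := hX.integral t (hmem t ht)
      rwa [hD] at this

/-- The design yields a priori bounds for all trajectories with the given initial values. -/
theorem exists_design {β Δ δ q : ℝ} (hr : 1 ≤ r) (hΓ : (Γ + Γ.transpose).PosDef)
    (hβ : ∑ i, matNorm (R i) ≤ β - 1)
    (hyc : ContinuousOn yref (Ici 0)) (hy : MemSobolevInf r yref) (ha : IsAvailability a)
    (hδ : 0 < δ) (hloss : LossAtMost a Δ) (havail : AvailableAtLeast a δ)
    (hq : q ∈ Ioo (0 : ℝ) 1) (hφ : φ₀ ∈ funnelFunctions)
    (hqE : φ₀ 0 * (supNorm (refState r yref) * (1 + Real.exp (β * Δ)) + Real.exp (β * Δ)) *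
      designA r q ≤ q)
    (hd : IsGrowthConst φ₀ d) (hchi : chi r q d φ₀ (initErr yref y₀) ≤ φ₀ δ)
    (hinit : ∀ i ∈ Finset.Icc 1 r, ‖auxError (φ₀ 0) (initErr yref y₀) i‖ < 1) :
    ∃ (c μ : ℕ → ℝ) (C k M KY κ : ℝ),
      Design R Γ (fun i => iteratedDerivWithin i yref (Ici 0)) a φ₀ d c μ C k M KY κ ∧
      ∀ (ω : EReal) (X : ℕ → ℝ → Vec m) (f : ℝ → Vec m),
        IsTrajectory R Γ (fun i => iteratedDerivWithin i yref (Ici 0)) a φ₀ k ω X f →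
        (∀ i : Fin r, X i 0 = y₀ i) → ∃ B, ∀ t ∈ timeDomain ω,
          (∀ i ≤ r, ‖auxError (shiftedFunnel a φ₀ t)
            (fun i => X i t - iteratedDerivWithin i yref (Ici 0) t) i‖ ≤ k) ∧
          ∀ i < r, ‖X i t‖ ≤ B := by
  have hφ0 : 0 < φ₀ 0 := (hφ.2.1 0 0 le_rfl le_rfl).1
  have hc := errorConsts_cmu hd.1.le hφ0 hq hinit
  have hcb := cmu_bounds hd.1.le hφ0 hq hinit
  obtain ⟨hYc, hYd, -, M, hM0, hM⟩ := reference_regularity hr hyc hy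
  have hxr : ∀ t, 0 ≤ t → ‖stack r (fun i => iteratedDerivWithin i yref (Ici 0) t)‖ ≤
      supNorm (refState r yref) := fun t ht => norm_refState_le hr hyc hy ht
  have hxr0 : 0 ≤ supNorm (refState r yref) := ENNReal.toReal_nonneg
  obtain ⟨κ, hκ, hgain⟩ := exists_coercive hΓ
  have hdrift : 0 ≤ driftBound R (fun k => (cmu q d φ₀ (initErr yref y₀) k).1)
      (supNorm (refState r yref)) (φ₀ 0) :=
    Finset.sum_nonneg fun i _ => mul_nonneg (matNorm_nonneg _)
      (add_nonneg hxr0 (div_nonneg (add_nonneg zero_le_one (hc.gain_nonneg i.2)) hφ0.le))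
  -- The radius `C` dominates the initial top error and `q` through the value of `cmu` at `r`, and
  -- is close enough to one for the damping to beat the drift, whose bound involves only the radii
  -- below the top.
  obtain ⟨C, hbC, hC0, hC1, htop⟩ := exists_lt_alpha_mul
    (b := (cmu q d φ₀ (initErr yref y₀) r).1) hκ
    (add_nonneg (add_nonneg (div_nonneg (hcb r le_rfl).2.2 hφ0.le) hdrift) hM0) (hcb r le_rfl).2.1
  obtain ⟨k, hk1, hk⟩ := exists_errorBd_lt hc.c_lt_one hC1
  have D : Design R Γ (fun i => iteratedDerivWithin i yref (Ici 0)) a φ₀ d _ _ C k M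
      (supNorm (refState r yref)) κ :=
    ⟨hr, ha, hφ, hd, hYc, hYd, fun i hi t ht => (norm_le_norm_stack
      (fun i => iteratedDerivWithin i yref (Ici 0) t) hi).trans (hxr t ht),
      hM, hM0, hxr0, hc, hgain, hC0, hC1, htop, hk1, hk⟩
  have hle : ∀ i ≤ r, (cmu q d φ₀ (initErr yref y₀) i).1 ≤
      errorBd r (fun k => (cmu q d φ₀ (initErr yref y₀) k).1) C i := by
    intro i hi
    unfold errorBd
    split_ifs with h
    · exact le_rfl
    · obtain rfl : i = r := by omega
      exact hbC
  refine ⟨_, _, C, k, M, _, κ, D, fun ω X f hX hX0 => ?_⟩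
  have hb := hX.bounds D hδ hloss havail hβ hxr le_rfl hchi hq.1.le hq.2 hqE
    (fun i hi hi1 => ?_) fun i hi hi1 => ?_
  · exact ⟨_, fun t ht => D.bounded_of_bounds ht.1 (hb t ht).1 (hb t ht).2⟩
  · refine le_trans ?_ (hle i hi)
    obtain ⟨i, rfl⟩ := Nat.exists_eq_add_of_le' hi1
    exact (le_cmu_fst q d φ₀ (initErr yref y₀) i).1
  · refine le_trans ?_ (hle i hi)
    rw [auxError_congr (n := r) (ε' := initErr yref y₀) (fun j hj => ?_) i hi]
    · obtain ⟨i, rfl⟩ := Nat.exists_eq_add_of_le' hi1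
      exact (le_cmu_fst q d φ₀ (initErr yref y₀) i).2
    · rw [initErr, dif_pos hj, ← hX0 ⟨j, hj⟩]

end ClosedLoop

end FunnelControl

/-! ### The theorem on the closed loop -/

theorem mainTheorem2 {n m r : ℕ} (hr : 1 ≤ r) (hn : n = r * m)
    -- the system, with trivial internal dynamics (the state of the latter has dimension 0)
    (β : ℝ) (A : Matrix (Fin n) (Fin n) ℝ) (B : Matrix (Fin n) (Fin m) ℝ)
    (C : Matrix (Fin m) (Fin n) ℝ) (R : Fin r → Matrix (Fin m) (Fin m) ℝ)
    (S : Matrix (Fin m) (Fin 0) ℝ) (Q : Matrix (Fin 0) (Fin 0) ℝ) (P : Matrix (Fin 0) (Fin m) ℝ)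
    (hsys : FunnelControl.InSystemClass (FunnelControl.trivialParams β) A B C R S Q P)
    (y₀ : Fin r → FunnelControl.Vec m)
    -- the reference signal (its continuous representative)
    (yref : ℝ → FunnelControl.Vec m) (hyref_cont : ContinuousOn yref (Set.Ici 0))
    (hyref : FunnelControl.MemSobolevInf r yref)
    -- arbitrary loss duration and availability time
    (a : ℝ → ℝ) (ha : FunnelControl.IsAvailability a) (Δ δ : ℝ) (hΔ : 0 < Δ) (hδ : 0 < δ)
    (hloss : FunnelControl.LossAtMost a Δ) (havail : FunnelControl.AvailableAtLeast a δ)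
    -- the design parameters
    (q : ℝ) (hq : q ∈ Set.Ioo (0 : ℝ) 1) (ηs : ℝ)
    (hηs : FunnelControl.IsEtaStar r (FunnelControl.trivialParams β) q Δ δ yref ηs)
    (φ₀ : ℝ → ℝ) (hφ₀ : φ₀ ∈ FunnelControl.funnelFunctions)
    (hφ₀_init : FunnelControl.FunnelInitCond r (FunnelControl.trivialParams β) q Δ δ yref ηs φ₀)
    (d : ℝ) (hd : FunnelControl.IsGrowthConst φ₀ d)
    (hφ₀_chi : ∃ ρ ∈ Set.Ioo 0 δ,
      FunnelControl.chi r q d φ₀ (FunnelControl.initErr yref y₀) ≤ φ₀ ρ)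
    -- the initial condition `‖e_i(0)‖ < 1`, `i = 1, …, r`
    (hinit : ∀ i ∈ Finset.Icc 1 r,
      ‖FunnelControl.auxError (FunnelControl.shiftedFunnel a φ₀ 0)
        (FunnelControl.initErr yref y₀) i‖ < 1) :
    (∃ (ω : EReal) (y : ℝ → FunnelControl.Vec m),
      FunnelControl.IsSolution R (FunnelControl.gainMatrix r A B C) yref a φ₀ y₀ ω y) ∧
    (∀ (ω : EReal) (y : ℝ → FunnelControl.Vec m),
      FunnelControl.IsSolution R (FunnelControl.gainMatrix r A B C) yref a φ₀ y₀ ω y →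
      ∃ (ω' : EReal) (y' : ℝ → FunnelControl.Vec m),
        FunnelControl.IsMaximalSolution R (FunnelControl.gainMatrix r A B C) yref a φ₀ y₀ ω' y' ∧
        ω ≤ ω' ∧ Set.EqOn y' y (FunnelControl.timeDomain ω)) ∧
    (∀ (ω : EReal) (y : ℝ → FunnelControl.Vec m),
      FunnelControl.IsMaximalSolution R (FunnelControl.gainMatrix r A B C) yref a φ₀ y₀ ω y →
      -- the solution is global
      ω = ⊤ ∧
      -- the error evolves in the shifted funnel
      (∀ t : ℝ, 0 ≤ t → FunnelControl.shiftedFunnel a φ₀ t * ‖y t - yref t‖ < 1) ∧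
      -- the feedback law is well defined along the solution
      (∀ t : ℝ, 0 ≤ t → ∀ i ∈ Finset.Icc 1 r, ‖FunnelControl.loopError yref a φ₀ ω y i t‖ < 1) ∧
      -- the input is bounded, and so are the output and its derivatives up to order `r`
      MeasureTheory.MemLp (FunnelControl.control r yref a φ₀ ω y) ⊤
        (MeasureTheory.volume.restrict (Set.Ici 0)) ∧
      FunnelControl.MemSobolevInf r y) := by
  have hβ : ∑ i, FunnelControl.matNorm (R i) ≤ β - 1 := by
    simpa [FunnelControl.trivialParams] using hsys.R_bound
  have ha0 : a 0 = 1 := havail.1 0 ⟨le_rfl, hδ.le⟩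
  have hφ0 : FunnelControl.shiftedFunnel a φ₀ 0 = φ₀ 0 := by
    rw [FunnelControl.shiftedFunnel_of_available le_rfl le_rfl (Or.inl rfl)
      (fun s hs => absurd hs.1 (not_lt.2 hs.2)) ha0, sub_zero]
  rw [hφ0] at hinit
  have hA : 0 < FunnelControl.designA r q := by
    have := FunnelControl.alpha_pos (FunnelControl.sq_lt_one hq.1.le hq.2)
    unfold FunnelControl.designA FunnelControl.geomPoly
    exact Finset.sum_pos (fun i _ => pow_pos this i) ⟨0, by simp⟩
  have hE : FunnelControl.errorBound r (FunnelControl.trivialParams β) Δ δ yref ηs =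
      FunnelControl.supNorm (FunnelControl.refState r yref) * (1 + Real.exp (β * Δ)) +
        Real.exp (β * Δ) := by
    simp [FunnelControl.errorBound, FunnelControl.trivialParams]
  have hE0 : 0 < FunnelControl.supNorm (FunnelControl.refState r yref) *
      (1 + Real.exp (β * Δ)) + Real.exp (β * Δ) := by
    have : 0 ≤ FunnelControl.supNorm (FunnelControl.refState r yref) := ENNReal.toReal_nonneg
    positivity
  have hqE : φ₀ 0 * (FunnelControl.supNorm (FunnelControl.refState r yref) *
      (1 + Real.exp (β * Δ)) + Real.exp (β * Δ)) * FunnelControl.designA r q ≤ q := by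
    have h := hφ₀_init.2
    rw [hE, le_div_iff₀ (mul_pos hA hE0)] at h
    rwa [mul_assoc, mul_comm _ (FunnelControl.designA r q)]
  have hchi : FunnelControl.chi r q d φ₀ (FunnelControl.initErr yref y₀) ≤ φ₀ δ := by
    obtain ⟨ρ, hρ, h⟩ := hφ₀_chi
    exact h.trans (hφ₀.2.1 ρ δ hρ.1.le hρ.2.le).2
  obtain ⟨c, μ, C', k, M, KY, κ, D, hB⟩ := FunnelControl.exists_design hr hsys.gain_posDef hβ
    hyref_cont hyref ha hδ hloss havail hq hφ₀ hqE hd hchi hinit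
  obtain ⟨y, hy, hext⟩ := D.exists_global_solution hB
  -- A solution on the half-line has no proper extension; one that agrees with all others settles
  -- existence, extension and maximality together.
  refine ⟨⟨⊤, y, hy⟩, fun ω z hz => ⟨⊤, y, ⟨hy, fun ω' _ _ h => absurd h not_top_lt⟩, le_top,
    hext ω z hz⟩, fun ω z hz => ?_⟩
  obtain rfl : ω = ⊤ := by
    by_contra h
    exact hz.2 ⊤ y hy (lt_top_iff_ne_top.2 h) (hext ω z hz.1)
  obtain ⟨B, hzB⟩ := hB ⊤ _ _ (hz.1.isTrajectory k) hz.1.initial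
  have hmem : ∀ t : ℝ, 0 ≤ t → t ∈ FunnelControl.timeDomain ⊤ := fun t ht =>
    FunnelControl.timeDomain_top ▸ ht
  have hk : ∀ t : ℝ, 0 ≤ t → ∀ i ≤ r,
      ‖FunnelControl.loopError yref a φ₀ ⊤ z i t‖ ≤ k := fun t ht => (hzB t (hmem t ht)).1
  refine ⟨rfl, fun t ht => ?_, fun t ht i hi =>
    (hk t ht i (Finset.mem_Icc.1 hi).2).trans_lt D.k_lt_one, ?_⟩
  -- The funnel estimate is the case `i = 1`, since the dummy error `e_0` is zero and hence `e_1 = φ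
  -- e`.
  · have h := (hk t ht 1 hr).trans_lt D.k_lt_one
    have h0 : 0 ≤ FunnelControl.shiftedFunnel a φ₀ t :=
      (FunnelControl.shiftedFunnel_mem_Icc ha hφ₀.2.1 ⟨ht, le_rfl⟩).1
    rwa [FunnelControl.loopError, FunnelControl.auxError_succ, FunnelControl.auxError_zero,
      FunnelControl.gain_zero, add_zero, norm_smul, Real.norm_of_nonneg h0,
      FunnelControl.errDeriv, iteratedDerivWithin_zero, iteratedDerivWithin_zero] at h
  · refine D.bounded_of_isSolution (B := B) hz.1 fun t ht => ⟨hk t ht, ?_⟩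
    have := (hzB t (hmem t ht)).2
    rwa [FunnelControl.timeDomain_top] at this
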